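/- **Setting.** Fix integers $n_1,n_2\ge 2$ and put $n=n_1+n_2$. For every dimension $p$, let $X_{kj}\in\mathbb R^p$ ($k=1,2$, $1\le j\le n_k$, training data) and $Y_1,Y_2\in\mathbb R^p$ (test data of class 1 and 2) be independent; $X_{k1},\dots,X_{kn_k},Y_k$ have a common absolutely continuous distribution with mean $\mu_{(k)}$ and covariance matrix $\Sigma_{(k)}=\sum_{i=1}^p\lambda_{(k),i}u_{(k),i}u_{(k),i}^\top$, with $u_{(k),1},\dots,u_{(k),p}$ orthonormal. Put $\mu=\mu_{(1)}-\mu_{(2)}$. Assume, as $p\to\infty$: 1. $p^{-1/2}\|\mu\|\to\delta>0$. 2. (One strong spike in each class.) $\lambda_{(k),1}=\sigma_{(k)}^2p+\tau_{(k),1}^2$ and $\lambda_{(k),i}=\tau_{(k),i}^2$ for $i\ge2$, where $\sigma_{(k)}^2>0$, the numbers $\tau_{(k),i}^2>0$ are uniformly bounded, and $p^{-1}\sum_{i\le p}\tau_{(k),i}^2\to\tau_k^2>0$. 3. For every observation $X$ of class $k$ and every $p$, the vector of scores $(\lambda_{(k),i}^{-1/2}u_{(k),i}^\top(X-\mu_{(k)}))_{i\le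 p}$ consists of the first $p$ elements of an infinite random sequence not depending on $p$, which has uniformly bounded fourth moments and is $\rho$-mixing under some permutation. Write $z_{kj}$ for the first score of $X_{kj}$. 4. $u_{(k),1}^\top\mu\ge0$ and $\mathrm{Angle}(u_{(k),1},\mu)\to\theta_{(k)}\in[0,\pi/2]$ for $k=1,2$. 5. (One common spike, $m=1$.) $\mathcal U=\mathrm{span}(u_{(1),1},u_{(2),1})$ has dimension $1$ for all $p$, and there is a unit vector $u_1\in\mathcal U$ (for every $p$) with $u_1^\top\mu\ge0$, $\mathrm{Angle}(u_1,\mu)\to\theta\in[0,\pi/2]$, and $u_1^\top u_{(k),1}$ convergent for $k=1,2$. Assume moreover $\tau_1^2>\tau_2^2$. **Directions.** Let $\bar X_k$ be the sample mean of class $k$, $d=\bar X_1-\bar X_2$, $S_W=\sum_{k,j}(X_{kj}-\bar X_k)(X_{kj}-\bar X_k)^\top$, with eigenvalues $\hat\lambda_1\ge\dots\ge\hat\lambda_p$ and any corresponding orthonormal eigenvectors $\hat u_1,\dots,\hat u_p$. Let $\mathcal D$ be the set of those $i\in\{1,\dots,n-2\}$ for which $\mathrm{Angle}(\hat u_i,\mathcal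 U)$ does not converge to $\pi/2$ in probability. For $\alpha\in\mathbb R$ let $v_\alpha$ be the unit vector proportional to $$\sum_{i\in\mathcal D}\frac{\alpha p}{\hat\lambda_i+\alpha p}\,\hat u_i\hat u_i^\top d+\sum_{i=n-1}^{p}\hat u_i\hat u_i^\top d .$$ For $k=1,2$ let $\hat\alpha_k$ be an estimator with $\hat\alpha_k\to-\tau_k^2$ in probability. For a sequence of directions $w$, let $D(w)$ be the probability limit of $p^{-1/2}|w^\top(Y_1-Y_2)|$ as $p\to\infty$ (a random variable). Finally let $\Phi_k=\sigma_{(k)}^2\sum_{j=1}^{n_k}(z_{kj}-\bar z_k)^2$ with $\bar z_k=n_k^{-1}\sum_jz_{kj}$. **Theorem.** The limits $D(v_{\hat\alpha_1})$ and $D(v_{\hat\alpha_2})$ exist, and: (i) If $\theta>0$, then with probability $1$, $$D(v_{\hat\alpha_1})\le D(v_{\hat\alpha_2})\iff\tau_1^{-2}\Phi_1\le\tau_2^{-2}\Phi_2,\qquad D(v_{\hat\alpha_1})>D(v_{\hat\alpha_2})\iff\tau_1^{-2}\Phi_1>\tau_2^{-2}\Phi_2 .$$ (ii) If all observations are Gaussian,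 then $$\mathbb P\left(\tau_1^{-2}\Phi_1\le\tau_2^{-2}\Phi_2\right)=\mathbb P\left(F\le\frac{(n_2-1)\,\tau_2^{-2}\sigma_{(2)}^2}{(n_1-1)\,\tau_1^{-2}\sigma_{(1)}^2}\right),\qquad F\sim F(n_1-1,n_2-1).$$ -/

import Mathlib

open MeasureTheory ProbabilityTheory Filter Topology
open scoped ENNReal RealInnerProductSpace

namespace HDLSS

noncomputable section

/-- `ℝ^p` with its Euclidean norm. -/
abbrev E (p : ℕ) : Type := EuclideanSpace ℝ (Fin p)

/-! ### `ρ`-mixing sequences, chi-squared and `F` distributions -/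

/-- The correlation of two real random variables (`0` if one of them has variance `0`). -/
def corr {Ω : Type*} [MeasurableSpace Ω] (P : Measure Ω) (f g : Ω → ℝ) : ℝ :=
  cov[f, g; P] / (√(Var[f; P]) * √(Var[g; P]))

/-- The `σ`-field generated by the variables `Z i`, `i ∈ s`. -/
@[reducible] def sigmaField {Ω : Type*} (Z : ℕ → Ω → ℝ) (s : Set ℕ) : MeasurableSpace Ω :=
  ⨆ i ∈ s, MeasurableSpace.comap (Z i) inferInstance

/-- The `ρ`-mixing coefficient with lag `l`: the supremum of `|Corr(f, g)|` over all `j`, all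
square-integrable `f` measurable with respect to `σ(Z i : i ≤ j)` and all square-integrable `g`
measurable with respect to `σ(Z i : i ≥ j + l)`. -/
def rhoCoeff {Ω : Type*} [MeasurableSpace Ω] (P : Measure Ω) (Z : ℕ → Ω → ℝ) (l : ℕ) : ℝ≥0∞ :=
  ⨆ (j : ℕ) (f : Ω → ℝ) (g : Ω → ℝ)
    (_ : Measurable[sigmaField Z (Set.Iic j)] f ∧ MemLp f 2 P)
    (_ : Measurable[sigmaField Z (Set.Ici (j + l))] g ∧ MemLp g 2 P),
    ENNReal.ofReal |corr P f g|

/-- A sequence of random variables is `ρ`-mixing if its `ρ`-mixing coefficients tend to `0`. -/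
def RhoMixing {Ω : Type*} [MeasurableSpace Ω] (P : Measure Ω) (Z : ℕ → Ω → ℝ) : Prop :=
  Tendsto (rhoCoeff P Z) atTop (𝓝 0)

/-- The chi-squared distribution with `d` degrees of freedom: the law of the sum of squares of `d`
independent standard normal variables. -/
def chiSquared (d : ℕ) : Measure ℝ :=
  (Measure.pi fun _ : Fin d => gaussianReal 0 1).map fun x => ∑ i, x i ^ 2

/-- The `F(d₁, d₂)` distribution: the law of `(V₁ / d₁) / (V₂ / d₂)` for independent chi-squared
variables `V₁`, `V₂` with `d₁` and `d₂` degrees of freedom. -/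
def fDistribution (d₁ d₂ : ℕ) : Measure ℝ :=
  ((chiSquared d₁).prod (chiSquared d₂)).map fun v => (v.1 / d₁) / (v.2 / d₂)

/-! ### The two-class model

Class `1` of the mathematical text is `(0 : Fin 2)` and class `2` is `(1 : Fin 2)`. The `i`-th
component, eigenvalue or eigenvector of the text has index `i - 1`. The observations of class `k`
are indexed by `Option (Fin (n k))`: `some j` is a training observation, `none` is the independent
test observation. -/

/-- Data of the two-class model in all dimensions `p`: the observations, the class means, the
eigenvalues and an orthonormal eigenbasis of the class covariance matrices, and the infinite
sequences of principal component scores. -/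
structure Model (Ω : Type*) (n : Fin 2 → ℕ) where
  /-- the observations in dimension `p` -/
  X : (p : ℕ) → (k : Fin 2) → Option (Fin (n k)) → Ω → E p
  /-- the class means -/
  mean : (p : ℕ) → Fin 2 → E p
  /-- the eigenvalues of the class covariance matrices -/
  eigval : (p : ℕ) → Fin 2 → Fin p → ℝ
  /-- the eigenvectors of the class covariance matrices -/
  eigvec : (p : ℕ) → Fin 2 → OrthonormalBasis (Fin p) ℝ (E p)
  /-- the principal component scores of each observation -/
  z : (k : Fin 2) → Option (Fin (n k)) → ℕ → Ω → ℝ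

variable {Ω : Type*} {n : Fin 2 → ℕ}

/-- The population mean difference `μ = μ₍₁₎ - μ₍₂₎`. -/
def Model.μ (M : Model Ω n) (p : ℕ) : E p := M.mean p 0 - M.mean p 1

/-- The first (leading) eigenvector of the covariance matrix of class `k`. -/
def Model.leading (M : Model Ω n) (p : ℕ) (k : Fin 2) : E p :=
  if h : 0 < p then M.eigvec p k ⟨0, h⟩ else 0

/-- The common leading eigenspace of the two classes (one strong spike in each class). -/
def Model.leadingSpace (M : Model Ω n) (p : ℕ) : Submodule ℝ (E p) :=
  Submodule.span ℝ {M.leading p 0, M.leading p 1}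

/-- In every dimension the observations are independent random vectors; those of class `k` have one
common absolutely continuous distribution, with mean `mean p k` and covariance matrix
`∑ i, eigval p k i • (eigvec p k i) (eigvec p k i)ᵀ`. -/
structure Model.IsSample [MeasurableSpace Ω] (M : Model Ω n) (P : Measure Ω) : Prop where
  measurable : ∀ p k o, Measurable (M.X p k o)
  memLp : ∀ p k o, MemLp (M.X p k o) 2 P
  indep : ∀ p, iIndepFun (fun o : (k : Fin 2) × Option (Fin (n k)) => M.X p o.1 o.2) P
  identDistrib : ∀ p k o o', IdentDistrib (M.X p k o) (M.X p k o') P P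
  absolutelyContinuous : ∀ p k o, P.map (M.X p k o) ≪ volume
  mean_eq : ∀ p k o, ∫ ω, M.X p k o ω ∂P = M.mean p k
  cov_eq : ∀ p k o (x y : E p),
    cov[fun ω => ⟪x, M.X p k o ω⟫, fun ω => ⟪y, M.X p k o ω⟫; P] =
      ∑ i, M.eigval p k i * ⟪x, M.eigvec p k i⟫ * ⟪y, M.eigvec p k i⟫

/-- The parameters of the one-component strong-spike model. -/
structure Params where
  /-- limit of `p^{-1/2} ‖μ‖` -/
  δ : ℝ
  /-- the signals `σ²₍ₖ₎,₁` -/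
  σsq : Fin 2 → ℝ
  /-- the individual tail eigenvalues `τ²₍ₖ₎,ᵢ` -/
  tailsq : Fin 2 → ℕ → ℝ
  /-- the averaged tail eigenvalues `τ²ₖ` -/
  τsq : Fin 2 → ℝ
  /-- limiting angle between the leading eigenvector of class `k` and `μ` -/
  θlead : Fin 2 → ℝ
  /-- limiting angle between the common leading eigenspace and `μ` -/
  θ : ℝ
  /-- limit of the coefficient of the leading eigenvector of class `k` in the basis of the common
  leading eigenspace -/
  R : Fin 2 → ℝ

/-- Mean difference: `p^{-1/2} ‖μ‖ → δ > 0`. -/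
structure Model.MeanDifference (M : Model Ω n) (c : Params) : Prop where
  δ_pos : 0 < c.δ
  tendsto : Tendsto (fun p : ℕ => ‖M.μ p‖ / √(p : ℝ)) atTop (𝓝 c.δ)

/-- Eigenvalues, with exactly one strong spike in each class (`m₁ = m₂ = 1`, `β₁ = β₂ = 1`):
`λ₍ₖ₎,₁ = σ²₍ₖ₎,₁ p + τ²₍ₖ₎,₁` and `λ₍ₖ₎,ᵢ = τ²₍ₖ₎,ᵢ` for `i ≥ 2`. -/
structure Model.OneStrongSpike (M : Model Ω n) (c : Params) : Prop where
  σsq_pos : ∀ k, 0 < c.σsq k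
  tailsq_pos : ∀ k i, 0 < c.tailsq k i
  τsq_pos : ∀ k, 0 < c.τsq k
  eigval_eq : ∀ p k (i : Fin p), M.eigval p k i =
    if (i : ℕ) = 0 then c.σsq k * p + c.tailsq k 0 else c.tailsq k i
  bounded : ∃ B, ∀ k i, c.tailsq k i ≤ B
  tendsto : ∀ k, Tendsto (fun p : ℕ => (∑ i ∈ Finset.range p, c.tailsq k i) / p) atTop
    (𝓝 (c.τsq k))

/-- Principal component scores: for every `p`, the vector `Λ₍ₖ₎^{-1/2} U₍ₖ₎ᵀ (X - μ₍ₖ₎)` of an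
observation consists of the first `p` elements of an infinite sequence that is `ρ`-mixing under
some permutation; fourth moments are uniformly bounded. -/
structure Model.Scores [MeasurableSpace Ω] (M : Model Ω n) (P : Measure Ω) : Prop where
  score_eq : ∀ p k o ω (i : Fin p),
    ⟪M.eigvec p k i, M.X p k o ω - M.mean p k⟫ / √(M.eigval p k i) = M.z k o i ω
  memLp : ∀ k o i, MemLp (M.z k o i) 4 P
  bounded : ∃ B, ∀ k o i, ∫ ω, M.z k o i ω ^ 4 ∂P ≤ B
  mixing : ∀ k o, ∃ π : Equiv.Perm ℕ, RhoMixing P fun i => M.z k o (π i)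

/-- Limiting angles between the leading eigenvectors and `μ`; the leading eigenvectors are oriented
such that their inner products with `μ` are nonnegative. -/
structure Model.LeadingAngles (M : Model Ω n) (c : Params) : Prop where
  inner_nonneg : ∀ p k, 0 ≤ ⟪M.leading p k, M.μ p⟫
  mem : ∀ k, c.θlead k ∈ Set.Icc 0 (Real.pi / 2)
  tendsto : ∀ k, Tendsto (fun p => InnerProductGeometry.angle (M.leading p k) (M.μ p)) atTop
    (𝓝 (c.θlead k))

/-- The common leading eigenspace has dimension `m = 1` for all `p`, and an orthonormal basis `u`
of it whose angle to `μ` converges to `θ` and for which the coefficients of the leading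
eigenvectors converge. (The limits `R k` are then `1` or `-1`, so `[R 0, R 1]` has rank `1`.) -/
structure Model.CommonLeadingSpace (M : Model Ω n) (c : Params) : Prop where
  finrank_eq : ∀ p, 0 < p → Module.finrank ℝ (M.leadingSpace p) = 1
  mem : c.θ ∈ Set.Icc 0 (Real.pi / 2)
  basis : ∃ u : (p : ℕ) → E p,
    (∀ p, 0 < p → ‖u p‖ = 1 ∧ u p ∈ M.leadingSpace p) ∧
    (∀ p, 0 ≤ ⟪u p, M.μ p⟫) ∧
    Tendsto (fun p => InnerProductGeometry.angle (u p) (M.μ p)) atTop (𝓝 c.θ) ∧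
    ∀ k, Tendsto (fun p => ⟪u p, M.leading p k⟫) atTop (𝓝 (c.R k))

/-! ### Sample quantities -/

/-- The sample mean of class `k`. -/
def Model.sampleMean (M : Model Ω n) (p : ℕ) (k : Fin 2) (ω : Ω) : E p :=
  (n k : ℝ)⁻¹ • ∑ j : Fin (n k), M.X p k (some j) ω

/-- The sample mean difference vector `d`. -/
def Model.d (M : Model Ω n) (p : ℕ) (ω : Ω) : E p := M.sampleMean p 0 ω - M.sampleMean p 1 ω

/-- The within-class scatter matrix
`S_W = ∑ₖ ∑ⱼ (Xₖⱼ - X̄ₖ) (Xₖⱼ - X̄ₖ)ᵀ`, as a linear map. -/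
def Model.withinScatter (M : Model Ω n) (p : ℕ) (ω : Ω) : E p →L[ℝ] E p :=
  ∑ k, ∑ j : Fin (n k), InnerProductSpace.rankOne ℝ
    (M.X p k (some j) ω - M.sampleMean p k ω) (M.X p k (some j) ω - M.sampleMean p k ω)

/-- A choice, in every dimension and for every outcome, of `p` real numbers and of an orthonormal
basis of `ℝ^p`. -/
structure SampleEigen (Ω : Type*) where
  /-- the sample eigenvalues -/
  eigval : (p : ℕ) → Ω → Fin p → ℝ
  /-- the sample eigenvectors -/
  eigvec : (p : ℕ) → Ω → OrthonormalBasis (Fin p) ℝ (E p)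

/-- The choice is an eigendecomposition of `S_W`, with the eigenvalues in descending order. -/
def SampleEigen.IsEigenOf (S : SampleEigen Ω) (M : Model Ω n) : Prop :=
  ∀ p ω, Antitone (S.eigval p ω) ∧
    ∀ i, M.withinScatter p ω (S.eigvec p ω i) = S.eigval p ω i • S.eigvec p ω i

/-- The angle between a vector and a subspace: the angle between the vector and its orthogonal
projection (`π / 2` if the projection is `0`). -/
def angleSubspace {p : ℕ} (w : E p) (V : Submodule ℝ (E p)) : ℝ :=
  InnerProductGeometry.angle w (V.starProjection w)

/-- The index set `𝓓` of those `i ∈ {1, …, n - 2}` (here: `i + 2 < n`, as indices start at `0`) for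
which the `i`-th sample eigenvector is not strongly inconsistent with the common leading
eigenspace, that is, for which the angle between them does not converge to `π / 2` in
probability. -/
def signalIndices [MeasurableSpace Ω] (P : Measure Ω) (M : Model Ω n) (S : SampleEigen Ω) :
    Set ℕ :=
  {i | i + 2 < n 0 + n 1 ∧
    ¬ TendstoInMeasure P
      (fun p ω => if h : i < p then angleSubspace (S.eigvec p ω ⟨i, h⟩) (M.leadingSpace p)
        else Real.pi / 2)
      atTop (fun _ => Real.pi / 2)}

open Classical in
/-- The projected ridged linear discriminant vector before normalization, with `α_p = α p`:
`∑_{i ∈ 𝓓} α_p / (λ̂ᵢ + α_p) ûᵢ ûᵢᵀ d + Û₂ Û₂ᵀ d`, where `Û₂` has the columns `ûᵢ` with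
`i ≥ n - 1` (here: `n ≤ i + 2`, as indices start at `0`). -/
def ridgeVector (M : Model Ω n) (S : SampleEigen Ω) (D : Set ℕ) (p : ℕ) (α : ℝ) (ω : Ω) : E p :=
  (∑ i : Fin p, if (i : ℕ) ∈ D then
      (α * p / (S.eigval p ω i + α * p) * ⟪S.eigvec p ω i, M.d p ω⟫) • S.eigvec p ω i else 0) +
    ∑ i : Fin p, if n 0 + n 1 ≤ (i : ℕ) + 2 then
      ⟪S.eigvec p ω i, M.d p ω⟫ • S.eigvec p ω i else 0

/-- The projected ridged linear discriminant vector `v_α` with ridge parameter `α`, a multiple of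
`ridgeVector` of norm `1`. -/
def projectedRidge [MeasurableSpace Ω] (P : Measure Ω) (M : Model Ω n) (S : SampleEigen Ω)
    (p : ℕ) (α : ℝ) (ω : Ω) : E p :=
  ‖ridgeVector M S (signalIndices P M S) p α ω‖⁻¹ •
    ridgeVector M S (signalIndices P M S) p α ω

/-- `D` is the asymptotic distance between the two piles of independent test data along the
sequence of directions `w`: the probability limit of `p^{-1/2} |wᵀ (Y₁ - Y₂)|` for test
observations `Y₁`, `Y₂` of the two classes. -/
def IsAsymptoticDistance [MeasurableSpace Ω] (P : Measure Ω) (M : Model Ω n)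
    (w : (p : ℕ) → Ω → E p) (D : Ω → ℝ) : Prop :=
  TendstoInMeasure P
    (fun p ω => |⟪w p ω, M.X p 0 none ω - M.X p 1 none ω⟫| / √(p : ℝ)) atTop D

/-- The scaled variance `Φₖ = Wᵀ (I - n_k⁻¹ J) W` of the leading principal component scores
`W = σ₍ₖ₎,₁ z₍ₖ₎,₁` of the training observations of class `k`. -/
def Model.Φ (M : Model Ω n) (c : Params) (k : Fin 2) (ω : Ω) : ℝ :=
  let W : Fin (n k) → ℝ := fun j => √(c.σsq k) * M.z k (some j) 0 ω
  let J : Matrix (Fin (n k)) (Fin (n k)) ℝ := Matrix.of fun _ _ => 1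
  W ⬝ᵥ Matrix.mulVec (1 - (n k : ℝ)⁻¹ • J) W

end

end HDLSS

/-! Everything is scaled by `p^{-1/2}`. Write `τ_k` for the averaged tail eigenvalue `c.τsq k`. A
scaled observation is its scaled mean, plus its leading score times a multiple of the common
direction `u`, plus a residual. The leading scores do not depend on `p`. Residuals of different
observations become orthogonal to each other and to deterministic vectors of convergent norm, and
their squared norms tend to `τ_k` by mixing (`tendsto_norm_sq_resid`). So, once the leading scores
are fixed at `z`, inner products of linear combinations of the data whose class totals are opposite
converge (`tendsto_inner_scaled`). On centered coefficients the Gram form tends to `w wᵀ + diag(τ_k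
(I - n_k⁻¹ J))`, where `w` consists of the centered leading scores times `±σ_k`; the block `w_k` has
squared norm `Φ_k`.

This form lives in dimension `n - 2`. Each `τ_k` is an eigenvalue of multiplicity `n_k - 2` with
eigenvectors orthogonal to `w`. The other two eigenvalues satisfy `∑ |w_k|² / (ℓ - τ_k) = 1`; one
lies above `τ_1`, the other between `τ_2` and `τ_1`. Hence only sample eigenvectors number `1` and
`n_1` detect `u`, which identifies `𝓓` (`signalIndices_eq`). The eigenvalue equation and Parseval's
identity then evaluate the ridge sums (`sum_ridgeWeight`, `sum_ridgeWeight_sq`): ridging with `-τ_k`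
cancels the component of `d` along `u`. If `κ` is the limit of that component, the asymptotic
distance is `δ² sin² θ / √(g + κ² τ_k / Φ_k)` with `g` independent of `k` (`tendsto_ridge`). Since
`κ ≠ 0` almost surely, comparing distances amounts to comparing `Φ_k / τ_k`.

Sample eigenvectors are neither unique nor assumed measurable. Limits are therefore taken along
ultrafilters on `ℕ × Ω` that refine convergence in probability and keep the leading scores near `z`.
Compactness provides limit spectra, and the resulting distance depends on `z` alone, so
`tendstoInMeasure_of_localised` returns to convergence in probability. Part (ii) is Cochran's
theorem applied to the independent scatters `Φ_k / σ_k²`. -/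

namespace HDLSS

/-! ### Convergence in probability as a filter, and localisation at values of a random variable -/

section ConvergenceInProbability

variable {Ω : Type*} [MeasurableSpace Ω]

/-- The filter of the sets `A ⊆ ℕ × Ω` whose sections at `p` have outer probability tending to `1`
as `p → ∞`. Convergence along it is convergence in (outer) probability. -/
def probFilter (P : Measure Ω) : Filter (ℕ × Ω) where
  sets := {A | Tendsto (fun p => P {ω | (p, ω) ∉ A}) atTop (𝓝 0)}
  univ_sets := by simp
  sets_of_superset := by
    intro A B hA hAB
    exact tendsto_of_tendsto_of_tendsto_of_le_of_le tendsto_const_nhds hA (fun _ => zero_le)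
      fun p => measure_mono fun ω hω h => hω (hAB h)
  inter_sets := by
    intro A B hA hB
    have h := Tendsto.add (Set.mem_ofPred_eq ▸ hA) (Set.mem_ofPred_eq ▸ hB)
    rw [add_zero] at h
    refine tendsto_of_tendsto_of_tendsto_of_le_of_le tendsto_const_nhds h (fun _ => zero_le)
      fun p => (measure_mono ?_).trans (measure_union_le _ _)
    intro ω hω
    by_contra hc
    simp only [Set.mem_union, Set.mem_ofPred_eq, not_or, not_not] at hc
    exact hω hc

lemma mem_probFilter {P : Measure Ω} {A : Set (ℕ × Ω)} :
    A ∈ probFilter P ↔ Tendsto (fun p => P {ω | (p, ω) ∉ A}) atTop (𝓝 0) := Iff.rfl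

lemma tendsto_fst_probFilter (P : Measure Ω) : Tendsto Prod.fst (probFilter P) atTop := by
  intro s hs
  rw [mem_map, mem_probFilter]
  refine tendsto_const_nhds.congr' ?_
  filter_upwards [hs] with p hp
  simp [hp]

instance probFilter_neBot (P : Measure Ω) [IsProbabilityMeasure P] : (probFilter P).NeBot := by
  rw [neBot_iff]
  intro h
  have h0 : (∅ : Set (ℕ × Ω)) ∈ probFilter P := by rw [h]; exact mem_bot
  rw [mem_probFilter] at h0
  simp only [Set.mem_empty_iff_false, not_false_eq_true, Set.ofPred_true, measure_univ] at h0
  exact one_ne_zero (tendsto_nhds_unique tendsto_const_nhds h0)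

lemma tendstoInMeasure_iff_tendsto_probFilter {P : Measure Ω} {F : ℕ → Ω → ℝ} {D : Ω → ℝ} :
    TendstoInMeasure P F atTop D ↔
      Tendsto (fun x : ℕ × Ω => F x.1 x.2 - D x.2) (probFilter P) (𝓝 0) := by
  rw [tendstoInMeasure_iff_dist, Metric.tendsto_nhds]
  refine forall₂_congr fun ε _ => ?_
  rw [Filter.Eventually, mem_probFilter]
  simp [dist_eq_norm]

/-- Chebyshev's criterion. -/
lemma tendsto_probFilter_of_sq {P : Measure Ω} {F : ℕ → Ω → ℝ}
    (hF : ∀ᶠ p in atTop, MemLp (F p) 2 P)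
    (h : Tendsto (fun p => ∫ ω, F p ω ^ 2 ∂P) atTop (𝓝 0)) :
    Tendsto (fun x : ℕ × Ω => F x.1 x.2) (probFilter P) (𝓝 0) := by
  rw [Metric.tendsto_nhds]
  intro ε hε
  rw [Filter.Eventually, mem_probFilter]
  have h' : Tendsto (fun p => ENNReal.ofReal ((∫ ω, F p ω ^ 2 ∂P) / ε ^ 2)) atTop (𝓝 0) := by
    simpa using ENNReal.tendsto_ofReal (h.div_const (ε ^ 2))
  refine tendsto_of_tendsto_of_tendsto_of_le_of_le' tendsto_const_nhds h'
    (Eventually.of_forall fun _ => zero_le) ?_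
  filter_upwards [hF] with p hp
  have hi : Integrable (fun ω => F p ω ^ 2) P := hp.integrable_sq
  have hm := mul_meas_ge_le_integral_of_nonneg (μ := P)
    (Eventually.of_forall fun ω => sq_nonneg (F p ω)) hi (ε ^ 2)
  have hs : {ω | (p, ω) ∉ {x : ℕ × Ω | dist (F x.1 x.2) 0 < ε}} ⊆
      {ω | ε ^ 2 ≤ F p ω ^ 2} := by
    intro ω hω
    simp only [dist_zero_right, Real.norm_eq_abs, Set.mem_ofPred_eq, not_lt] at hω ⊢
    rw [← sq_abs (F p ω)]
    exact pow_le_pow_left₀ hε.le hω 2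
  refine (measure_mono hs).trans ?_
  have hε2 : 0 < ε ^ 2 := by positivity
  rw [ENNReal.le_ofReal_iff_toReal_le]
  · rw [le_div_iff₀ hε2, mul_comm]; exact hm
  · have := meas_ge_le_lintegral_div (μ := P) (f := fun ω => ENNReal.ofReal (F p ω ^ 2))
      hi.aestronglyMeasurable.aemeasurable.ennreal_ofReal
      (ε := ENNReal.ofReal (ε ^ 2)) (by simpa using hε.ne') ENNReal.ofReal_ne_top
    refine ne_top_of_le_ne_top ?_ ((measure_mono ?_).trans this)
    · refine ENNReal.div_ne_top ?_ (by simpa using hε.ne')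
      have := hi.lintegral_lt_top
      exact this.ne
    · intro ω hω
      exact ENNReal.ofReal_le_ofReal hω
  · positivity

/-- A continuous mapping theorem with random limit: a family `F` of possibly nonmeasurable variables
that converges to `D z₀` whenever `Z` is localised at a point `z₀` of a set of full measure
converges in probability to `D ∘ Z`. -/
lemma tendstoInMeasure_of_localised {𝒵 : Type*} [TopologicalSpace 𝒵] [SecondCountableTopology 𝒵]
    [MeasurableSpace 𝒵] [OpensMeasurableSpace 𝒵] {P : Measure Ω} [IsFiniteMeasure P]
    {Z : Ω → 𝒵} (hZ : Measurable Z) {O : Set 𝒵} (hO : ∀ᵐ ω ∂P, Z ω ∈ O)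
    {D : 𝒵 → ℝ} (hD : ∀ z ∈ O, ContinuousAt D z) {F : ℕ → Ω → ℝ}
    (hF : ∀ z ∈ O, Tendsto (fun x : ℕ × Ω => F x.1 x.2)
      (probFilter P ⊓ comap (fun x => Z x.2) (𝓝 z)) (𝓝 (D z))) :
    TendstoInMeasure P F atTop (fun ω => D (Z ω)) := by
  rw [tendstoInMeasure_iff_tendsto_probFilter, Metric.tendsto_nhds]
  intro ε hε
  have key : ∀ z ∈ O, ∃ N : Set 𝒵, IsOpen N ∧ z ∈ N ∧ ∃ A ∈ probFilter P,
      ∀ x ∈ A, Z x.2 ∈ N → dist (F x.1 x.2 - D (Z x.2)) 0 < ε := by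
    intro z hz
    have h1 : Tendsto (fun x : ℕ × Ω => D (Z x.2))
        (probFilter P ⊓ comap (fun x => Z x.2) (𝓝 z)) (𝓝 (D z)) :=
      ((hD z hz).tendsto.comp tendsto_comap).mono_left inf_le_right
    have h2 := (hF z hz).sub h1
    rw [sub_self, Metric.tendsto_nhds] at h2
    obtain ⟨A, hA, B, hB, hAB⟩ := mem_inf_iff_superset.1 (h2 ε hε)
    obtain ⟨N', hN', hNB⟩ := mem_comap.1 hB
    obtain ⟨N, hN, hNo, hzN⟩ := mem_nhds_iff.1 hN'
    exact ⟨N, hNo, hzN, A, hA, fun x hx hxN => hAB ⟨hx, hNB (hN hxN)⟩⟩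
  choose! N hNo hzN A hA hAN using key
  -- Lindelöf: countably many of the neighbourhoods cover `O`, so finitely many of them capture `Z`
  -- up to small probability. Finitely many sets `A` can then be intersected inside the filter.
  obtain ⟨T, hTO, hTc, hT⟩ := TopologicalSpace.countable_cover_nhdsWithin (s := O) (f := N)
    fun z hz => mem_nhdsWithin_of_mem_nhds ((hNo z hz).mem_nhds (hzN z hz))
  rcases T.eq_empty_or_nonempty with hTe | hTn
  · have hO' : O = ∅ := by simpa [hTe] using hT
    have hP : P Set.univ = 0 := by
      have := hO
      simp only [hO', Set.mem_empty_iff_false] at this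
      simpa [ae_iff] using this
    rw [Filter.Eventually, mem_probFilter]
    have : ∀ s : Set Ω, P s = 0 := fun s => measure_mono_null (Set.subset_univ s) hP
    simp [this]
  obtain ⟨t, rfl⟩ := hTc.exists_eq_range hTn
  have htO : ∀ m, t m ∈ O := fun m => hTO ⟨m, rfl⟩
  have hlim : Tendsto (fun m => P (⋂ i ≤ m, {ω | Z ω ∉ N (t i)})) atTop (𝓝 0) := by
    have h0 : P (⋂ m, ⋂ i ≤ m, {ω | Z ω ∉ N (t i)}) = 0 := by
      refine measure_mono_null ?_ (ae_iff.1 hO)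
      intro ω hω hωO
      obtain ⟨y, ⟨m, rfl⟩, hm⟩ := Set.mem_iUnion₂.1 (hT hωO)
      simp only [Set.mem_iInter] at hω
      exact hω m m le_rfl hm
    rw [← h0]
    refine tendsto_measure_iInter_atTop (fun m => ?_) ?_ ⟨0, measure_ne_top _ _⟩
    · refine (MeasurableSet.biInter (Set.to_countable _) fun i _ => ?_).nullMeasurableSet
      exact (hZ (hNo _ (htO i)).measurableSet).compl
    · intro a b hab
      exact Set.biInter_mono (fun i hi => le_trans hi hab) fun _ _ => subset_rfl
  rw [Filter.Eventually, mem_probFilter]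
  rw [ENNReal.tendsto_nhds_zero]
  intro η hη
  have hη2 : 0 < η / 2 := ENNReal.half_pos hη.ne'
  obtain ⟨m, hm⟩ := (ENNReal.tendsto_nhds_zero.1 hlim (η / 2) hη2).exists
  have hAm : (⋂ i ∈ Finset.Iic m, A (t i)) ∈ probFilter P :=
    (biInter_finset_mem _).2 fun i _ => hA _ (htO i)
  rw [mem_probFilter] at hAm
  filter_upwards [ENNReal.tendsto_nhds_zero.1 hAm (η / 2) hη2] with p hp
  rw [← ENNReal.add_halves η]
  refine le_trans (measure_mono ?_) ((measure_union_le _ _).trans (add_le_add hm hp))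
  intro ω hω
  by_contra hc
  simp only [Set.mem_union, Set.mem_iInter, Set.mem_ofPred_eq, not_or, not_forall, not_not,
    Finset.mem_Iic] at hc hω
  obtain ⟨⟨i, hi, hiN⟩, hc2⟩ := hc
  exact hω (hAN _ (htO i) _ (by_contra fun h => hc2 ⟨i, hi, h⟩) hiN)

/-- If `Z` takes values in `O` almost surely, then it can be localised at some point of `O`. -/
lemma exists_neBot_localised {𝒵 : Type*} [TopologicalSpace 𝒵] [SecondCountableTopology 𝒵]
    [MeasurableSpace 𝒵] [OpensMeasurableSpace 𝒵] {P : Measure Ω} [IsProbabilityMeasure P]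
    {Z : Ω → 𝒵} (hZ : Measurable Z) {O : Set 𝒵} (hO : ∀ᵐ ω ∂P, Z ω ∈ O) :
    ∃ z ∈ O, (probFilter P ⊓ comap (fun x => Z x.2) (𝓝 z)).NeBot := by
  -- Were every localised filter trivial, the constant `0` would converge in probability to `1`.
  by_contra! hc
  have h := tendstoInMeasure_of_localised hZ hO (D := fun _ => 1) (fun z _ => continuousAt_const)
    (F := fun _ _ => 0) (fun z hz => by rw [hc z hz]; exact tendsto_bot)
  rw [tendstoInMeasure_iff_tendsto_probFilter] at h
  have := tendsto_nhds_unique h tendsto_const_nhds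
  norm_num at this

end ConvergenceInProbability

/-! ### Spectrum of the limiting Gram form and the ridge sums -/

section LimitSpectrum

/-- The standard inner product of two families of coefficients, one for every training
observation. -/
def dot {n : Fin 2 → ℕ} (a b : (k : Fin 2) → Fin (n k) → ℝ) : ℝ := ∑ k, ∑ j, a k j * b k j

/-- The contribution of class `k` to `dot`. -/
def blockDot {n : Fin 2 → ℕ} (k : Fin 2) (a b : (k : Fin 2) → Fin (n k) → ℝ) : ℝ :=
  ∑ j, a k j * b k j

/-- The coefficients of every class add up to zero. -/
def Centered {n : Fin 2 → ℕ} (a : (k : Fin 2) → Fin (n k) → ℝ) : Prop := ∀ k, ∑ j, a k j = 0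

/-- The part of `a` belonging to class `k`. -/
def block {n : Fin 2 → ℕ} (k : Fin 2) (a : (k : Fin 2) → Fin (n k) → ℝ) :
    (k : Fin 2) → Fin (n k) → ℝ := fun k' j => if k' = k then a k' j else 0

variable {n : Fin 2 → ℕ} {N : ℕ} {τ : Fin 2 → ℝ} {w a b c : (k : Fin 2) → Fin (n k) → ℝ}
  {y : Fin N → (k : Fin 2) → Fin (n k) → ℝ} {ℓ : Fin N → ℝ}

lemma dot_eq : dot a b = blockDot 0 a b + blockDot 1 a b := Fin.sum_univ_two _

lemma dot_comm : dot a b = dot b a := by simp only [dot, mul_comm]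

lemma dot_add_left : dot (a + b) c = dot a c + dot b c := by
  simp [dot, add_mul, Finset.sum_add_distrib]

lemma dot_smul_left (t : ℝ) : dot (t • a) c = t * dot a c := by
  simp only [dot, Finset.mul_sum, Pi.smul_apply, smul_eq_mul, mul_assoc]

lemma dot_sub_left : dot (a - b) c = dot a c - dot b c := by
  simp [dot, sub_mul, Finset.sum_sub_distrib]

lemma dot_sum_left {ι : Type*} (s : Finset ι) (f : ι → (k : Fin 2) → Fin (n k) → ℝ) :
    dot (∑ i ∈ s, f i) c = ∑ i ∈ s, dot (f i) c := by
  induction s using Finset.cons_induction with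
  | empty => simp [dot]
  | cons i s hi ih => rw [Finset.sum_cons, Finset.sum_cons, dot_add_left, ih]

lemma blockDot_self_nonneg (k : Fin 2) : 0 ≤ blockDot k a a :=
  Finset.sum_nonneg fun _ _ => mul_self_nonneg _

lemma eq_zero_of_blockDot_self {k : Fin 2} (h : blockDot k a a = 0) : a k = 0 := by
  funext j
  have := (Finset.sum_eq_zero_iff_of_nonneg fun j _ => mul_self_nonneg (a k j)).1 h j
    (Finset.mem_univ j)
  simpa using this

lemma eq_zero_of_dot_self (h : dot a a = 0) : a = 0 := by
  rw [dot_eq] at h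
  have h0 := blockDot_self_nonneg (a := a) 0
  have h1 := blockDot_self_nonneg (a := a) 1
  funext k
  fin_cases k
  · exact eq_zero_of_blockDot_self (k := 0) (by linarith)
  · exact eq_zero_of_blockDot_self (k := 1) (by linarith)

lemma dot_block (k : Fin 2) : dot a (block k b) = blockDot k a b := by
  simp [dot, block, blockDot]

lemma Centered.block (h : Centered a) (k : Fin 2) : Centered (block k a) := by
  intro k'
  by_cases hk : k' = k
  · simpa [HDLSS.block, hk] using h k'
  · simp [HDLSS.block, hk]

/-- The `j`-th coordinate vector of class `k`, centered. -/
noncomputable def deviation (k : Fin 2) (j : Fin (n k)) : (k : Fin 2) → Fin (n k) → ℝ :=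
  block k fun _ j' => if (j' : ℕ) = j then 1 - (n k : ℝ)⁻¹ else - (n k : ℝ)⁻¹

lemma sum_smul_deviation {F : Type*} [AddCommGroup F] [Module ℝ F] (k : Fin 2) (j : Fin (n k))
    (f : Fin (n k) → F) :
    ∑ j', deviation k j k j' • f j' = f j - (n k : ℝ)⁻¹ • ∑ j', f j' := by
  have : ∀ j' : Fin (n k), deviation k j k j' • f j' =
      (if j' = j then f j' else 0) - (n k : ℝ)⁻¹ • f j' := by
    intro j'
    by_cases hj : j' = j
    · simp only [deviation, block, hj, if_true]; module
    · simp only [deviation, block, if_true, if_neg hj, if_neg fun hh => hj (Fin.ext hh)]; module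
  simp only [this, Finset.sum_sub_distrib, ← Finset.smul_sum]
  simp

lemma deviation_of_ne {k k' : Fin 2} (h : k' ≠ k) (j : Fin (n k)) :
    deviation k j k' = 0 := by
  funext j'
  simp [deviation, block, h]

lemma deviation_centered (k : Fin 2) (hn : (n k : ℝ) ≠ 0) (j : Fin (n k)) :
    Centered (deviation k j) := by
  intro k'
  rcases eq_or_ne k' k with rfl | hk
  · have := sum_smul_deviation k' j fun _ => (1 : ℝ)
    simpa [hn] using this
  · simp [deviation_of_ne hk]

lemma dot_deviation (ha : Centered a) (k : Fin 2) (j : Fin (n k)) :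
    dot a (deviation k j) = a k j := by
  have h := sum_smul_deviation k j (a k)
  rw [ha k, smul_zero, sub_zero] at h
  rw [← h, dot_comm, dot, Finset.sum_eq_single k]
  · rfl
  · intro k' _ hk
    simp [deviation_of_ne hk]
  · simp

/-- The nonzero part of the spectrum of `w wᵀ + diag(τ₁ (I - n₁⁻¹ J), τ₂ (I - n₂⁻¹ J))`: the vectors
`y i` are orthogonal eigenvectors to the eigenvalues `ℓ i`, with square norm `ℓ i`, listed in
descending order. -/
structure LimitSpectrum (n : Fin 2 → ℕ) (N : ℕ) (τ : Fin 2 → ℝ) (w : (k : Fin 2) → Fin (n k) → ℝ)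
    (y : Fin N → (k : Fin 2) → Fin (n k) → ℝ) (ℓ : Fin N → ℝ) : Prop where
  card : N + 2 = n 0 + n 1
  two_le : ∀ k, 2 ≤ n k
  τ_pos : ∀ k, 0 < τ k
  τ_lt : τ 1 < τ 0
  w_centered : Centered w
  w_pos : ∀ k, 0 < blockDot k w w
  antitone : Antitone ℓ
  orth : ∀ i i', dot (y i) (y i') = if i = i' then ℓ i else 0
  centered : ∀ i, Centered (y i)
  gram : ∀ a b, Centered a → Centered b →
    ∑ i, dot (y i) a * dot (y i) b = dot w a * dot w b + ∑ k, τ k * blockDot k a b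

/-- The limit of the inner product of the leading eigenvector with the `i`-th sample eigenvector. -/
noncomputable def loading (w : (k : Fin 2) → Fin (n k) → ℝ)
    (y : Fin N → (k : Fin 2) → Fin (n k) → ℝ)
    (ℓ : Fin N → ℝ) (i : Fin N) : ℝ := dot (y i) w / ℓ i

namespace LimitSpectrum

variable (h : LimitSpectrum n N τ w y ℓ)
include h

/-- The Gram form is positive definite on centered coefficients: evaluated at `a` it is a sum of
nonnegative terms containing `τ k * blockDot k a a` with `τ k > 0`. -/
lemma ext_of_dot {a : (k : Fin 2) → Fin (n k) → ℝ} (ha : Centered a)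
    (h0 : ∀ i, dot (y i) a = 0) : a = 0 := by
  have hg := h.gram a a ha ha
  simp only [h0, mul_zero, Finset.sum_const_zero, Fin.sum_univ_two] at hg
  have h0 := mul_nonneg (h.τ_pos 0).le (blockDot_self_nonneg (a := a) 0)
  have h1 := mul_nonneg (h.τ_pos 1).le (blockDot_self_nonneg (a := a) 1)
  have h2 := mul_self_nonneg (dot w a)
  have e0 : blockDot 0 a a = 0 :=
    (mul_eq_zero.1 (by linarith : τ 0 * blockDot 0 a a = 0)).resolve_left (h.τ_pos 0).ne'
  have e1 : blockDot 1 a a = 0 :=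
    (mul_eq_zero.1 (by linarith : τ 1 * blockDot 1 a a = 0)).resolve_left (h.τ_pos 1).ne'
  exact eq_zero_of_dot_self (by rw [dot_eq, e0, e1, add_zero])

/-- A dimension count excludes `y i = 0`. The functionals `dot (y i)` and the two class sums
separate points, and there are `N + 2 = n 0 + n 1` of them, so they are linearly independent. -/
lemma ℓ_pos (i : Fin N) : 0 < ℓ i := by
  let T : ((k : Fin 2) → Fin (n k) → ℝ) →ₗ[ℝ] (Fin N ⊕ Fin 2 → ℝ) :=
    { toFun := fun a => Sum.elim (fun i => dot (y i) a) (fun k => ∑ j, a k j)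
      map_add' := by
        intro a b
        funext s
        rcases s with i | k
        · simp only [Sum.elim_inl, Pi.add_apply]
          rw [dot_comm, dot_add_left, dot_comm, dot_comm (a := b)]
        · simp [Finset.sum_add_distrib]
      map_smul' := by
        intro t a
        funext s
        rcases s with i | k
        · simp only [Sum.elim_inl, Pi.smul_apply, RingHom.id_apply, smul_eq_mul]
          rw [dot_comm, dot_smul_left, dot_comm]
        · simp [Finset.mul_sum] }
  have hinj : Function.Injective T := by
    rw [← LinearMap.ker_eq_bot, LinearMap.ker_eq_bot']
    intro a ha
    exact h.ext_of_dot (fun k => congrFun ha (Sum.inr k)) fun i => congrFun ha (Sum.inl i)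
  have hdim : Module.finrank ℝ ((k : Fin 2) → Fin (n k) → ℝ) =
      Module.finrank ℝ (Fin N ⊕ Fin 2 → ℝ) := by
    rw [Module.finrank_pi_fintype]
    simp [h.card]
  obtain ⟨a, ha⟩ := (LinearMap.injective_iff_surjective_of_finrank_eq_finrank hdim).1 hinj
    (Pi.single (Sum.inl i) 1)
  have h1 : dot (y i) a = 1 := by simpa [T] using congrFun ha (Sum.inl i)
  have h2 : ℓ i = dot (y i) (y i) := by simp [h.orth]
  have h3 : 0 ≤ ℓ i := by
    rw [h2, dot_eq]
    exact add_nonneg (blockDot_self_nonneg 0) (blockDot_self_nonneg 1)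
  refine h3.lt_of_ne fun h0 => ?_
  have : y i = 0 := eq_zero_of_dot_self (by rw [← h2, ← h0])
  rw [this] at h1
  simp [dot] at h1

/-- The vectors `y i / √(ℓ i)` form an orthonormal basis of the centered coefficients. Only `b` has
to be centered, because `b` is the one that is expanded. -/
lemma parseval (hb : Centered b) :
    ∑ i, dot (y i) a * dot (y i) b / ℓ i = dot a b := by
  have hb' : b = ∑ i, (dot (y i) b / ℓ i) • y i := by
    rw [← sub_eq_zero]
    refine h.ext_of_dot ?_ fun i => ?_
    · intro k
      simp only [Pi.sub_apply, Finset.sum_sub_distrib, hb k, Finset.sum_apply, Pi.smul_apply,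
        smul_eq_mul, zero_sub, neg_eq_zero]
      rw [Finset.sum_comm]
      refine Finset.sum_eq_zero fun i _ => ?_
      rw [← Finset.mul_sum, h.centered i k, mul_zero]
    · rw [dot_comm, dot_sub_left, dot_sum_left, sub_eq_zero]
      simp only [dot_smul_left, h.orth, mul_ite, mul_zero]
      rw [Finset.sum_ite_eq' Finset.univ i]
      simp [(h.ℓ_pos i).ne', dot_comm]
  conv_rhs => rw [dot_comm, hb', dot_sum_left]
  refine Finset.sum_congr rfl fun i _ => ?_
  rw [dot_smul_left]
  ring

/-- The eigenvalue equation in coordinates: within each class, `y i` is parallel to `w` unless `ℓ i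
= τ k`. -/
lemma eigen (i : Fin N) (k : Fin 2) (j : Fin (n k)) :
    (ℓ i - τ k) * y i k j = dot (y i) w * w k j := by
  obtain ⟨s, hs⟩ : ∃ s, s = dot (y i) w := ⟨_, rfl⟩
  rw [← hs]
  -- The defect of the equation is itself centered, so the Gram identity can be tested against it
  -- and gives `dot v v = 0`.
  set v : (k : Fin 2) → Fin (n k) → ℝ :=
    fun k j => (ℓ i - τ k) * y i k j - s * w k j with hv
  have hvc : Centered v := by
    intro k
    simp only [hv, Finset.sum_sub_distrib, ← Finset.mul_sum, h.centered i k, h.w_centered k]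
    ring
  have hg := h.gram (y i) v (h.centered i) hvc
  simp only [h.orth, ite_mul, zero_mul, Finset.sum_ite_eq', Finset.mem_univ, if_true] at hg
  have hz : dot v v = 0 := by
    have : dot v v = ℓ i * dot (y i) v - (∑ k, τ k * blockDot k (y i) v) -
        s * dot w v := by
      simp only [dot, blockDot, Finset.mul_sum, ← Finset.sum_sub_distrib]
      refine Finset.sum_congr rfl fun k _ => Finset.sum_congr rfl fun j _ => ?_
      simp only [hv]
      ring
    rw [this, hg, dot_comm (a := w) (b := y i), ← hs]
    ring
  have := congrFun (congrFun (eq_zero_of_dot_self hz) k) j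
  simp only [hv, Pi.zero_apply] at this
  linarith

lemma eigen_blockDot (i : Fin N) (k : Fin 2) :
    (ℓ i - τ k) * blockDot k (y i) w = dot (y i) w * blockDot k w w := by
  simp only [blockDot, Finset.mul_sum]
  refine Finset.sum_congr rfl fun j _ => ?_
  rw [← mul_assoc, h.eigen, mul_assoc]

lemma eigen_blockDot_self (i : Fin N) (k : Fin 2) :
    (ℓ i - τ k) * blockDot k (y i) (y i) = dot (y i) w * blockDot k (y i) w := by
  simp only [blockDot, Finset.mul_sum]
  refine Finset.sum_congr rfl fun j _ => ?_
  rw [← mul_assoc, h.eigen]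
  ring

lemma dot_w_eq_zero {i : Fin N} {k : Fin 2} (hi : ℓ i = τ k) : dot (y i) w = 0 := by
  have := h.eigen_blockDot i k
  rw [hi, sub_self, zero_mul] at this
  exact (mul_eq_zero.1 this.symm).resolve_right (h.w_pos k).ne'

/-- In the class other than `k` the factor `ℓ i - τ` is nonzero because `τ 0 ≠ τ 1`, so that block
product vanishes. The remaining block then carries all of `dot (y i) w`, which is zero. -/
lemma blockDot_w_eq_zero {i : Fin N} {k : Fin 2} (hi : ℓ i = τ k) (k' : Fin 2) :
    blockDot k' (y i) w = 0 := by
  have h0 := h.dot_w_eq_zero hi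
  by_cases hk : k' = k
  · subst hk
    have e := h.eigen_blockDot i
    simp only [h0, zero_mul, mul_eq_zero] at e
    have hne := h.τ_lt
    rw [dot_eq] at h0
    fin_cases k'
    · have := (e 1).resolve_left (by rw [hi]; exact sub_ne_zero.2 hne.ne')
      simpa [this] using h0
    · have := (e 0).resolve_left (by rw [hi]; exact sub_ne_zero.2 hne.ne)
      simpa [this] using h0
  · have e := h.eigen_blockDot i k'
    rw [h0, zero_mul, hi] at e
    refine (mul_eq_zero.1 e).resolve_left (sub_ne_zero.2 ?_)
    have hne := h.τ_lt
    fin_cases k <;> fin_cases k' <;> simp_all [hne.ne, hne.ne']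

lemma dot_w_ne_zero {i : Fin N} (hi : ∀ k, ℓ i ≠ τ k) : dot (y i) w ≠ 0 := by
  intro h0
  have : y i = 0 := by
    funext k j
    have := h.eigen i k j
    rw [h0, zero_mul] at this
    exact (mul_eq_zero.1 this).resolve_left (sub_ne_zero.2 (hi k))
  have h2 := h.orth i i
  rw [this] at h2
  simp only [if_true] at h2
  have := h.ℓ_pos i
  rw [← h2] at this
  simp [dot] at this

/-- The secular equation. -/
lemma secular {i : Fin N} (hi : ∀ k, ℓ i ≠ τ k) :
    blockDot 0 w w / (ℓ i - τ 0) + blockDot 1 w w / (ℓ i - τ 1) = 1 := by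
  have h0 : ℓ i - τ 0 ≠ 0 := sub_ne_zero.2 (hi 0)
  have h1 : ℓ i - τ 1 ≠ 0 := sub_ne_zero.2 (hi 1)
  have hd := h.dot_w_ne_zero hi
  have e0 := h.eigen_blockDot i 0
  have e1 := h.eigen_blockDot i 1
  have hs : dot (y i) w = blockDot 0 (y i) w + blockDot 1 (y i) w := dot_eq
  have f0 : blockDot 0 (y i) w = dot (y i) w * (blockDot 0 w w / (ℓ i - τ 0)) := by
    field_simp; linarith
  have f1 : blockDot 1 (y i) w = dot (y i) w * (blockDot 1 w w / (ℓ i - τ 1)) := by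
    field_simp; linarith
  rw [f0, f1, ← mul_add] at hs
  exact mul_left_cancel₀ hd (by rw [← hs, mul_one])

/-- Below `τ 1` both terms of the secular equation would be negative, yet they add up to `1`. -/
lemma τ_le (i : Fin N) : τ 1 ≤ ℓ i := by
  by_contra! hlt
  have h0 : ℓ i < τ 0 := hlt.trans h.τ_lt
  have hs := h.secular (i := i) (by intro k; fin_cases k; exacts [h0.ne, hlt.ne])
  have := div_neg_of_pos_of_neg (h.w_pos 0) (sub_neg.2 h0)
  have := div_neg_of_pos_of_neg (h.w_pos 1) (sub_neg.2 hlt)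
  linarith

/-- Two different eigenvalues of signal type do not lie on the same side of `τ 0`. -/
lemma eq_of_mul_pos {i i' : Fin N} (h0 : 0 < (ℓ i - τ 0) * (ℓ i' - τ 0))
    (h1 : 0 < (ℓ i - τ 1) * (ℓ i' - τ 1)) : i = i' := by
  by_contra hne
  have ho := h.orth i i'
  rw [if_neg hne, dot_eq] at ho
  have hi : ∀ k, ℓ i ≠ τ k := by
    intro k hk; fin_cases k <;> simp [hk] at h0 h1
  have hi' : ∀ k, ℓ i' ≠ τ k := by
    intro k hk; fin_cases k <;> simp [hk] at h0 h1
  -- Both eigenvectors are blockwise multiples of `w`, so their inner product is a nonzero number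
  -- times a sum of terms `|w_k|² / ((ℓ i - τ k) (ℓ i' - τ k))`. These are positive, which
  -- contradicts orthogonality. The argument covers repeated eigenvalues as well.
  have key : ∀ k, ((ℓ i - τ k) * (ℓ i' - τ k)) * blockDot k (y i) (y i') =
      dot (y i) w * dot (y i') w * blockDot k w w := by
    intro k
    simp only [blockDot, Finset.mul_sum]
    refine Finset.sum_congr rfl fun j _ => ?_
    calc _ = ((ℓ i - τ k) * y i k j) * ((ℓ i' - τ k) * y i' k j) := by ring
      _ = _ := by rw [h.eigen, h.eigen]; ring
  have e0 : blockDot 0 (y i) (y i') = dot (y i) w * dot (y i') w *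
      (blockDot 0 w w / ((ℓ i - τ 0) * (ℓ i' - τ 0))) := by
    rw [← mul_div_assoc, eq_div_iff h0.ne', ← key 0]; ring
  have e1 : blockDot 1 (y i) (y i') = dot (y i) w * dot (y i') w *
      (blockDot 1 w w / ((ℓ i - τ 1) * (ℓ i' - τ 1))) := by
    rw [← mul_div_assoc, eq_div_iff h1.ne', ← key 1]; ring
  rw [e0, e1, ← mul_add] at ho
  have := div_pos (h.w_pos 0) h0
  have := div_pos (h.w_pos 1) h1
  exact mul_ne_zero (mul_ne_zero (h.dot_w_ne_zero hi) (h.dot_w_ne_zero hi'))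
    (by positivity) ho

/-- The trace of the centering projection of class `k`, computed in the orthonormal basis `y i / √(ℓ
i)`. -/
lemma sum_blockDot (k : Fin 2) : ∑ i, blockDot k (y i) (y i) / ℓ i = n k - 1 := by
  have hn : (n k : ℝ) ≠ 0 := by have := h.two_le k; positivity
  have hye : ∀ i j, dot (y i) (deviation k j) = y i k j := fun i j =>
    dot_deviation (h.centered i) k j
  have hee : ∀ j : Fin (n k), dot (deviation k j) (deviation k j) = 1 - (n k : ℝ)⁻¹ := by
    intro j
    rw [dot_deviation (deviation_centered k hn j)]
    simp [deviation, block]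
  have hp : ∀ j, ∑ i, y i k j * y i k j / ℓ i = 1 - (n k : ℝ)⁻¹ := by
    intro j
    rw [← hee j, ← h.parseval (deviation_centered k hn j)]
    simp only [hye]
  simp only [blockDot, Finset.sum_div]
  rw [Finset.sum_comm]
  simp only [hp, Finset.sum_const, Finset.card_univ, Fintype.card_fin, nsmul_eq_mul]
  field_simp

/-- The multiplicity of `τ k` is a difference of two traces: the centering projection of class `k`,
of trace `n k - 1`, minus the projection onto the line of `w_k`, of trace `1`. -/
lemma card_eq (k : Fin 2) : (Finset.univ.filter fun i => ℓ i = τ k).card + 2 = n k := by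
  have hw := (h.w_pos k).ne'
  have h1 := h.sum_blockDot k
  have h2 : ∑ i, blockDot k (y i) w * blockDot k (y i) w / ℓ i = blockDot k w w := by
    have := h.parseval (a := block k w) (h.w_centered.block k)
    rw [dot_block] at this
    simp only [dot_block] at this
    rw [this]
    simp [blockDot, block]
  -- If `ℓ i = τ k`, then `y i` is supported on class `k` and orthogonal to `w_k`, so the difference
  -- is `1`. Otherwise block `k` of `y i` is a multiple of `w_k`, equality holds in Cauchy–Schwarz,
  -- and the difference is `0`.
  have h3 : ∀ i, (if ℓ i = τ k then (1 : ℝ) else 0) = blockDot k (y i) (y i) / ℓ i -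
      blockDot k (y i) w * blockDot k (y i) w / ℓ i / blockDot k w w := by
    intro i
    have hl := (h.ℓ_pos i).ne'
    split_ifs with hi
    · rw [h.blockDot_w_eq_zero hi]
      have ho := h.orth i i
      rw [if_pos rfl, dot_eq] at ho
      have hz : ∀ k' ≠ k, blockDot k' (y i) (y i) = 0 := by
        intro k' hk
        have e := h.eigen_blockDot_self i k'
        rw [h.blockDot_w_eq_zero hi, mul_zero, hi] at e
        refine (mul_eq_zero.1 e).resolve_left (sub_ne_zero.2 ?_)
        have hne := h.τ_lt
        fin_cases k <;> fin_cases k' <;> simp_all [hne.ne, hne.ne']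
      have : blockDot k (y i) (y i) = ℓ i := by
        fin_cases k
        · have := hz 1 (by simp); simp only [Fin.zero_eta]; linarith
        · have := hz 0 (by simp); simp only [Fin.mk_one]; linarith
      rw [this]
      field_simp
      simp
    · have e1 := h.eigen_blockDot_self i k
      have e2 := h.eigen_blockDot i k
      have hs : ℓ i - τ k ≠ 0 := sub_ne_zero.2 hi
      have : blockDot k (y i) (y i) * blockDot k w w = blockDot k (y i) w * blockDot k (y i) w := by
        apply mul_left_cancel₀ hs
        rw [← mul_assoc, e1, ← mul_assoc, e2]
        ring
      rw [eq_comm, sub_eq_zero, div_right_comm, ← this]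
      field_simp
  have h4 : ((Finset.univ.filter fun i => ℓ i = τ k).card : ℝ) = n k - 1 - 1 := by
    rw [Finset.card_filter]
    push_cast
    rw [Finset.sum_congr rfl fun i _ => h3 i, Finset.sum_sub_distrib, h1, ← Finset.sum_div, h2,
      div_self hw]
  have h5 : ((Finset.univ.filter fun i => ℓ i = τ k).card : ℝ) + 2 = n k := by rw [h4]; ring
  exact_mod_cast h5

lemma card_lt_le_one : (Finset.univ.filter fun i => τ 0 < ℓ i).card ≤ 1 := by
  rw [Finset.card_le_one]
  intro i hi i' hi'
  simp only [Finset.mem_filter, Finset.mem_univ, true_and] at hi hi'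
  have := h.τ_lt
  exact h.eq_of_mul_pos (mul_pos (by linarith) (by linarith)) (mul_pos (by linarith) (by linarith))

lemma card_between_le_one :
    (Finset.univ.filter fun i => τ 1 < ℓ i ∧ ℓ i < τ 0).card ≤ 1 := by
  rw [Finset.card_le_one]
  intro i hi i' hi'
  simp only [Finset.mem_filter, Finset.mem_univ, true_and] at hi hi'
  exact h.eq_of_mul_pos (mul_pos_of_neg_of_neg (by linarith [hi.2]) (by linarith [hi'.2]))
    (mul_pos (by linarith [hi.1]) (by linarith [hi'.1]))

/-- Besides the multiplicities `n k - 2`, exactly two of the `n 0 + n 1 - 2` eigenvalues remain. At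
most one lies in each of the two allowed ranges, so each range contains exactly one. -/
lemma card_split : (Finset.univ.filter fun i => τ 0 < ℓ i).card = 1 ∧
    (Finset.univ.filter fun i => τ 0 ≤ ℓ i).card + 1 = n 0 ∧
    (Finset.univ.filter fun i => τ 1 < ℓ i).card = n 0 := by
  classical
  have hlt := h.τ_lt
  have d1 : (Finset.univ.filter fun i => τ 0 ≤ ℓ i) =
      (Finset.univ.filter fun i => τ 0 < ℓ i) ∪ (Finset.univ.filter fun i => ℓ i = τ 0) := by
    ext i
    simp [le_iff_lt_or_eq, eq_comm]
  have d2 : (Finset.univ.filter fun i => τ 1 < ℓ i) =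
      (Finset.univ.filter fun i => τ 0 ≤ ℓ i) ∪
        (Finset.univ.filter fun i => τ 1 < ℓ i ∧ ℓ i < τ 0) := by
    ext i
    simp only [Finset.mem_filter, Finset.mem_univ, true_and, Finset.mem_union]
    constructor
    · intro hi
      rcases le_or_gt (τ 0) (ℓ i) with hh | hh
      · exact Or.inl hh
      · exact Or.inr ⟨hi, hh⟩
    · rintro (hi | hi)
      · linarith
      · exact hi.1
  have d3 : (Finset.univ : Finset (Fin N)) =
      (Finset.univ.filter fun i => τ 1 < ℓ i) ∪ (Finset.univ.filter fun i => ℓ i = τ 1) := by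
    ext i
    simp only [Finset.mem_filter, Finset.mem_univ, true_and, Finset.mem_union, true_iff]
    rcases (h.τ_le i).lt_or_eq with hh | hh
    · exact Or.inl hh
    · exact Or.inr hh.symm
  have e1 := congrArg Finset.card d1
  have e2 := congrArg Finset.card d2
  have e3 := congrArg Finset.card d3
  rw [Finset.card_union_of_disjoint] at e1 e2 e3
  · have c0 := h.card_eq 0
    have c1 := h.card_eq 1
    have b1 := h.card_lt_le_one
    have b2 := h.card_between_le_one
    have hc := h.card
    rw [Finset.card_univ, Fintype.card_fin] at e3
    omega
  all_goals
    rw [Finset.disjoint_filter]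
    intro i _ h1 h2
    linarith

omit h in
lemma mem_filter_iff_lt_card {p : Fin N → Prop} [DecidablePred p]
    (hp : ∀ i i', i ≤ i' → p i' → p i) (i : Fin N) :
    p i ↔ (i : ℕ) < (Finset.univ.filter p).card := by
  constructor
  · intro hi
    have : Finset.Iic i ⊆ Finset.univ.filter p := by
      intro i' hi'
      simpa using hp i' i (Finset.mem_Iic.1 hi') hi
    have := Finset.card_le_card this
    rw [Fin.card_Iic] at this
    omega
  · intro hi
    by_contra hn
    have : Finset.univ.filter p ⊆ Finset.Iio i := by
      intro i' hi'
      rw [Finset.mem_Iio]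
      by_contra hc
      exact hn (hp i i' (not_lt.1 hc) (by simpa using hi'))
    have := Finset.card_le_card this
    rw [Fin.card_Iio] at this
    omega

/-- In descending order: one eigenvalue above `τ 0`, then `n 0 - 2` copies of `τ 0`, then the
intermediate eigenvalue at position `n 0 - 1` counted from zero, then the copies of `τ 1`. -/
lemma ne_τ_iff (i : Fin N) : (∀ k, ℓ i ≠ τ k) ↔ (i : ℕ) = 0 ∨ (i : ℕ) + 1 = n 0 := by
  obtain ⟨c1, c2, c3⟩ := h.card_split
  have f1 := mem_filter_iff_lt_card (p := fun i => τ 0 < ℓ i)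
    (fun i i' hi hh => hh.trans_le (h.antitone hi)) i
  have f2 := mem_filter_iff_lt_card (p := fun i => τ 0 ≤ ℓ i)
    (fun i i' hi hh => hh.trans (h.antitone hi)) i
  have f3 := mem_filter_iff_lt_card (p := fun i => τ 1 < ℓ i)
    (fun i i' hi hh => hh.trans_le (h.antitone hi)) i
  have g1 : ℓ i ≠ τ 0 ↔ (τ 0 < ℓ i ∨ ¬ τ 0 ≤ ℓ i) := by
    rw [not_le, ne_iff_lt_or_gt, or_comm]
  have g2 : ℓ i ≠ τ 1 ↔ τ 1 < ℓ i := by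
    rw [(h.τ_le i).lt_iff_ne, ne_comm]
  rw [Fin.forall_fin_two, g1, g2, f1, f2, f3]
  omega

lemma loading_ne_zero_iff (i : Fin N) :
    loading w y ℓ i ≠ 0 ↔ (i : ℕ) = 0 ∨ (i : ℕ) + 1 = n 0 := by
  rw [← h.ne_τ_iff]
  refine ⟨fun hb k hk => hb ?_, fun hi => div_ne_zero (h.dot_w_ne_zero hi) (h.ℓ_pos i).ne'⟩
  rw [loading, h.dot_w_eq_zero hk, zero_div]

open Classical in
/-- The limit of the weights of the ridge vector: `α / (ℓ + α)` with `α = - τ k` on the signal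
indices and `0` elsewhere. -/
noncomputable def _root_.HDLSS.ridgeWeight (n : Fin 2 → ℕ) (τ : Fin 2 → ℝ) (k : Fin 2)
    (ℓ : Fin N → ℝ) (i : Fin N) : ℝ :=
  if (i : ℕ) = 0 ∨ (i : ℕ) + 1 = n 0 then -τ k / (ℓ i + -τ k) else 0

/-- On signal indices the eigenvalue equation replaces `dot (y i) w / (ℓ i - τ k)` by `blockDot k (y
i) w / blockDot k w w`. This removes the pole and leaves summands to which Parseval applies. On the
other indices both sides vanish. -/
lemma sum_ridgeWeight_aux (k : Fin 2) (i : Fin N) :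
    (ridgeWeight n τ k ℓ i - 1) * loading w y ℓ i ^ 2 =
      -(dot (y i) w * dot (y i) (block k w) / ℓ i) / blockDot k w w ∧
    (ridgeWeight n τ k ℓ i ^ 2 - 1) * loading w y ℓ i ^ 2 =
      τ k * (dot (y i) (block k w) * dot (y i) (block k w) / ℓ i) / blockDot k w w ^ 2 -
        dot (y i) w * dot (y i) (block k w) / ℓ i / blockDot k w w := by
  have hw := (h.w_pos k).ne'
  have hl := (h.ℓ_pos i).ne'
  by_cases hi : (i : ℕ) = 0 ∨ (i : ℕ) + 1 = n 0
  · have hs : ℓ i - τ k ≠ 0 := sub_ne_zero.2 ((h.ne_τ_iff i).2 hi k)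
    have e := h.eigen_blockDot i k
    have hs' : ℓ i + -τ k ≠ 0 := by rwa [← sub_eq_add_neg]
    have e' : blockDot k (y i) w = dot (y i) w * blockDot k w w / (ℓ i - τ k) := by
      rw [eq_div_iff hs, ← e]; ring
    simp only [ridgeWeight, if_pos hi, loading, dot_block, e', ← sub_eq_add_neg]
    constructor
    · field_simp
      ring
    · field_simp
      ring
  · have hb : dot (y i) w = 0 := by
      have : loading w y ℓ i = 0 := by
        by_contra hc
        exact hi ((h.loading_ne_zero_iff i).1 hc)
      exact (div_eq_zero_iff.1 this).resolve_right hl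
    obtain ⟨k', hk'⟩ : ∃ k', ℓ i = τ k' := by
      by_contra! hc
      exact hi ((h.ne_τ_iff i).1 hc)
    simp [loading, hb, dot_block, h.blockDot_w_eq_zero hk']

/-- The value `-1` is what makes the ridge vector asymptotically orthogonal to the leading
direction. -/
lemma sum_ridgeWeight (k : Fin 2) :
    ∑ i, (ridgeWeight n τ k ℓ i - 1) * loading w y ℓ i ^ 2 = -1 := by
  rw [Finset.sum_congr rfl fun i _ => (h.sum_ridgeWeight_aux k i).1, ← Finset.sum_div,
    Finset.sum_neg_distrib, h.parseval (h.w_centered.block k), dot_block, neg_div,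
    div_self (h.w_pos k).ne']

/-- This sum gives the norm of the ridge vector, and it is the only place where the choice of `k`
enters the limiting distance. -/
lemma sum_ridgeWeight_sq (k : Fin 2) :
    ∑ i, (ridgeWeight n τ k ℓ i ^ 2 - 1) * loading w y ℓ i ^ 2 = τ k / blockDot k w w - 1 := by
  have hw := (h.w_pos k).ne'
  have hbb : blockDot k (block k w) w = blockDot k w w := by simp [blockDot, block]
  rw [Finset.sum_congr rfl fun i _ => (h.sum_ridgeWeight_aux k i).2, Finset.sum_sub_distrib,
    ← Finset.sum_div, ← Finset.sum_div, ← Finset.mul_sum, h.parseval (h.w_centered.block k),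
    h.parseval (h.w_centered.block k), dot_block, dot_block, hbb]
  field_simp

end LimitSpectrum

end LimitSpectrum

/-! ### Finite-dimensional eigendecompositions and their limits -/

section SpectralConfig

/-- Indexing by `ℕ` with default `0` lets sums over the `p` eigenvectors be compared with sums over
the fixed number `N` of relevant ones, even when `p < N`. -/
lemma sum_fin_eq_sum_fin {p N : ℕ} (f : ℕ → ℝ) (h1 : ∀ i, p ≤ i → f i = 0)
    (h2 : ∀ i, N ≤ i → f i = 0) : ∑ i : Fin p, f i = ∑ i : Fin N, f i := by
  rw [Fin.sum_univ_eq_sum_range, Fin.sum_univ_eq_sum_range]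
  rcases le_total p N with h | h
  · refine Finset.sum_subset (Finset.range_mono h) fun i _ hi => h1 i ?_
    simpa using hi
  · refine (Finset.sum_subset (Finset.range_mono h) fun i _ hi => h2 i ?_).symm
    simpa using hi

/-- Centered vectors `V k j` in `ℝ^p` with an ordered eigendecomposition of
`∑ₖⱼ (V k j) (V k j)ᵀ`. -/
structure SpectralConfig (n : Fin 2 → ℕ) (p : ℕ) where
  /-- the centered data vectors -/
  V : (k : Fin 2) → Fin (n k) → E p
  /-- the eigenvectors -/
  basis : OrthonormalBasis (Fin p) ℝ (E p)
  /-- the eigenvalues -/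
  ev : Fin p → ℝ
  antitone : Antitone ev
  eigen : ∀ i, ∑ k, ∑ j, ⟪V k j, basis i⟫ • V k j = ev i • basis i
  centered : ∀ k, ∑ j, V k j = 0

namespace SpectralConfig

variable {n : Fin 2 → ℕ} {p : ℕ} (C : SpectralConfig n p)

/-- The `i`-th eigenvector, and `0` if `p ≤ i`. -/
noncomputable def vec (i : ℕ) : E p := if h : i < p then C.basis ⟨i, h⟩ else 0

/-- The `i`-th eigenvalue, and `0` if `p ≤ i`. -/
noncomputable def val (i : ℕ) : ℝ := if h : i < p then C.ev ⟨i, h⟩ else 0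

/-- The inner products of the `i`-th eigenvector with the data. -/
noncomputable def coef (i : ℕ) : (k : Fin 2) → Fin (n k) → ℝ := fun k j => ⟪C.V k j, C.vec i⟫

/-- The combination of the data with given coefficients. -/
noncomputable def comb (a : (k : Fin 2) → Fin (n k) → ℝ) : E p := ∑ k, ∑ j, a k j • C.V k j

@[simp] lemma vec_fin (i : Fin p) : C.vec i = C.basis i := by simp [vec]

@[simp] lemma val_fin (i : Fin p) : C.val i = C.ev i := by simp [val]

lemma vec_of_le {i : ℕ} (h : p ≤ i) : C.vec i = 0 := dif_neg (not_lt.2 h)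

lemma val_of_le {i : ℕ} (h : p ≤ i) : C.val i = 0 := dif_neg (not_lt.2 h)

lemma norm_vec_le (i : ℕ) : ‖C.vec i‖ ≤ 1 := by
  by_cases h : i < p
  · simp [vec, h]
  · simp [vec, h]

lemma comb_coef (i : ℕ) : C.comb (C.coef i) = C.val i • C.vec i := by
  by_cases h : i < p
  · have := C.eigen ⟨i, h⟩
    simpa [comb, coef, vec, val, h] using this
  · simp [comb, coef, vec, val, h]

lemma inner_comb (a : (k : Fin 2) → Fin (n k) → ℝ) (q : E p) :
    ⟪C.comb a, q⟫ = dot a fun k j => ⟪C.V k j, q⟫ := by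
  simp only [comb, dot, sum_inner, real_inner_smul_left]

lemma inner_comb_vec (a : (k : Fin 2) → Fin (n k) → ℝ) (i : ℕ) :
    ⟪C.comb a, C.vec i⟫ = dot (C.coef i) a := by
  rw [inner_comb, dot_comm]; rfl

lemma val_mul_inner (i : ℕ) (q : E p) :
    C.val i * ⟪C.vec i, q⟫ = dot (C.coef i) fun k j => ⟪C.V k j, q⟫ := by
  rw [← inner_comb, comb_coef, real_inner_smul_left]

lemma dot_coef (i i' : ℕ) : dot (C.coef i) (C.coef i') = if i = i' then C.val i else 0 := by
  rw [← inner_comb_vec, comb_coef, real_inner_smul_left]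
  by_cases h : i' < p
  · by_cases h' : i < p
    · simp only [vec, val, h, h', dif_pos, orthonormal_iff_ite.1 C.basis.orthonormal,
        Fin.mk.injEq]
      split_ifs <;> simp_all
    · simp only [vec, val, h', dif_neg, not_false_eq_true]
      split_ifs <;> simp_all
  · rw [C.vec_of_le (not_lt.1 h), inner_zero_left, mul_zero]
    split_ifs with hi
    · rw [C.val_of_le (hi ▸ not_lt.1 h)]
    · rfl

lemma val_nonneg (i : ℕ) : 0 ≤ C.val i := by
  have h := C.dot_coef i i
  rw [if_pos rfl, dot_eq] at h
  rw [← h]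
  exact add_nonneg (blockDot_self_nonneg 0) (blockDot_self_nonneg 1)

lemma val_antitone : Antitone C.val := by
  intro i j hij
  by_cases h : j < p
  · simp only [val, h, hij.trans_lt h, dif_pos]
    exact C.antitone (by simpa using hij)
  · rw [C.val_of_le (not_lt.1 h)]
    exact C.val_nonneg i

lemma coef_centered (i : ℕ) : Centered (C.coef i) := by
  intro k
  simp only [coef]
  rw [← sum_inner, C.centered, inner_zero_left]

/-- The scatter matrix has rank at most `N`. Otherwise `N + 1` nonzero, mutually orthogonal centered
vectors, together with the two class-constant vectors, would be independent in dimension `N + 2`. -/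
lemma val_eq_zero {N : ℕ} (hN : N + 2 = n 0 + n 1) (hn : ∀ k, 2 ≤ n k) : C.val N = 0 := by
  by_contra hne
  have hpos : ∀ i : Fin (N + 1), C.val i ≠ 0 := fun i =>
    (((C.val_nonneg N).lt_of_ne' hne).trans_le (C.val_antitone (by omega))).ne'
  have hn0 : ∀ k, (n k : ℝ) ≠ 0 := fun k => by have := hn k; positivity
  let T : (Fin (N + 1) ⊕ Fin 2 → ℝ) →ₗ[ℝ] ((k : Fin 2) → Fin (n k) → ℝ) :=
    { toFun := fun c => (∑ i : Fin (N + 1), c (Sum.inl i) • C.coef i) + fun k _ => c (Sum.inr k)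
      map_add' := by
        intro c c'
        funext k j
        simp only [Pi.add_apply, Finset.sum_apply, Pi.smul_apply, smul_eq_mul, add_mul,
          Finset.sum_add_distrib]
        ring
      map_smul' := by
        intro t c
        funext k j
        simp only [Pi.add_apply, Finset.sum_apply, Pi.smul_apply, smul_eq_mul, RingHom.id_apply,
          mul_add, Finset.mul_sum, mul_assoc] }
  have hinj : Function.Injective T := by
    rw [← LinearMap.ker_eq_bot, LinearMap.ker_eq_bot']
    intro c hc
    have hr : ∀ k, c (Sum.inr k) = 0 := by
      intro k
      have h1 : ∑ j, T c k j = 0 := by simp [hc]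
      simp only [T, LinearMap.coe_mk, AddHom.coe_mk, Pi.add_apply, Finset.sum_apply, Pi.smul_apply,
        smul_eq_mul, Finset.sum_add_distrib, Finset.sum_const, Finset.card_univ, Fintype.card_fin,
        nsmul_eq_mul] at h1
      rw [Finset.sum_comm] at h1
      simp only [← Finset.mul_sum, C.coef_centered _ k, mul_zero, Finset.sum_const_zero, zero_add,
        mul_eq_zero] at h1
      exact h1.resolve_left (hn0 k)
    have hl : ∀ i, c (Sum.inl i) = 0 := by
      intro i
      have h1 : ∑ i : Fin (N + 1), c (Sum.inl i) • C.coef i = 0 := by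
        funext k j
        have := congrFun (congrFun hc k) j
        simpa [T, hr k] using this
      have h2 : dot (∑ i : Fin (N + 1), c (Sum.inl i) • C.coef i) (C.coef i) = 0 := by
        rw [h1]; simp [dot]
      rw [dot_sum_left] at h2
      simp only [dot_smul_left, dot_coef, Fin.val_inj, mul_ite, mul_zero, Finset.sum_ite_eq',
        Finset.mem_univ, if_true, mul_eq_zero] at h2
      exact h2.resolve_right (hpos i)
    funext s
    rcases s with i | k
    · exact hl i
    · exact hr k
  have := LinearMap.finrank_le_finrank_of_injective hinj
  have hdim : Module.finrank ℝ ((k : Fin 2) → Fin (n k) → ℝ) = n 0 + n 1 := by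
    rw [Module.finrank_pi_fintype]
    simp
  rw [hdim, Module.finrank_fintype_fun_eq_card, Fintype.card_sum, Fintype.card_fin,
    Fintype.card_fin] at this
  omega

lemma coef_eq_zero {N : ℕ} (hN : N + 2 = n 0 + n 1) (hn : ∀ k, 2 ≤ n k) {i : ℕ} (hi : N ≤ i) :
    C.coef i = 0 := by
  apply eq_zero_of_dot_self
  rw [C.dot_coef, if_pos rfl]
  exact le_antisymm ((C.val_antitone hi).trans (C.val_eq_zero hN hn).le) (C.val_nonneg i)

lemma sum_inner_mul_inner (a b : E p) :
    ∑ i : Fin p, ⟪C.vec i, a⟫ * ⟪C.vec i, b⟫ = ⟪a, b⟫ := by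
  rw [← C.basis.sum_inner_mul_inner a b]
  refine Finset.sum_congr rfl fun i _ => ?_
  rw [vec_fin, real_inner_comm]

/-- Parseval in `ℝ^p`, truncated at `N` because later eigenvectors are orthogonal to all the data.
The limit of this identity is the field `gram` of `LimitSpectrum`. -/
lemma gram {N : ℕ} (hN : N + 2 = n 0 + n 1) (hn : ∀ k, 2 ≤ n k)
    (a b : (k : Fin 2) → Fin (n k) → ℝ) :
    ∑ i : Fin N, dot (C.coef i) a * dot (C.coef i) b = ⟪C.comb a, C.comb b⟫ := by
  rw [← C.sum_inner_mul_inner, ← sum_fin_eq_sum_fin (p := p) (N := N)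
    (fun i => dot (C.coef i) a * dot (C.coef i) b)]
  · refine Finset.sum_congr rfl fun i _ => ?_
    simp only [← inner_comb_vec, real_inner_comm (C.vec i)]
  · intro i hi
    simp only [← inner_comb_vec, C.vec_of_le hi, inner_zero_right, mul_zero]
  · intro i hi
    simp [C.coef_eq_zero hN hn hi, dot]

end SpectralConfig

lemma exists_tendsto_of_abs_le {ι : Type*} (U : Ultrafilter ι) {f : ι → ℝ} {B : ℝ}
    (h : ∀ᶠ x in U, |f x| ≤ B) : ∃ a, Tendsto f U (𝓝 a) := by
  obtain ⟨a, -, ha⟩ := (isCompact_Icc (a := -B) (b := B)).ultrafilter_le_nhds' (U.map f)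
    (show ∀ᶠ x in U, f x ∈ Set.Icc (-B) B from h.mono fun x hx => abs_le.1 hx)
  exact ⟨a, ha⟩

section Limit

variable {n : Fin 2 → ℕ} {ι : Type*} {U : Ultrafilter ι} {p : ι → ℕ}
  {C : (x : ι) → SpectralConfig n (p x)} {N : ℕ}
  {τ : Fin 2 → ℝ} {w : (k : Fin 2) → Fin (n k) → ℝ}

lemma tendsto_dot {L : Filter ι} {f g : ι → (k : Fin 2) → Fin (n k) → ℝ}
    {a b : (k : Fin 2) → Fin (n k) → ℝ} (hf : ∀ k j, Tendsto (fun x => f x k j) L (𝓝 (a k j)))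
    (hg : ∀ k j, Tendsto (fun x => g x k j) L (𝓝 (b k j))) :
    Tendsto (fun x => dot (f x) (g x)) L (𝓝 (dot a b)) :=
  tendsto_finsetSum _ fun k _ => tendsto_finsetSum _ fun j _ => (hf k j).mul (hg k j)

/-- Along an ultrafilter, sample eigenvalues and eigenvectors converge to the spectrum of the limit
of the Gram matrix. -/
lemma exists_limitSpectrum (hN : N + 2 = n 0 + n 1) (hn : ∀ k, 2 ≤ n k) (hτ : ∀ k, 0 < τ k)
    (hlt : τ 1 < τ 0) (hw : Centered w) (hpos : ∀ k, 0 < blockDot k w w)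
    (hb : ∀ k j, ∃ B, ∀ᶠ x in U, ‖(C x).V k j‖ ≤ B)
    (hg : ∀ a b, Centered a → Centered b → Tendsto (fun x => ⟪(C x).comb a, (C x).comb b⟫) U
      (𝓝 (dot w a * dot w b + ∑ k, τ k * blockDot k a b))) :
    ∃ (y : Fin N → (k : Fin 2) → Fin (n k) → ℝ) (ℓ : Fin N → ℝ),
      LimitSpectrum n N τ w y ℓ ∧
      (∀ i : Fin N, Tendsto (fun x => (C x).val i) U (𝓝 (ℓ i))) ∧
      ∀ (q : (x : ι) → E (p x)) (t : ℝ),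
        (∀ k j, Tendsto (fun x => ⟪(C x).V k j, q x⟫) U (𝓝 (t * w k j))) →
        ∀ i : Fin N, Tendsto (fun x => ⟪(C x).vec i, q x⟫) U (𝓝 (t * loading w y ℓ i)) := by
  -- The coefficients are bounded by the norms of the data, so they converge along the ultrafilter.
  -- No uniqueness of eigenvectors is needed.
  have hy : ∀ (i : Fin N) (k : Fin 2) (j : Fin (n k)),
      ∃ a, Tendsto (fun x => (C x).coef i k j) U (𝓝 a) := by
    intro i k j
    obtain ⟨B, hB⟩ := hb k j
    refine exists_tendsto_of_abs_le U (B := B) ?_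
    filter_upwards [hB] with x hx
    refine (abs_real_inner_le_norm _ _).trans (le_trans ?_ hx)
    exact mul_le_of_le_one_right (norm_nonneg _) ((C x).norm_vec_le i)
  choose y hy using hy
  set ℓ : Fin N → ℝ := fun i => dot (y i) (y i) with hℓdef
  have hℓ : ∀ i : Fin N, Tendsto (fun x => (C x).val i) U (𝓝 (ℓ i)) := by
    intro i
    have := tendsto_dot (hy i) (hy i)
    simpa [SpectralConfig.dot_coef] using this
  have hS : LimitSpectrum n N τ w y ℓ := by
    refine ⟨hN, hn, hτ, hlt, hw, hpos, ?_, ?_, ?_, ?_⟩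
    · intro i i' hi
      exact le_of_tendsto_of_tendsto' (hℓ i') (hℓ i) fun x => (C x).val_antitone hi
    · intro i i'
      split_ifs with hi
      · subst hi; rfl
      · have := tendsto_dot (hy i) (hy i')
        simp only [SpectralConfig.dot_coef, Fin.val_inj, if_neg hi] at this
        exact tendsto_nhds_unique this tendsto_const_nhds
    · intro i k
      have := tendsto_finsetSum Finset.univ fun j _ => hy i k j
      have hz : ∀ x, ∑ j, (C x).coef i k j = 0 := fun x => (C x).coef_centered i k
      simp only [hz] at this
      exact tendsto_nhds_unique this tendsto_const_nhds
    · intro a b ha hb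
      refine tendsto_nhds_unique ?_ (hg a b ha hb)
      have hd : ∀ (i : Fin N) (a : (k : Fin 2) → Fin (n k) → ℝ),
          Tendsto (fun x => dot ((C x).coef i) a) U (𝓝 (dot (y i) a)) := fun i a =>
        tendsto_dot (g := fun _ => a) (hy i) fun _ _ => tendsto_const_nhds
      have h1 := tendsto_finsetSum Finset.univ fun i _ => (hd i a).mul (hd i b)
      exact h1.congr fun x => (C x).gram hN hn a b
  refine ⟨y, ℓ, hS, hℓ, fun q t hq i => ?_⟩
  -- The eigenvector is reached only through `val i * ⟪vec i, q⟫`, a combination of data inner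
  -- products. Dividing by `val i` is legitimate because its limit `ℓ i` is positive.
  have h1 := tendsto_dot (hy i) hq
  simp only [← SpectralConfig.val_mul_inner] at h1
  have h2 := h1.div (hℓ i) (hS.ℓ_pos i).ne'
  have h3 : dot (y i) (fun k j => t * w k j) / ℓ i = t * loading w y ℓ i := by
    have : (fun k j => t * w k j) = t • w := rfl
    rw [this, dot_comm, dot_smul_left, dot_comm, loading, mul_div_assoc]
  rw [h3] at h2
  refine h2.congr' ?_
  filter_upwards [(hℓ i).eventually_ne (hS.ℓ_pos i).ne'] with x hx
  simp only [Pi.div_apply]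
  field_simp

end Limit

end SpectralConfig

/-! ### The projected ridge vector and its limiting inner products -/

section Ridge

namespace SpectralConfig

variable {n : Fin 2 → ℕ} {p : ℕ} (C : SpectralConfig n p)

open Classical in
/-- The weight of the `i`-th eigenvector in the projected ridge vector; the signal indices are
`0` and `n 0 - 1`. -/
noncomputable def weight (N : ℕ) (α : ℝ) (i : ℕ) : ℝ :=
  if N ≤ i then 1 else if i = 0 ∨ i + 1 = n 0 then α / (C.val i + α) else 0

/-- The projected ridge vector. -/
noncomputable def ridge (N : ℕ) (α : ℝ) (e : E p) : E p :=
  ∑ i : Fin p, (C.weight N α i * ⟪C.vec i, e⟫) • C.vec i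

variable {N : ℕ} (α : ℝ)

/-- Since the weights are `1` from index `N` on, the ridge vector differs from `e` by a sum of fixed
length, in which the limit can be taken termwise. -/
lemma inner_ridge (e q : E p) : ⟪C.ridge N α e, q⟫ =
    ⟪e, q⟫ + ∑ i : Fin N, (C.weight N α i - 1) * (⟪C.vec i, e⟫ * ⟪C.vec i, q⟫) := by
  rw [← sum_fin_eq_sum_fin (p := p) (N := N)
      (fun i => (C.weight N α i - 1) * (⟪C.vec i, e⟫ * ⟪C.vec i, q⟫)),
    ← C.sum_inner_mul_inner e q, ← Finset.sum_add_distrib, ridge, sum_inner]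
  · refine Finset.sum_congr rfl fun i _ => ?_
    rw [real_inner_smul_left]
    ring
  · intro i hi
    simp [C.vec_of_le hi]
  · intro i hi
    simp [weight, hi]

lemma inner_vec_ridge (e : E p) (i : Fin p) :
    ⟪C.vec i, C.ridge N α e⟫ = C.weight N α i * ⟪C.vec i, e⟫ := by
  simp only [ridge, inner_sum, real_inner_smul_right, vec_fin,
    orthonormal_iff_ite.1 C.basis.orthonormal]
  simp

lemma inner_ridge_self (e : E p) : ⟪C.ridge N α e, C.ridge N α e⟫ =
    ⟪e, e⟫ + ∑ i : Fin N, (C.weight N α i ^ 2 - 1) * (⟪C.vec i, e⟫ * ⟪C.vec i, e⟫) := by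
  rw [← sum_fin_eq_sum_fin (p := p) (N := N)
      (fun i => (C.weight N α i ^ 2 - 1) * (⟪C.vec i, e⟫ * ⟪C.vec i, e⟫)),
    ← C.sum_inner_mul_inner e e, ← Finset.sum_add_distrib,
    ← C.sum_inner_mul_inner (C.ridge N α e)]
  · refine Finset.sum_congr rfl fun i _ => ?_
    rw [inner_vec_ridge]
    ring
  · intro i hi
    simp [C.vec_of_le hi]
  · intro i hi
    simp [weight, hi]

end SpectralConfig

variable {n : Fin 2 → ℕ} {ι : Type*} {U : Filter ι} {p : ι → ℕ}
  {C : (x : ι) → SpectralConfig n (p x)} {N : ℕ}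
  {τ : Fin 2 → ℝ} {w : (k : Fin 2) → Fin (n k) → ℝ}
  {y : Fin N → (k : Fin 2) → Fin (n k) → ℝ} {ℓ : Fin N → ℝ}

lemma tendsto_weight (h : LimitSpectrum n N τ w y ℓ)
    (hℓ : ∀ i : Fin N, Tendsto (fun x => (C x).val i) U (𝓝 (ℓ i))) (k : Fin 2) {α : ι → ℝ}
    (hα : Tendsto α U (𝓝 (-τ k))) (i : Fin N) :
    Tendsto (fun x => (C x).weight N (α x) i) U (𝓝 (ridgeWeight n τ k ℓ i)) := by
  simp only [SpectralConfig.weight, ridgeWeight, if_neg (not_le.2 i.2)]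
  split_ifs with hi
  · refine hα.div ((hℓ i).add hα) ?_
    have := (h.ne_τ_iff i).2 hi k
    rw [← sub_eq_add_neg]
    exact sub_ne_zero.2 this
  · exact tendsto_const_nhds

/-- The limit of the normalised inner product of the ridge vector with another vector. -/
lemma tendsto_ridge (h : LimitSpectrum n N τ w y ℓ)
    (hℓ : ∀ i : Fin N, Tendsto (fun x => (C x).val i) U (𝓝 (ℓ i))) (k : Fin 2) {α : ι → ℝ}
    (hα : Tendsto α U (𝓝 (-τ k))) {e q : (x : ι) → E (p x)} {κ η s g : ℝ} (hg : 0 < g)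
    (he : ∀ i : Fin N, Tendsto (fun x => ⟪(C x).vec i, e x⟫) U (𝓝 (κ * loading w y ℓ i)))
    (hq : ∀ i : Fin N, Tendsto (fun x => ⟪(C x).vec i, q x⟫) U (𝓝 (η * loading w y ℓ i)))
    (heq : Tendsto (fun x => ⟪e x, q x⟫) U (𝓝 (s + κ * η)))
    (hee : Tendsto (fun x => ⟪e x, e x⟫) U (𝓝 (g + κ ^ 2))) :
    Tendsto (fun x => |⟪(C x).ridge N (α x) (e x), q x⟫| / ‖(C x).ridge N (α x) (e x)‖) U
      (𝓝 (|s| / √(g + κ ^ 2 * (τ k / blockDot k w w)))) := by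
  have hwt := tendsto_weight h hℓ k hα
  have h1 : Tendsto (fun x => ⟪(C x).ridge N (α x) (e x), q x⟫) U (𝓝 s) := by
    simp only [SpectralConfig.inner_ridge]
    have := heq.add (tendsto_finsetSum Finset.univ fun i _ =>
      ((hwt i).sub_const 1).mul ((he i).mul (hq i)))
    convert this using 2
    have e1 : ∀ i, (ridgeWeight n τ k ℓ i - 1) * (κ * loading w y ℓ i * (η * loading w y ℓ i)) =
        κ * η * ((ridgeWeight n τ k ℓ i - 1) * loading w y ℓ i ^ 2) := fun i => by ring
    -- The correction tends to `-κ η` and cancels the leading-direction part of `⟪e, q⟫`.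
    simp only [e1, ← Finset.mul_sum, h.sum_ridgeWeight k]
    ring
  have h2 : Tendsto (fun x => ⟪(C x).ridge N (α x) (e x), (C x).ridge N (α x) (e x)⟫) U
      (𝓝 (g + κ ^ 2 * (τ k / blockDot k w w))) := by
    simp only [SpectralConfig.inner_ridge_self]
    have := hee.add (tendsto_finsetSum Finset.univ fun i _ =>
      (((hwt i).pow 2).sub_const 1).mul ((he i).mul (he i)))
    convert this using 2
    have e1 : ∀ i, (ridgeWeight n τ k ℓ i ^ 2 - 1) *
        (κ * loading w y ℓ i * (κ * loading w y ℓ i)) =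
        κ ^ 2 * ((ridgeWeight n τ k ℓ i ^ 2 - 1) * loading w y ℓ i ^ 2) := fun i => by ring
    simp only [e1, ← Finset.mul_sum, h.sum_ridgeWeight_sq k]
    ring
  simp only [norm_eq_sqrt_real_inner]
  refine h1.abs.div (Real.continuous_sqrt.continuousAt.tendsto.comp h2) ?_
  have := div_pos (h.τ_pos k) (h.w_pos k)
  exact (Real.sqrt_pos.2 (by positivity)).ne'

end Ridge

/-! ### Second moments and averaged covariances under mixing -/

section SecondMoments

variable {Ω : Type*} [MeasurableSpace Ω] {P : Measure Ω}

/-- Pythagoras for square-integrable random variables. -/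
lemma integral_sq_sum_of_orthonormal {ι : Type*} [Fintype ι] [DecidableEq ι] {f : ι → Ω → ℝ}
    (hf : ∀ a, MemLp (f a) 2 P) (h : ∀ a b, ∫ ω, f a ω * f b ω ∂P = if a = b then 1 else 0)
    (c : ι → ℝ) :
    MemLp (fun ω => ∑ a, c a * f a ω) 2 P ∧
      ∫ ω, (∑ a, c a * f a ω) ^ 2 ∂P = ∑ a, c a ^ 2 := by
  refine ⟨memLp_finsetSum _ fun a _ => (hf a).const_mul (c a), ?_⟩
  have h1 : ∀ ω, (∑ a, c a * f a ω) ^ 2 = ∑ a, ∑ b, c a * c b * (f a ω * f b ω) := by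
    intro ω
    rw [sq, Finset.sum_mul_sum]
    exact Finset.sum_congr rfl fun a _ => Finset.sum_congr rfl fun b _ => by ring
  have hi : ∀ a b, Integrable (fun ω => c a * c b * (f a ω * f b ω)) P := fun a b =>
    ((hf a).integrable_mul (hf b)).const_mul _
  simp only [h1]
  rw [integral_finsetSum _ fun a _ => integrable_finsetSum _ fun b _ => hi a b]
  refine Finset.sum_congr rfl fun a _ => ?_
  rw [integral_finsetSum _ fun b _ => hi a b]
  simp only [integral_const_mul, h]
  simp [sq]

lemma abs_covariance_le [IsProbabilityMeasure P] {f g : Ω → ℝ} (hf : MemLp f 2 P)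
    (hg : MemLp g 2 P) : |cov[f, g; P]| ≤ (Var[f; P] + Var[g; P]) / 2 := by
  have hf' : MemLp (fun ω => f ω - ∫ x, f x ∂P) 2 P := hf.sub (memLp_const _)
  have hg' : MemLp (fun ω => g ω - ∫ x, g x ∂P) 2 P := hg.sub (memLp_const _)
  rw [variance_eq_integral hf.aestronglyMeasurable.aemeasurable,
    variance_eq_integral hg.aestronglyMeasurable.aemeasurable,
    ← integral_add hf'.integrable_sq hg'.integrable_sq, ← integral_div, covariance]
  refine abs_integral_le_integral_abs.trans (integral_mono ?_ ?_ fun ω => ?_)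
  · exact (hf'.integrable_mul hg').abs
  · exact (hf'.integrable_sq.add hg'.integrable_sq).div_const 2
  · simp only
    rw [abs_mul]
    nlinarith [sq_nonneg (|f ω - ∫ x, f x ∂P| - |g ω - ∫ x, g x ∂P|),
      sq_abs (f ω - ∫ x, f x ∂P), sq_abs (g ω - ∫ x, g x ∂P)]

lemma abs_covariance_le_corr [IsProbabilityMeasure P] {f g : Ω → ℝ} (hf : MemLp f 2 P)
    (hg : MemLp g 2 P) {B : ℝ} (hfB : Var[f; P] ≤ B) (hgB : Var[g; P] ≤ B) :
    |cov[f, g; P]| ≤ |corr P f g| * B := by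
  have key : cov[f, g; P] = corr P f g * (√(Var[f; P]) * √(Var[g; P])) := by
    -- `corr` is `0` by convention when a variance vanishes; the covariance is then `0` too, since
    -- one of the variables is almost surely constant.
    by_cases h0 : √(Var[f; P]) * √(Var[g; P]) = 0
    · rw [h0, mul_zero, covariance]
      rcases mul_eq_zero.1 h0 with h | h
      · rw [Real.sqrt_eq_zero (variance_nonneg _ _)] at h
        rw [integral_eq_zero_of_ae]
        filter_upwards [ae_eq_integral_of_variance_eq_zero hf h] with ω hω
        simp [hω]
      · rw [Real.sqrt_eq_zero (variance_nonneg _ _)] at h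
        rw [integral_eq_zero_of_ae]
        filter_upwards [ae_eq_integral_of_variance_eq_zero hg h] with ω hω
        simp [hω]
    · rw [corr, div_mul_cancel₀ _ h0]
  rw [key, abs_mul]
  have hB : 0 ≤ B := (variance_nonneg _ _).trans hfB
  refine mul_le_mul_of_nonneg_left ?_ (abs_nonneg _)
  rw [abs_of_nonneg (by positivity)]
  calc _ ≤ √B * √B := mul_le_mul (Real.sqrt_le_sqrt hfB) (Real.sqrt_le_sqrt hgB)
        (Real.sqrt_nonneg _) (Real.sqrt_nonneg _)
    _ = B := Real.mul_self_sqrt hB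

lemma ofReal_abs_corr_le_rhoCoeff {Z : ℕ → Ω → ℝ} {a b l : ℕ} (hab : a + l ≤ b) {φ : ℝ → ℝ}
    (hφ : Measurable φ) (ha : MemLp (fun ω => φ (Z a ω)) 2 P)
    (hb : MemLp (fun ω => φ (Z b ω)) 2 P) :
    ENNReal.ofReal |corr P (fun ω => φ (Z a ω)) (fun ω => φ (Z b ω))| ≤ rhoCoeff P Z l := by
  have hm : ∀ (s : Set ℕ) (i : ℕ), i ∈ s → Measurable[sigmaField Z s] fun ω => φ (Z i ω) := by
    intro s i hi
    have h1 : MeasurableSpace.comap (Z i) inferInstance ≤ sigmaField Z s :=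
      le_iSup₂_of_le i hi le_rfl
    exact hφ.comp ((comap_measurable (Z i)).mono h1 le_rfl)
  unfold rhoCoeff
  refine le_iSup_of_le a (le_iSup_of_le _ (le_iSup_of_le _ (le_iSup_of_le ⟨hm _ a ?_, ha⟩
    (le_iSup_of_le ⟨hm _ b ?_, hb⟩ le_rfl))))
  · exact Set.mem_Iic.2 le_rfl
  · exact Set.mem_Ici.2 hab

lemma corr_comm (f g : Ω → ℝ) : corr P f g = corr P g f := by
  rw [corr, corr, covariance_comm, mul_comm]

/-- The averaged covariances of functions of a sequence that is `ρ`-mixing under some permutation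
tend to zero. -/
lemma tendsto_average_covariance [IsProbabilityMeasure P] {z : ℕ → Ω → ℝ} {φ : ℝ → ℝ}
    (hφ : Measurable φ) (hz : ∀ i, MemLp (fun ω => φ (z i ω)) 2 P) {B : ℝ}
    (hB : ∀ i, Var[fun ω => φ (z i ω); P] ≤ B)
    {π : Equiv.Perm ℕ} (hπ : RhoMixing P fun i => z (π i)) :
    Tendsto (fun p : ℕ => (∑ i ∈ Finset.range p, ∑ j ∈ Finset.range p,
      |cov[fun ω => φ (z i ω), fun ω => φ (z j ω); P]|) / (p : ℝ) ^ 2) atTop (𝓝 0) := by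
  have hB0 : 0 ≤ B := (variance_nonneg _ _).trans (hB 0)
  rw [Metric.tendsto_nhds]
  intro ε hε
  -- Far pairs contribute at most `ε' * B < ε`; `B + 1` keeps the denominator positive if `B = 0`.
  set ε' : ℝ := ε / (2 * (B + 1)) with hε'
  have hε'0 : 0 < ε' := by positivity
  obtain ⟨L, hL⟩ := (ENNReal.tendsto_nhds_zero.1 hπ (ENNReal.ofReal ε')
    (by simpa using hε'0)).exists_forall_of_atTop
  have hfar : ∀ i j, L ≤ (π.symm i - π.symm j) ∨ L ≤ (π.symm j - π.symm i) →
      |cov[fun ω => φ (z i ω), fun ω => φ (z j ω); P]| ≤ ε' * B := by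
    have h1 : ∀ i j, L ≤ (π.symm j - π.symm i) →
        |corr P (fun ω => φ (z i ω)) (fun ω => φ (z j ω))| ≤ ε' := by
      intro i j hij
      -- With truncated subtraction, `L ≤ π.symm j - π.symm i` determines the order of the two
      -- positions only if `L > 0`.
      rcases Nat.eq_zero_or_pos L with hL0 | hL0
      · rcases le_total (π.symm i) (π.symm j) with hle | hle
        · have := (ofReal_abs_corr_le_rhoCoeff (P := P) (Z := fun i => z (π i)) (a := π.symm i)
            (b := π.symm j) (l := L) (by omega) hφ (by simpa using hz i)
            (by simpa using hz j)).trans (hL L le_rfl)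
          simp only [Equiv.apply_symm_apply] at this
          exact (ENNReal.ofReal_le_ofReal_iff hε'0.le).1 this
        · have := (ofReal_abs_corr_le_rhoCoeff (P := P) (Z := fun i => z (π i)) (a := π.symm j)
            (b := π.symm i) (l := L) (by omega) hφ (by simpa using hz j)
            (by simpa using hz i)).trans (hL L le_rfl)
          simp only [Equiv.apply_symm_apply] at this
          rw [corr_comm]
          exact (ENNReal.ofReal_le_ofReal_iff hε'0.le).1 this
      · have := (ofReal_abs_corr_le_rhoCoeff (P := P) (Z := fun i => z (π i)) (a := π.symm i)
            (b := π.symm j) (l := L) (by omega) hφ (by simpa using hz i)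
            (by simpa using hz j)).trans (hL L le_rfl)
        simp only [Equiv.apply_symm_apply] at this
        exact (ENNReal.ofReal_le_ofReal_iff hε'0.le).1 this
    intro i j hij
    refine (abs_covariance_le_corr (hz i) (hz j) (hB i) (hB j)).trans
      (mul_le_mul_of_nonneg_right ?_ hB0)
    rcases hij with hij | hij
    · rw [corr_comm]
      exact h1 j i hij
    · exact h1 i j hij
  have hnear : ∀ i j, |cov[fun ω => φ (z i ω), fun ω => φ (z j ω); P]| ≤ B := fun i j =>
    (abs_covariance_le (hz i) (hz j)).trans (by linarith [hB i, hB j])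
  have hrow : ∀ p i, ∑ j ∈ Finset.range p, |cov[fun ω => φ (z i ω), fun ω => φ (z j ω); P]| ≤
      (2 * L + 1) * B + p * (ε' * B) := by
    intro p i
    have hle : ∀ j ∈ Finset.range p, |cov[fun ω => φ (z i ω), fun ω => φ (z j ω); P]| ≤
        (if π.symm j ∈ Finset.Icc (π.symm i - L) (π.symm i + L) then B else 0) + ε' * B := by
      intro j _
      have := mul_nonneg hε'0.le hB0
      split_ifs with hj
      · linarith [hnear i j]
      · rw [zero_add]
        refine hfar i j ?_
        rw [Finset.mem_Icc] at hj
        omega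
    refine (Finset.sum_le_sum hle).trans ?_
    rw [Finset.sum_add_distrib, Finset.sum_const, Finset.card_range, nsmul_eq_mul]
    refine add_le_add_left ?_ _
    rw [← Finset.sum_filter, Finset.sum_const, nsmul_eq_mul]
    refine mul_le_mul_of_nonneg_right ?_ hB0
    -- The permutation is injective, so however it scatters the indices, each row contains at most
    -- `2 * L + 1` that are close to `i` after reordering.
    have hc : ((Finset.range p).filter fun j =>
        π.symm j ∈ Finset.Icc (π.symm i - L) (π.symm i + L)).card ≤
        (Finset.Icc (π.symm i - L) (π.symm i + L)).card :=
      Finset.card_le_card_of_injOn π.symm (fun j hj => (Finset.mem_filter.1 hj).2)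
        π.symm.injective.injOn
    rw [Nat.card_Icc] at hc
    have hc' : ((Finset.range p).filter fun j =>
        π.symm j ∈ Finset.Icc (π.symm i - L) (π.symm i + L)).card ≤ 2 * L + 1 := by omega
    exact_mod_cast hc'
  have hlim : Tendsto (fun p : ℕ => (2 * L + 1) * B / (p : ℝ) + ε' * B) atTop (𝓝 (ε' * B)) := by
    simpa using (tendsto_const_div_atTop_nhds_zero_nat ((2 * L + 1) * B)).add_const (ε' * B)
  have hlt : ε' * B < ε := by
    rw [hε', div_mul_eq_mul_div, div_lt_iff₀ (by positivity)]
    nlinarith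
  filter_upwards [hlim.eventually (gt_mem_nhds hlt), eventually_gt_atTop 0] with p hp hp0
  have hp0' : (0 : ℝ) < p := by exact_mod_cast hp0
  rw [dist_zero_right, Real.norm_eq_abs, abs_of_nonneg
    (div_nonneg (Finset.sum_nonneg fun i _ => Finset.sum_nonneg fun j _ => abs_nonneg _)
      (by positivity))]
  refine lt_of_le_of_lt ?_ hp
  rw [div_le_iff₀ (by positivity)]
  refine (Finset.sum_le_sum fun i _ => hrow p i).trans (le_of_eq ?_)
  rw [Finset.sum_const, Finset.card_range, nsmul_eq_mul]
  field_simp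

end SecondMoments

/-! ### Asymptotic geometry of the residuals -/

section Residuals

variable {Ω : Type*} {n : Fin 2 → ℕ} {M : Model Ω n} {c : Params}

namespace Model

lemma leading_of_pos (M : Model Ω n) {p : ℕ} (hp : 0 < p) (k : Fin 2) :
    M.leading p k = M.eigvec p k ⟨0, hp⟩ := dif_pos hp

lemma eigval_pos (h2 : M.OneStrongSpike c) (p : ℕ) (k : Fin 2) (i : Fin p) :
    0 < M.eigval p k i := by
  rw [h2.eigval_eq]
  have := h2.σsq_pos k
  have := h2.tailsq_pos k
  split_ifs
  · have := this 0
    positivity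
  · exact this _

/-- The scaled residual of an observation after removal of its leading component. -/
noncomputable def resid (M : Model Ω n) (p : ℕ) (k : Fin 2) (o : Option (Fin (n k))) (ω : Ω) :
    E p :=
  (√(p : ℝ))⁻¹ • (M.X p k o ω - M.mean p k -
    ⟪M.leading p k, M.X p k o ω - M.mean p k⟫ • M.leading p k)

/-- The factor of the `i`-th score in the residual. -/
noncomputable def residCoef (c : Params) (p : ℕ) (k : Fin 2) (i : ℕ) : ℝ :=
  if i = 0 then 0 else (√(p : ℝ))⁻¹ * √(c.tailsq k i)

lemma residCoef_sq (h2 : M.OneStrongSpike c) (p : ℕ) (k : Fin 2) (i : ℕ) :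
    residCoef c p k i ^ 2 = if i = 0 then 0 else c.tailsq k i / p := by
  unfold residCoef
  split_ifs
  · simp
  · rw [mul_pow, inv_pow, Real.sq_sqrt (Nat.cast_nonneg p), Real.sq_sqrt (h2.tailsq_pos k i).le]
    ring

lemma residCoef_sq_le (h2 : M.OneStrongSpike c) {B : ℝ} (hB : ∀ k i, c.tailsq k i ≤ B) (p : ℕ)
    (k : Fin 2) (i : ℕ) : residCoef c p k i ^ 2 ≤ B / p := by
  have hB0 : 0 ≤ B := (h2.tailsq_pos k 0).le.trans (hB k 0)
  rw [residCoef_sq h2]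
  split_ifs
  · positivity
  · gcongr
    exact hB k i

lemma inner_leading_resid {p : ℕ} (hp : 0 < p) (k : Fin 2) (o : Option (Fin (n k))) (ω : Ω) :
    ⟪M.leading p k, M.resid p k o ω⟫ = 0 := by
  rw [resid, real_inner_smul_right, inner_sub_right, real_inner_smul_right,
    real_inner_self_eq_norm_sq, M.leading_of_pos hp]
  simp

variable [MeasurableSpace Ω] {P : Measure Ω}

lemma inner_eigvec_sub_mean (h2 : M.OneStrongSpike c) (h3 : M.Scores P) (p : ℕ) (k : Fin 2)
    (o : Option (Fin (n k))) (ω : Ω) (i : Fin p) :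
    ⟪M.eigvec p k i, M.X p k o ω - M.mean p k⟫ = √(M.eigval p k i) * M.z k o i ω := by
  have := (Real.sqrt_pos.2 (eigval_pos h2 p k i)).ne'
  rw [← h3.score_eq]
  field_simp

lemma inner_eigvec_resid (h2 : M.OneStrongSpike c) (h3 : M.Scores P) (p : ℕ) (k : Fin 2)
    (o : Option (Fin (n k))) (ω : Ω) (i : Fin p) :
    ⟪M.eigvec p k i, M.resid p k o ω⟫ = residCoef c p k i * M.z k o i ω := by
  have hp : 0 < p := Nat.zero_lt_of_lt i.2
  rw [resid, real_inner_smul_right, inner_sub_right, real_inner_smul_right,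
    M.leading_of_pos hp, inner_eigvec_sub_mean h2 h3, inner_eigvec_sub_mean h2 h3,
    orthonormal_iff_ite.1 (M.eigvec p k).orthonormal, residCoef]
  by_cases hi : i = ⟨0, hp⟩
  · simp [hi]
  · have hi' : (i : ℕ) ≠ 0 := fun h => hi (Fin.ext h)
    rw [if_neg hi, if_neg hi', h2.eigval_eq, if_neg hi']
    ring

lemma inner_resid (h2 : M.OneStrongSpike c) (h3 : M.Scores P) (p : ℕ) (k : Fin 2)
    (o : Option (Fin (n k))) (ω : Ω) (v : E p) :
    ⟪M.resid p k o ω, v⟫ =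
      ∑ i : Fin p, residCoef c p k i * ⟪M.eigvec p k i, v⟫ * M.z k o i ω := by
  rw [← (M.eigvec p k).sum_inner_mul_inner]
  refine Finset.sum_congr rfl fun i _ => ?_
  rw [real_inner_comm, inner_eigvec_resid h2 h3]
  ring

lemma measurable_z (hS : M.IsSample P) (h3 : M.Scores P) (k : Fin 2) (o : Option (Fin (n k)))
    (i : ℕ) : Measurable (M.z k o i) := by
  have h : M.z k o i = fun ω => ⟪M.eigvec (i + 1) k (Fin.last i), M.X (i + 1) k o ω -
      M.mean (i + 1) k⟫ / √(M.eigval (i + 1) k (Fin.last i)) := by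
    funext ω
    rw [h3.score_eq]
    rfl
  rw [h]
  exact (measurable_const.inner ((hS.measurable _ k o).sub_const _)).div_const _

lemma memLp_z [IsFiniteMeasure P] (h3 : M.Scores P) (k : Fin 2) (o : Option (Fin (n k)))
    (i : ℕ) : MemLp (M.z k o i) 2 P :=
  (h3.memLp k o i).mono_exponent (by norm_num)

variable [IsProbabilityMeasure P]

lemma integral_inner_X (hS : M.IsSample P) (p : ℕ) (k : Fin 2) (o : Option (Fin (n k)))
    (x : E p) : ∫ ω, ⟪x, M.X p k o ω⟫ ∂P = ⟪x, M.mean p k⟫ := by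
  rw [integral_inner ((hS.memLp p k o).integrable (by norm_num)), hS.mean_eq]

lemma integral_z (hS : M.IsSample P) (h3 : M.Scores P) (k : Fin 2)
    (o : Option (Fin (n k))) (i : ℕ) : ∫ ω, M.z k o i ω ∂P = 0 := by
  have h : ∀ ω, M.z k o i ω = (⟪M.eigvec (i + 1) k (Fin.last i), M.X (i + 1) k o ω⟫ -
      ⟪M.eigvec (i + 1) k (Fin.last i), M.mean (i + 1) k⟫) /
        √(M.eigval (i + 1) k (Fin.last i)) := by
    intro ω
    rw [← inner_sub_right, h3.score_eq]
    rfl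
  simp only [h]
  rw [integral_div, integral_sub, integral_inner_X hS]
  · simp
  · exact ((hS.memLp (i + 1) k o).integrable (by norm_num)).const_inner _
  · exact integrable_const _

/-- As the scores do not depend on the dimension, the covariance formula may be read off in any
dimension that contains both indices. -/
lemma integral_z_mul_z (hS : M.IsSample P) (h2 : M.OneStrongSpike c) (h3 : M.Scores P) (k : Fin 2)
    (o : Option (Fin (n k))) (i j : ℕ) :
    ∫ ω, M.z k o i ω * M.z k o j ω ∂P = if i = j then 1 else 0 := by
  obtain ⟨p, hi, hj⟩ : ∃ p, i < p ∧ j < p := ⟨max i j + 1, by omega, by omega⟩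
  have hcov := hS.cov_eq p k o (M.eigvec p k ⟨i, hi⟩) (M.eigvec p k ⟨j, hj⟩)
  simp only [covariance, integral_inner_X hS, ← inner_sub_right, inner_eigvec_sub_mean h2 h3,
    orthonormal_iff_ite.1 (M.eigvec p k).orthonormal] at hcov
  simp only [mul_ite, mul_one, mul_zero, Finset.sum_ite_eq, Finset.mem_univ, if_true,
    Fin.mk.injEq] at hcov
  have hi0 := (Real.sqrt_pos.2 (eigval_pos h2 p k ⟨i, hi⟩)).ne'
  have hj0 := (Real.sqrt_pos.2 (eigval_pos h2 p k ⟨j, hj⟩)).ne'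
  have h1 : ∀ ω, M.z k o i ω * M.z k o j ω = (√(M.eigval p k ⟨i, hi⟩) * M.z k o i ω *
      (√(M.eigval p k ⟨j, hj⟩) * M.z k o j ω)) /
      (√(M.eigval p k ⟨i, hi⟩) * √(M.eigval p k ⟨j, hj⟩)) := by
    intro ω
    field_simp
  simp only [h1]
  rw [integral_div, hcov]
  by_cases hij : i = j
  · subst hij
    rw [if_pos rfl, if_pos rfl, Real.mul_self_sqrt (eigval_pos h2 p k _).le,
      div_self (eigval_pos h2 p k _).ne']
  · rw [if_neg hij, if_neg hij, zero_div]

omit [IsProbabilityMeasure P] in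
lemma indepFun_X (hS : M.IsSample P) (p : ℕ) {a b : (k : Fin 2) × Option (Fin (n k))}
    (hab : a ≠ b) : IndepFun (M.X p a.1 a.2) (M.X p b.1 b.2) P :=
  (hS.indep p).indepFun hab

omit [IsProbabilityMeasure P] in
lemma indepFun_z_mul (hS : M.IsSample P) (h3 : M.Scores P)
    {a b : (k : Fin 2) × Option (Fin (n k))} (hab : a ≠ b) (i i' j j' : ℕ) :
    IndepFun (fun ω => M.z a.1 a.2 i ω * M.z a.1 a.2 i' ω)
      (fun ω => M.z b.1 b.2 j ω * M.z b.1 b.2 j' ω) P := by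
  obtain ⟨p, hi, hi', hj, hj'⟩ : ∃ p, i < p ∧ i' < p ∧ j < p ∧ j' < p :=
    ⟨max (max i i') (max j j') + 1, by omega, by omega, by omega, by omega⟩
  have hg : ∀ (k : Fin 2) (i i' : Fin p), Measurable fun x : E p =>
      ⟪M.eigvec p k i, x - M.mean p k⟫ / √(M.eigval p k i) *
        (⟪M.eigvec p k i', x - M.mean p k⟫ / √(M.eigval p k i')) := by
    intro k i i'
    fun_prop
  have := (indepFun_X hS p hab).comp (hg a.1 ⟨i, hi⟩ ⟨i', hi'⟩) (hg b.1 ⟨j, hj⟩ ⟨j', hj'⟩)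
  convert this using 1
  · funext ω
    simp only [Function.comp_apply, h3.score_eq]
  · funext ω
    simp only [Function.comp_apply, h3.score_eq]

lemma memLp_z_mul_z (hS : M.IsSample P) (h3 : M.Scores P)
    {a b : (k : Fin 2) × Option (Fin (n k))} (hab : a ≠ b) (i j : ℕ) :
    MemLp (fun ω => M.z a.1 a.2 i ω * M.z b.1 b.2 j ω) 2 P := by
  refine (memLp_two_iff_integrable_sq ((measurable_z hS h3 _ _ _).mul
    (measurable_z hS h3 _ _ _)).aestronglyMeasurable).2 ?_
  have := (indepFun_z_mul hS h3 hab i i j j).integrable_mul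
    ((memLp_z h3 a.1 a.2 i).integrable_mul (memLp_z h3 a.1 a.2 i))
    ((memLp_z h3 b.1 b.2 j).integrable_mul (memLp_z h3 b.1 b.2 j))
  refine this.congr (Eventually.of_forall fun ω => ?_)
  simp only [Pi.mul_apply]
  ring

lemma integral_z_mul_z_mul (hS : M.IsSample P) (h2 : M.OneStrongSpike c) (h3 : M.Scores P)
    {a b : (k : Fin 2) × Option (Fin (n k))} (hab : a ≠ b) (i i' j j' : ℕ) :
    ∫ ω, (M.z a.1 a.2 i ω * M.z b.1 b.2 j ω) * (M.z a.1 a.2 i' ω * M.z b.1 b.2 j' ω) ∂P =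
      if i = i' ∧ j = j' then 1 else 0 := by
  have h1 : ∀ ω, (M.z a.1 a.2 i ω * M.z b.1 b.2 j ω) * (M.z a.1 a.2 i' ω * M.z b.1 b.2 j' ω) =
      (M.z a.1 a.2 i ω * M.z a.1 a.2 i' ω) * (M.z b.1 b.2 j ω * M.z b.1 b.2 j' ω) :=
    fun ω => by ring
  simp only [h1]
  rw [(indepFun_z_mul hS h3 hab i i' j j').integral_fun_mul_eq_mul_integral,
    integral_z_mul_z hS h2 h3,
    integral_z_mul_z hS h2 h3]
  · split_ifs <;> simp_all
  · exact ((measurable_z hS h3 _ _ _).mul (measurable_z hS h3 _ _ _)).aestronglyMeasurable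
  · exact ((measurable_z hS h3 _ _ _).mul (measurable_z hS h3 _ _ _)).aestronglyMeasurable

lemma tendsto_const_div_nat (B : ℝ) : Tendsto (fun p : ℕ => B / (p : ℝ)) atTop (𝓝 0) :=
  tendsto_const_div_atTop_nhds_zero_nat B

/-- Residuals are asymptotically orthogonal to deterministic vectors of bounded norm. -/
lemma tendsto_inner_resid (hS : M.IsSample P) (h2 : M.OneStrongSpike c) (h3 : M.Scores P)
    (k : Fin 2) (o : Option (Fin (n k))) {v : (p : ℕ) → E p} {r : ℝ}
    (hv : Tendsto (fun p => ‖v p‖) atTop (𝓝 r)) :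
    Tendsto (fun x : ℕ × Ω => ⟪M.resid x.1 k o x.2, v x.1⟫) (probFilter P) (𝓝 0) := by
  obtain ⟨B, hB⟩ := h2.bounded
  have hB0 : 0 ≤ B := (h2.tailsq_pos k 0).le.trans (hB k 0)
  have key := fun p => integral_sq_sum_of_orthonormal (P := P)
    (f := fun (i : Fin p) => M.z k o i) (fun i => memLp_z h3 k o i)
    (fun i j => by simpa only [Fin.val_inj] using integral_z_mul_z hS h2 h3 k o i j)
    (fun i => residCoef c p k i * ⟪M.eigvec p k i, v p⟫)
  refine tendsto_probFilter_of_sq (F := fun p ω => ⟪M.resid p k o ω, v p⟫) ?_ ?_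
  · refine Eventually.of_forall fun p => ?_
    simp only [inner_resid h2 h3]
    exact (key p).1
  · simp only [inner_resid h2 h3, (key _).2]
    have hlim : Tendsto (fun p : ℕ => B / (p : ℝ) * ‖v p‖ ^ 2) atTop (𝓝 0) := by
      simpa using (tendsto_const_div_nat B).mul (hv.pow 2)
    refine squeeze_zero (fun p => Finset.sum_nonneg fun i _ => sq_nonneg _) (fun p => ?_) hlim
    rw [← (M.eigvec p k).sum_sq_inner_right, Finset.mul_sum]
    refine Finset.sum_le_sum fun i _ => ?_
    rw [mul_pow]
    exact mul_le_mul_of_nonneg_right (residCoef_sq_le h2 hB p k i) (sq_nonneg _)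

/-- Residuals of different observations are asymptotically orthogonal. -/
lemma tendsto_inner_resid_resid (hS : M.IsSample P) (h2 : M.OneStrongSpike c) (h3 : M.Scores P)
    {a b : (k : Fin 2) × Option (Fin (n k))} (hab : a ≠ b) :
    Tendsto (fun x : ℕ × Ω => ⟪M.resid x.1 a.1 a.2 x.2, M.resid x.1 b.1 b.2 x.2⟫)
      (probFilter P) (𝓝 0) := by
  obtain ⟨B, hB⟩ := h2.bounded
  have hB0 : 0 ≤ B := (h2.tailsq_pos 0 0).le.trans (hB 0 0)
  have heq : ∀ p ω, ⟪M.resid p a.1 a.2 ω, M.resid p b.1 b.2 ω⟫ =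
      ∑ il : Fin p × Fin p, (residCoef c p a.1 il.1 * (residCoef c p b.1 il.2 *
        ⟪M.eigvec p b.1 il.2, M.eigvec p a.1 il.1⟫)) *
          (M.z a.1 a.2 il.1 ω * M.z b.1 b.2 il.2 ω) := by
    intro p ω
    rw [inner_resid h2 h3, Fintype.sum_prod_type]
    refine Finset.sum_congr rfl fun i _ => ?_
    rw [real_inner_comm, inner_resid h2 h3, Finset.mul_sum, Finset.sum_mul]
    exact Finset.sum_congr rfl fun l _ => by ring
  have key := fun p => integral_sq_sum_of_orthonormal (P := P)
    (f := fun (il : Fin p × Fin p) ω => M.z a.1 a.2 il.1 ω * M.z b.1 b.2 il.2 ω)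
    (fun il => memLp_z_mul_z hS h3 hab il.1 il.2)
    (fun s t => by
      rw [integral_z_mul_z_mul hS h2 h3 hab]
      simp only [Fin.val_inj, Prod.ext_iff])
    (fun il => residCoef c p a.1 il.1 * (residCoef c p b.1 il.2 *
        ⟪M.eigvec p b.1 il.2, M.eigvec p a.1 il.1⟫))
  refine tendsto_probFilter_of_sq
    (F := fun p ω => ⟪M.resid p a.1 a.2 ω, M.resid p b.1 b.2 ω⟫) ?_ ?_
  · refine Eventually.of_forall fun p => ?_
    simp only [heq]
    exact (key p).1
  · simp only [heq, (key _).2]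
    have hlim : Tendsto (fun p : ℕ => B ^ 2 / (p : ℝ)) atTop (𝓝 0) := tendsto_const_div_nat _
    refine squeeze_zero (fun p => Finset.sum_nonneg fun i _ => sq_nonneg _) (fun p => ?_) hlim
    rw [Fintype.sum_prod_type]
    -- The squared inner products of a unit vector with the other class's eigenbasis add up to `1`.
    -- Each of the `p` rows thus contributes at most `(B / p)²`, for a total of `B² / p`.
    have hrow : ∀ i : Fin p, ∑ l : Fin p, (residCoef c p a.1 i * (residCoef c p b.1 l *
        ⟪M.eigvec p b.1 l, M.eigvec p a.1 i⟫)) ^ 2 ≤ (B / p) ^ 2 := by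
      intro i
      calc _ ≤ ∑ l : Fin p, B / p * (B / p * ⟪M.eigvec p b.1 l, M.eigvec p a.1 i⟫ ^ 2) := by
            refine Finset.sum_le_sum fun l _ => ?_
            rw [mul_pow, mul_pow]
            have := residCoef_sq_le h2 hB p a.1 i
            have := residCoef_sq_le h2 hB p b.1 l
            gcongr
        _ = _ := by
            rw [← Finset.mul_sum, ← Finset.mul_sum, (M.eigvec p b.1).sum_sq_inner_right]
            simp [sq]
    refine (Finset.sum_le_sum fun i _ => hrow i).trans (le_of_eq ?_)
    rw [Finset.sum_const, Finset.card_univ, Fintype.card_fin, nsmul_eq_mul]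
    rcases Nat.eq_zero_or_pos p with hp | hp
    · simp [hp]
    · field_simp

omit [MeasurableSpace Ω] in
lemma sum_residCoef_sq (h2 : M.OneStrongSpike c) (k : Fin 2) :
    Tendsto (fun p : ℕ => ∑ i : Fin p, residCoef c p k i ^ 2) atTop (𝓝 (c.τsq k)) := by
  have h := (h2.tendsto k).sub (tendsto_const_div_nat (c.tailsq k 0))
  rw [sub_zero] at h
  refine h.congr' ?_
  filter_upwards [eventually_gt_atTop 0] with p hp
  simp only [residCoef_sq h2]
  rw [Fin.sum_univ_eq_sum_range (fun i => if i = 0 then 0 else c.tailsq k i / (p : ℝ)) p,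
    Finset.sum_div, ← Finset.add_sum_erase _ _ (Finset.mem_range.2 hp),
    ← Finset.add_sum_erase _ _ (Finset.mem_range.2 hp), if_pos rfl, add_sub_cancel_left, zero_add]
  refine Finset.sum_congr rfl fun i hi => ?_
  rw [if_neg (Finset.ne_of_mem_erase hi)]

omit [IsProbabilityMeasure P] in
lemma memLp_z_sq (h3 : M.Scores P) (k : Fin 2) (o : Option (Fin (n k)))
    (i : ℕ) : MemLp (fun ω => M.z k o i ω ^ 2) 2 P := by
  have h := (h3.memLp k o i).norm_rpow_div 2
  have e : (4 : ℝ≥0∞) / 2 = 2 := by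
    rw [show (4 : ℝ≥0∞) = 2 * 2 by norm_num]
    exact ENNReal.mul_div_cancel_right (by norm_num) (by norm_num)
  rw [e] at h
  refine h.congr_norm ?_ (Eventually.of_forall fun ω => ?_)
  · exact (h3.memLp k o i).aestronglyMeasurable.pow 2
  · simp

/-- The law of large numbers for the squared norm of the residuals. -/
lemma tendsto_norm_sq_resid (hS : M.IsSample P) (h2 : M.OneStrongSpike c) (h3 : M.Scores P)
    (k : Fin 2) (o : Option (Fin (n k))) :
    Tendsto (fun x : ℕ × Ω => ⟪M.resid x.1 k o x.2, M.resid x.1 k o x.2⟫) (probFilter P)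
      (𝓝 (c.τsq k)) := by
  obtain ⟨B, hB⟩ := h2.bounded
  have hB0 : 0 ≤ B := (h2.tailsq_pos k 0).le.trans (hB k 0)
  obtain ⟨B', hB'⟩ := h3.bounded
  obtain ⟨π, hπ⟩ := h3.mixing k o
  have hvar : ∀ i, Var[fun ω => M.z k o i ω ^ 2; P] ≤ B' := by
    intro i
    refine (variance_le_expectation_sq (memLp_z_sq h3 k o i).aestronglyMeasurable).trans ?_
    refine le_trans (le_of_eq ?_) (hB' k o i)
    refine integral_congr_ae (Eventually.of_forall fun ω => ?_)
    simp only [Pi.pow_apply]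
    ring
  have havg := tendsto_average_covariance (P := P) (z := M.z k o) (φ := fun x => x ^ 2)
    (by fun_prop) (fun i => memLp_z_sq h3 k o i) hvar hπ
  have hmean : ∀ i, ∫ ω, M.z k o i ω ^ 2 ∂P = 1 := by
    intro i
    simpa [sq] using integral_z_mul_z hS h2 h3 k o i i
  have hdiff : Tendsto (fun x : ℕ × Ω => ∑ i : Fin x.1,
      residCoef c x.1 k i ^ 2 * (M.z k o i x.2 ^ 2 - 1)) (probFilter P) (𝓝 0) := by
    have hL : ∀ i, MemLp (fun ω => M.z k o i ω ^ 2 - 1) 2 P := fun i =>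
      (memLp_z_sq h3 k o i).sub (memLp_const 1)
    refine tendsto_probFilter_of_sq
      (F := fun p ω => ∑ i : Fin p, residCoef c p k i ^ 2 * (M.z k o i ω ^ 2 - 1)) ?_ ?_
    · exact Eventually.of_forall fun p => memLp_finsetSum _ fun i _ => (hL i).const_mul _
    · have hlim : Tendsto (fun p : ℕ => B ^ 2 * ((∑ i ∈ Finset.range p, ∑ j ∈ Finset.range p,
          |cov[fun ω => M.z k o i ω ^ 2, fun ω => M.z k o j ω ^ 2; P]|) / (p : ℝ) ^ 2))
          atTop (𝓝 0) := by
        simpa using havg.const_mul (B ^ 2)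
      refine squeeze_zero (fun p => integral_nonneg fun ω => sq_nonneg _) (fun p => ?_) hlim
      have e1 : ∀ ω, (∑ i : Fin p, residCoef c p k i ^ 2 * (M.z k o i ω ^ 2 - 1)) ^ 2 =
          ∑ i : Fin p, ∑ j : Fin p, residCoef c p k i ^ 2 * residCoef c p k j ^ 2 *
            ((M.z k o i ω ^ 2 - 1) * (M.z k o j ω ^ 2 - 1)) := by
        intro ω
        rw [sq, Finset.sum_mul_sum]
        exact Finset.sum_congr rfl fun a _ => Finset.sum_congr rfl fun b _ => by ring
      have hi : ∀ i j : Fin p, Integrable (fun ω => residCoef c p k i ^ 2 * residCoef c p k j ^ 2 *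
            ((M.z k o i ω ^ 2 - 1) * (M.z k o j ω ^ 2 - 1))) P := fun i j =>
        ((hL i).integrable_mul (hL j)).const_mul _
      simp only [e1]
      rw [integral_finsetSum _ fun a _ => integrable_finsetSum _ fun b _ => hi a b]
      rw [Finset.sum_div, Finset.mul_sum,
        ← Fin.sum_univ_eq_sum_range (fun i => B ^ 2 * ((∑ j ∈ Finset.range p,
          |cov[fun ω => M.z k o i ω ^ 2, fun ω => M.z k o j ω ^ 2; P]|) / (p : ℝ) ^ 2))]
      refine Finset.sum_le_sum fun i _ => ?_
      rw [integral_finsetSum _ fun b _ => hi i b, Finset.sum_div, Finset.mul_sum,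
        ← Fin.sum_univ_eq_sum_range (fun j => B ^ 2 *
          (|cov[fun ω => M.z k o i ω ^ 2, fun ω => M.z k o j ω ^ 2; P]| / (p : ℝ) ^ 2))]
      refine Finset.sum_le_sum fun j _ => ?_
      rw [integral_const_mul]
      have e2 : ∫ ω, (M.z k o i ω ^ 2 - 1) * (M.z k o j ω ^ 2 - 1) ∂P =
          cov[fun ω => M.z k o i ω ^ 2, fun ω => M.z k o j ω ^ 2; P] := by
        simp only [covariance, hmean]
      rw [e2]
      -- The bounded tail eigenvalues reduce the variance to the averaged covariances of the squared
      -- scores, which vanish by mixing.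
      have hle : residCoef c p k i ^ 2 * residCoef c p k j ^ 2 ≤ B / p * (B / p) :=
        mul_le_mul (residCoef_sq_le h2 hB p k i) (residCoef_sq_le h2 hB p k j) (sq_nonneg _)
          (by positivity)
      calc _ ≤ residCoef c p k i ^ 2 * residCoef c p k j ^ 2 *
            |cov[fun ω => M.z k o i ω ^ 2, fun ω => M.z k o j ω ^ 2; P]| := by
            gcongr
            exact le_abs_self _
        _ ≤ B / p * (B / p) *
            |cov[fun ω => M.z k o i ω ^ 2, fun ω => M.z k o j ω ^ 2; P]| := by
            gcongr
        _ = _ := by ring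
  have hsum := hdiff.add ((sum_residCoef_sq h2 k).comp (tendsto_fst_probFilter P))
  rw [zero_add] at hsum
  refine hsum.congr fun x => ?_
  rw [inner_resid h2 h3, Function.comp_apply, ← Finset.sum_add_distrib]
  refine Finset.sum_congr rfl fun i _ => ?_
  rw [inner_eigvec_resid h2 h3]
  ring

end Model

end Residuals

/-! ### The common leading direction and limits of inner products of the data -/

section GramLimits

variable {Ω : Type*} {n : Fin 2 → ℕ} {M : Model Ω n} {c : Params}

namespace Model

/-- A unit vector `u p` spanning the common leading eigenspace, in a form suited for limits. -/
structure IsLeadingBasis (M : Model Ω n) (c : Params) (u : (p : ℕ) → E p) : Prop where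
  norm_eq : ∀ p, 0 < p → ‖u p‖ = 1
  span_eq : ∀ p, 0 < p → M.leadingSpace p = Submodule.span ℝ {u p}
  sq_R : ∀ k, c.R k ^ 2 = 1
  leading_eq : ∀ k, ∀ᶠ p in atTop, M.leading p k = c.R k • u p
  tendsto : Tendsto (fun p : ℕ => ⟪u p, (√(p : ℝ))⁻¹ • M.μ p⟫) atTop
    (𝓝 (c.δ * Real.cos c.θ))

/-- In a one-dimensional space each leading eigenvector is `u` or `-u`. A convergent sequence of
signs is eventually constant, so the sign eventually equals its limit `R k`. -/
lemma exists_isLeadingBasis (h1 : M.MeanDifference c) (h5 : M.CommonLeadingSpace c) :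
    ∃ u, IsLeadingBasis M c u := by
  obtain ⟨u, hu, -, hang, hR⟩ := h5.basis
  have hspan : ∀ p, 0 < p → M.leadingSpace p = Submodule.span ℝ {u p} := by
    intro p hp
    have hne : u p ≠ 0 := by
      intro h0
      have := (hu p hp).1
      simp [h0] at this
    refine (Submodule.eq_of_le_of_finrank_eq ?_ ?_).symm
    · rw [Submodule.span_singleton_le_iff_mem]
      exact (hu p hp).2
    · rw [finrank_span_singleton hne, h5.finrank_eq p hp]
  have hlead : ∀ k p, 0 < p → M.leading p k = ⟪u p, M.leading p k⟫ • u p ∧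
      ⟪u p, M.leading p k⟫ ^ 2 = 1 := by
    intro k p hp
    have hmem : M.leading p k ∈ Submodule.span ℝ {u p} := by
      rw [← hspan p hp]
      refine Submodule.subset_span ?_
      fin_cases k
      · exact Set.mem_insert _ _
      · exact Set.mem_insert_of_mem _ rfl
    obtain ⟨a, ha⟩ := Submodule.mem_span_singleton.1 hmem
    have hn : ‖M.leading p k‖ = 1 := by simp [M.leading_of_pos hp]
    have ha' : ⟪u p, M.leading p k⟫ = a := by
      rw [← ha, real_inner_smul_right, real_inner_self_eq_norm_sq, (hu p hp).1]
      ring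
    rw [ha']
    refine ⟨ha.symm, ?_⟩
    rw [← ha, norm_smul, (hu p hp).1, mul_one, Real.norm_eq_abs] at hn
    rw [← sq_abs, hn, one_pow]
  have hsq : ∀ k, c.R k ^ 2 = 1 := by
    intro k
    refine tendsto_nhds_unique ((hR k).pow 2) (tendsto_const_nhds.congr' ?_)
    filter_upwards [eventually_gt_atTop 0] with p hp
    exact (hlead k p hp).2.symm
  refine ⟨u, fun p hp => (hu p hp).1, hspan, hsq, fun k => ?_, ?_⟩
  · have hpos : Tendsto (fun p => ⟪u p, M.leading p k⟫ * c.R k) atTop (𝓝 1) := by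
      have := (hR k).mul_const (c.R k)
      rwa [← sq, hsq k] at this
    filter_upwards [eventually_gt_atTop 0, hpos.eventually (lt_mem_nhds one_pos)] with p hp hpp
    have h2 := (hlead k p hp).2
    have : ⟪u p, M.leading p k⟫ = c.R k := by
      rcases sq_eq_sq_iff_eq_or_eq_neg.1 (h2.trans (hsq k).symm) with h | h
      · exact h
      · rw [h] at hpp
        nlinarith [sq_nonneg (c.R k)]
    conv_lhs => rw [(hlead k p hp).1, this]
  · have := h1.tendsto.mul ((Real.continuous_cos.tendsto _).comp hang)
    refine this.congr' ?_
    filter_upwards [eventually_gt_atTop 0] with p hp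
    rw [real_inner_smul_right, ← InnerProductGeometry.cos_angle_mul_norm_mul_norm, (hu p hp).1]
    simp only [Function.comp_apply]
    ring

/-- A linear combination of the observations, scaled by `p^{-1/2}`. -/
noncomputable def scaled (M : Model Ω n) (p : ℕ) (a : (k : Fin 2) → Option (Fin (n k)) → ℝ)
    (ω : Ω) : E p := ∑ k, ∑ o, a k o • (√(p : ℝ))⁻¹ • M.X p k o ω

/-- The part of `scaled` that is due to the residuals. -/
noncomputable def scaledResid (M : Model Ω n) (p : ℕ) (a : (k : Fin 2) → Option (Fin (n k)) → ℝ)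
    (ω : Ω) : E p := ∑ k, ∑ o, a k o • M.resid p k o ω

/-- The coefficients of class `1` add up to `t`, those of class `2` to `- t`. -/
def HasTotal (a : (k : Fin 2) → Option (Fin (n k)) → ℝ) (t : ℝ) : Prop :=
  ∑ o, a 0 o = t ∧ ∑ o, a 1 o = -t

/-- The limit of the coefficient of a linear combination of the observations in the direction of the
common leading eigenvector, in terms of the leading scores. -/
noncomputable def limProj (c : Params) (t : ℝ) (a z : (k : Fin 2) → Option (Fin (n k)) → ℝ) : ℝ :=
  t * (c.δ * Real.cos c.θ) + ∑ k, c.R k * √(c.σsq k) * ∑ o, a k o * z k o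

/-- The size of the leading component relative to `p^{1/2}`. -/
noncomputable def spikeCoef (c : Params) (p : ℕ) (k : Fin 2) : ℝ :=
  √(c.σsq k + c.tailsq k 0 / p)

lemma tendsto_spikeCoef (k : Fin 2) :
    Tendsto (fun p => spikeCoef c p k) atTop (𝓝 (√(c.σsq k))) := by
  have := (tendsto_const_div_nat (c.tailsq k 0)).const_add (c.σsq k)
  rw [add_zero] at this
  exact (Real.continuous_sqrt.tendsto _).comp this

variable [MeasurableSpace Ω] {P : Measure Ω}

lemma scaled_X_eq (h2 : M.OneStrongSpike c) (h3 : M.Scores P) {p : ℕ} (hp : 0 < p) (k : Fin 2)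
    (o : Option (Fin (n k))) (ω : Ω) :
    (√(p : ℝ))⁻¹ • M.X p k o ω = (√(p : ℝ))⁻¹ • M.mean p k +
      (spikeCoef c p k * M.z k o 0 ω) • M.leading p k + M.resid p k o ω := by
  have hp' : (0 : ℝ) < p := by exact_mod_cast hp
  have hs : (√(p : ℝ))⁻¹ * √(M.eigval p k ⟨0, hp⟩) = spikeCoef c p k := by
    rw [h2.eigval_eq, if_pos rfl, ← Real.sqrt_inv, ← Real.sqrt_mul (by positivity), spikeCoef]
    congr 1
    field_simp
  have hl := inner_eigvec_sub_mean h2 h3 p k o ω ⟨0, hp⟩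
  rw [resid, M.leading_of_pos hp, hl, ← hs]
  module

/-- Opposite class totals are what merges the two means into a multiple of `μ`, the only mean
quantity whose growth is controlled. -/
lemma scaled_eq (h2 : M.OneStrongSpike c) (h3 : M.Scores P) {u : (p : ℕ) → E p} {p : ℕ}
    (hp : 0 < p) (hu : ∀ k, M.leading p k = c.R k • u p)
    {a : (k : Fin 2) → Option (Fin (n k)) → ℝ} {t : ℝ} (ha : HasTotal a t) (ω : Ω) :
    M.scaled p a ω = t • ((√(p : ℝ))⁻¹ • M.μ p) +
      (∑ k, c.R k * spikeCoef c p k * ∑ o, a k o * M.z k o 0 ω) • u p + M.scaledResid p a ω := by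
  have hk : ∀ k, ∑ o, a k o • (√(p : ℝ))⁻¹ • M.X p k o ω =
      (∑ o, a k o) • ((√(p : ℝ))⁻¹ • M.mean p k) +
        (c.R k * spikeCoef c p k * ∑ o, a k o * M.z k o 0 ω) • u p +
        ∑ o, a k o • M.resid p k o ω := by
    intro k
    rw [Finset.sum_smul, Finset.mul_sum, Finset.sum_smul, ← Finset.sum_add_distrib,
      ← Finset.sum_add_distrib]
    refine Finset.sum_congr rfl fun o _ => ?_
    rw [scaled_X_eq h2 h3 hp, hu k]
    module
  rw [scaled, scaledResid]
  simp only [hk, Fin.sum_univ_two, ha.1, ha.2, μ]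
  module

variable [IsProbabilityMeasure P]

lemma tendsto_inner_scaledResid (hS : M.IsSample P) (h2 : M.OneStrongSpike c) (h3 : M.Scores P)
    (a b : (k : Fin 2) → Option (Fin (n k)) → ℝ) :
    Tendsto (fun x : ℕ × Ω => ⟪M.scaledResid x.1 a x.2, M.scaledResid x.1 b x.2⟫)
      (probFilter P) (𝓝 (∑ k, c.τsq k * ∑ o, a k o * b k o)) := by
  classical
  have h : ∀ (s t : (k : Fin 2) × Option (Fin (n k))),
      Tendsto (fun x : ℕ × Ω => ⟪M.resid x.1 s.1 s.2 x.2, M.resid x.1 t.1 t.2 x.2⟫)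
        (probFilter P) (𝓝 (if s = t then c.τsq s.1 else 0)) := by
    intro s t
    split_ifs with hst
    · subst hst
      exact tendsto_norm_sq_resid hS h2 h3 s.1 s.2
    · exact tendsto_inner_resid_resid hS h2 h3 hst
  have hsum := tendsto_finsetSum Finset.univ fun s _ => tendsto_finsetSum Finset.univ fun t _ =>
    (h s t).const_mul (a s.1 s.2 * b t.1 t.2)
  have hlim : ∑ s : (k : Fin 2) × Option (Fin (n k)), ∑ t : (k : Fin 2) × Option (Fin (n k)),
      a s.1 s.2 * b t.1 t.2 * (if s = t then c.τsq s.1 else 0) =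
        ∑ k, c.τsq k * ∑ o, a k o * b k o := by
    simp only [mul_ite, mul_zero, Finset.sum_ite_eq, Finset.mem_univ, if_true]
    rw [Fintype.sum_sigma]
    refine Finset.sum_congr rfl fun k _ => ?_
    rw [Finset.mul_sum]
    exact Finset.sum_congr rfl fun o _ => by ring
  rw [hlim] at hsum
  refine hsum.congr fun x => ?_
  have e : ∀ a, M.scaledResid x.1 a x.2 =
      ∑ s : (k : Fin 2) × Option (Fin (n k)), a s.1 s.2 • M.resid x.1 s.1 s.2 x.2 := by
    intro a
    rw [scaledResid, Fintype.sum_sigma]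
  rw [e, e, sum_inner]
  refine Finset.sum_congr rfl fun s _ => ?_
  rw [inner_sum]
  refine Finset.sum_congr rfl fun t _ => ?_
  rw [real_inner_smul_left, real_inner_smul_right]
  ring

lemma tendsto_scaledResid_inner (hS : M.IsSample P) (h2 : M.OneStrongSpike c) (h3 : M.Scores P)
    (a : (k : Fin 2) → Option (Fin (n k)) → ℝ) {v : (p : ℕ) → E p} {r : ℝ}
    (hv : Tendsto (fun p => ‖v p‖) atTop (𝓝 r)) :
    Tendsto (fun x : ℕ × Ω => ⟪M.scaledResid x.1 a x.2, v x.1⟫) (probFilter P) (𝓝 0) := by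
  have h := tendsto_finsetSum Finset.univ fun k _ => tendsto_finsetSum Finset.univ fun o _ =>
    (tendsto_inner_resid hS h2 h3 k o hv).const_mul (a k o)
  simp only [mul_zero, Finset.sum_const_zero] at h
  refine h.congr fun x => ?_
  simp only [scaledResid, sum_inner, real_inner_smul_left]

-- The orthogonality is exact, not merely asymptotic: a residual is orthogonal to the leading
-- eigenvector of its own class, and eventually both of these are multiples of `u`.
omit [MeasurableSpace Ω] in
lemma inner_scaledResid_basis {u : (p : ℕ) → E p} (hu : IsLeadingBasis M c u)
    (a : (k : Fin 2) → Option (Fin (n k)) → ℝ) :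
    ∀ᶠ p in atTop, ∀ ω, ⟪M.scaledResid p a ω, u p⟫ = 0 := by
  filter_upwards [eventually_gt_atTop 0, hu.leading_eq 0, hu.leading_eq 1] with p hp h0 h1 ω
  have hlead : ∀ k, M.leading p k = c.R k • u p := by
    intro k; fin_cases k; exacts [h0, h1]
  rw [scaledResid, sum_inner]
  refine Finset.sum_eq_zero fun k _ => ?_
  rw [sum_inner]
  refine Finset.sum_eq_zero fun o _ => ?_
  have h := inner_leading_resid (M := M) hp k o ω
  rw [hlead, real_inner_smul_left] at h
  have hR : c.R k ≠ 0 := by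
    intro h0
    have := hu.sq_R k
    simp [h0] at this
  rw [real_inner_smul_left, real_inner_comm, (mul_eq_zero.1 h).resolve_left hR, mul_zero]

section

variable {u : (p : ℕ) → E p} {L : Filter (ℕ × Ω)}
  {z : (k : Fin 2) → Option (Fin (n k)) → ℝ} {a b : (k : Fin 2) → Option (Fin (n k)) → ℝ}
  {s t : ℝ}

omit [IsProbabilityMeasure P] in
lemma tendsto_leadingCoef (hL : L ≤ probFilter P)
    (hz : ∀ k o, Tendsto (fun x : ℕ × Ω => M.z k o 0 x.2) L (𝓝 (z k o))) :
    Tendsto (fun x : ℕ × Ω => ∑ k, c.R k * spikeCoef c x.1 k * ∑ o, a k o * M.z k o 0 x.2) L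
      (𝓝 (∑ k, c.R k * √(c.σsq k) * ∑ o, a k o * z k o)) :=
  tendsto_finsetSum _ fun k _ =>
    ((((tendsto_spikeCoef k).comp (tendsto_fst_probFilter P)).mono_left hL).const_mul _).mul
      (tendsto_finsetSum _ fun o _ => (hz k o).const_mul _)

omit [IsProbabilityMeasure P] in
lemma eventually_scaled_eq (h2 : M.OneStrongSpike c) (h3 : M.Scores P)
    (hu : IsLeadingBasis M c u) (hL : L ≤ probFilter P) (ha : HasTotal a t) :
    ∀ᶠ x : ℕ × Ω in L, M.scaled x.1 a x.2 = t • ((√(x.1 : ℝ))⁻¹ • M.μ x.1) +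
      (∑ k, c.R k * spikeCoef c x.1 k * ∑ o, a k o * M.z k o 0 x.2) • u x.1 +
        M.scaledResid x.1 a x.2 := by
  have h := (tendsto_fst_probFilter P).mono_left hL
  filter_upwards [h.eventually (eventually_gt_atTop 0), h.eventually (hu.leading_eq 0),
    h.eventually (hu.leading_eq 1)] with x hp h0 h1
  exact scaled_eq h2 h3 hp (by intro k; fin_cases k; exacts [h0, h1]) ha x.2

omit [MeasurableSpace Ω] in
lemma tendsto_norm_scaled_μ (h1 : M.MeanDifference c) :
    Tendsto (fun p : ℕ => ‖(√(p : ℝ))⁻¹ • M.μ p‖) atTop (𝓝 c.δ) := by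
  refine h1.tendsto.congr fun p => ?_
  rw [norm_smul, norm_inv, Real.norm_of_nonneg (Real.sqrt_nonneg _)]
  ring

omit [IsProbabilityMeasure P] in
lemma tendsto_scaled_inner_basis (h2 : M.OneStrongSpike c) (h3 : M.Scores P)
    (hu : IsLeadingBasis M c u) (hL : L ≤ probFilter P)
    (hz : ∀ k o, Tendsto (fun x : ℕ × Ω => M.z k o 0 x.2) L (𝓝 (z k o))) (ha : HasTotal a t) :
    Tendsto (fun x : ℕ × Ω => ⟪M.scaled x.1 a x.2, u x.1⟫) L (𝓝 (limProj c t a z)) := by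
  have hfst := (tendsto_fst_probFilter P).mono_left hL
  have h := ((hu.tendsto.comp hfst).const_mul t).add
    (tendsto_leadingCoef (c := c) (a := a) hL hz)
  refine h.congr' ?_
  filter_upwards [eventually_scaled_eq h2 h3 hu hL ha,
    hfst.eventually (inner_scaledResid_basis hu a),
    hfst.eventually (eventually_gt_atTop 0)] with x hx h0 hp
  rw [hx]
  generalize (∑ k, c.R k * spikeCoef c x.1 k * ∑ o, a k o * M.z k o 0 x.2) = A
  have huu : ⟪u x.1, u x.1⟫ = 1 := by
    rw [real_inner_self_eq_norm_sq, hu.norm_eq _ hp, one_pow]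
  simp only [Function.comp_apply]
  generalize (√(x.1 : ℝ))⁻¹ • M.μ x.1 = m
  rw [inner_add_left, inner_add_left, h0, real_inner_smul_left, real_inner_smul_left, huu,
    real_inner_comm m]
  ring

/-- The limits of the Gram matrix of linear combinations of the observations. -/
lemma tendsto_inner_scaled (hS : M.IsSample P) (h1 : M.MeanDifference c)
    (h2 : M.OneStrongSpike c) (h3 : M.Scores P)
    (hu : IsLeadingBasis M c u) (hL : L ≤ probFilter P)
    (hz : ∀ k o, Tendsto (fun x : ℕ × Ω => M.z k o 0 x.2) L (𝓝 (z k o)))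
    (ha : HasTotal a t) (hb : HasTotal b s) :
    Tendsto (fun x : ℕ × Ω => ⟪M.scaled x.1 a x.2, M.scaled x.1 b x.2⟫) L
      (𝓝 (t * s * (c.δ * Real.sin c.θ) ^ 2 + limProj c t a z * limProj c s b z +
        ∑ k, c.τsq k * ∑ o, a k o * b k o)) := by
  have hfst := (tendsto_fst_probFilter P).mono_left hL
  have hμ := tendsto_norm_scaled_μ h1
  have l1 := tendsto_leadingCoef (c := c) (a := a) hL hz
  have l2 := tendsto_leadingCoef (c := c) (a := b) hL hz
  have l3 := hu.tendsto.comp hfst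
  have l4 := (hμ.comp hfst).pow 2
  have l5 := (tendsto_scaledResid_inner hS h2 h3 a hμ).mono_left hL
  have l6 := (tendsto_scaledResid_inner hS h2 h3 b hμ).mono_left hL
  have l7 := (tendsto_inner_scaledResid hS h2 h3 a b).mono_left hL
  have h := ((((l4.const_mul (t * s)).add (l3.mul ((l2.const_mul t).add (l1.const_mul s)))).add
    (l1.mul l2)).add ((l6.const_mul t).add (l5.const_mul s))).add l7
  -- The mean difference has squared length `δ²`, and `δ cos θ` of it lies along `u`. Collecting the
  -- `u`-components into `limProj` leaves `δ² sin² θ`.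
  have e : t * s * (c.δ * Real.sin c.θ) ^ 2 + limProj c t a z * limProj c s b z =
      t * s * c.δ ^ 2 + c.δ * Real.cos c.θ *
        (t * (∑ k, c.R k * √(c.σsq k) * ∑ o, b k o * z k o) +
          s * (∑ k, c.R k * √(c.σsq k) * ∑ o, a k o * z k o)) +
      (∑ k, c.R k * √(c.σsq k) * ∑ o, a k o * z k o) *
        (∑ k, c.R k * √(c.σsq k) * ∑ o, b k o * z k o) + (t * 0 + s * 0) := by
    rw [limProj, limProj, mul_pow, Real.sin_sq]
    ring
  rw [e]
  refine h.congr' ?_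
  filter_upwards [eventually_scaled_eq h2 h3 hu hL ha, eventually_scaled_eq h2 h3 hu hL hb,
    hfst.eventually (inner_scaledResid_basis hu a),
    hfst.eventually (inner_scaledResid_basis hu b),
    hfst.eventually (eventually_gt_atTop 0)] with x hxa hxb ha0 hb0 hp
  simp only [Function.comp_apply]
  rw [hxa, hxb]
  generalize (∑ k, c.R k * spikeCoef c x.1 k * ∑ o, a k o * M.z k o 0 x.2) = A
  generalize (∑ k, c.R k * spikeCoef c x.1 k * ∑ o, b k o * M.z k o 0 x.2) = B
  have huu : ⟪u x.1, u x.1⟫ = 1 := by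
    rw [real_inner_self_eq_norm_sq, hu.norm_eq _ hp, one_pow]
  rw [← real_inner_self_eq_norm_sq]
  generalize (√(x.1 : ℝ))⁻¹ • M.μ x.1 = m
  simp only [inner_add_left, inner_add_right, real_inner_smul_left, real_inner_smul_right, huu, ha0,
    real_inner_comm (M.scaledResid x.1 b x.2), hb0, real_inner_comm (u x.1) m]
  ring

end

end Model

end GramLimits

/-! ### The sample as a spectral configuration -/

section SampleConfig

variable {Ω : Type*} {n : Fin 2 → ℕ} {M : Model Ω n} {c : Params} {S : SampleEigen Ω}

namespace Model

/-- Coefficients of the training observations, extended by `0` to the test observations. -/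
def trainCoef (a : (k : Fin 2) → Fin (n k) → ℝ) : (k : Fin 2) → Option (Fin (n k)) → ℝ :=
  fun k o => o.elim 0 (a k)

/-- The sign with which class `k` enters differences between the classes. -/
def classSign (k : Fin 2) : ℝ := if k = 0 then 1 else -1

/-- The coefficients of the sample mean difference. -/
noncomputable def meanCoef (n : Fin 2 → ℕ) : (k : Fin 2) → Option (Fin (n k)) → ℝ :=
  fun k o => classSign k * o.elim 0 fun _ => (n k : ℝ)⁻¹

/-- The coefficients of the difference of the test observations. -/
noncomputable def testCoef (n : Fin 2 → ℕ) : (k : Fin 2) → Option (Fin (n k)) → ℝ :=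
  fun k o => classSign k * o.elim 1 fun _ => 0

lemma hasTotal_trainCoef {a : (k : Fin 2) → Fin (n k) → ℝ} (ha : Centered a) :
    HasTotal (trainCoef a) 0 := by
  constructor <;> simp [trainCoef, Fintype.sum_option, ha _]

lemma hasTotal_meanCoef (hn : ∀ k, (n k : ℝ) ≠ 0) : HasTotal (meanCoef n) 1 := by
  constructor <;> simp [meanCoef, classSign, Fintype.sum_option, hn]

lemma hasTotal_testCoef : HasTotal (testCoef n) 1 := by
  constructor <;> simp [testCoef, classSign, Fintype.sum_option]

/-- The eigendecomposition of the scaled within-class scatter matrix. -/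
noncomputable def config (M : Model Ω n) (hS : S.IsEigenOf M) (hn : ∀ k, (n k : ℝ) ≠ 0)
    (x : ℕ × Ω) : SpectralConfig n x.1 where
  V := fun k j => (√(x.1 : ℝ))⁻¹ • (M.X x.1 k (some j) x.2 - M.sampleMean x.1 k x.2)
  basis := S.eigvec x.1 x.2
  ev := fun i => S.eigval x.1 x.2 i / x.1
  antitone := fun i j hij => by
    have := (hS x.1 x.2).1 hij
    dsimp only
    gcongr
  eigen := fun i => by
    have h := (hS x.1 x.2).2 i
    simp only [withinScatter, _root_.sum_apply, InnerProductSpace.rankOne_apply] at h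
    rw [div_eq_inv_mul, mul_smul, ← h, Finset.smul_sum]
    refine Finset.sum_congr rfl fun k _ => ?_
    rw [Finset.smul_sum]
    refine Finset.sum_congr rfl fun j _ => ?_
    have hp : (√(x.1 : ℝ))⁻¹ * (√(x.1 : ℝ))⁻¹ = (x.1 : ℝ)⁻¹ := by
      rw [← mul_inv, Real.mul_self_sqrt (Nat.cast_nonneg _)]
    rw [real_inner_smul_left, smul_smul, smul_smul, ← hp]
    congr 1
    ring
  centered := fun k => by
    rw [← Finset.smul_sum, Finset.sum_sub_distrib, sampleMean]
    simp only [Finset.sum_const, Finset.card_univ, Fintype.card_fin]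
    rw [← Nat.cast_smul_eq_nsmul ℝ, smul_smul, mul_inv_cancel₀ (hn k), one_smul, sub_self,
      smul_zero]

variable {hS : S.IsEigenOf M} {hn : ∀ k, (n k : ℝ) ≠ 0}

lemma config_comb {a : (k : Fin 2) → Fin (n k) → ℝ} (ha : Centered a) (x : ℕ × Ω) :
    (M.config hS hn x).comb a = M.scaled x.1 (trainCoef a) x.2 := by
  simp only [SpectralConfig.comb, scaled, config, trainCoef, Fintype.sum_option, Option.elim_none,
    zero_smul, zero_add, Option.elim_some]
  refine Finset.sum_congr rfl fun k _ => ?_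
  simp only [smul_sub, Finset.sum_sub_distrib]
  rw [← Finset.sum_smul, ha k, zero_smul, sub_zero]

lemma config_V (x : ℕ × Ω) (k : Fin 2) (j : Fin (n k)) :
    (M.config hS hn x).V k j = M.scaled x.1 (trainCoef (deviation k j)) x.2 := by
  rw [← config_comb (hS := hS) (hn := hn) (deviation_centered k (hn k) j),
    SpectralConfig.comb, Finset.sum_eq_single k]
  · rw [sum_smul_deviation, (M.config hS hn x).centered, smul_zero, sub_zero]
  · intro k' _ hk
    simp [deviation_of_ne hk]
  · simp

lemma scaled_meanCoef (p : ℕ) (ω : Ω) :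
    M.scaled p (meanCoef n) ω = (√(p : ℝ))⁻¹ • M.d p ω := by
  simp only [scaled, meanCoef, classSign, Fintype.sum_option, Fin.sum_univ_two, d, sampleMean,
    Option.elim_none, Option.elim_some, mul_zero, zero_smul, zero_add, ← Finset.smul_sum, if_true,
    one_ne_zero, if_false]
  module

lemma scaled_testCoef (p : ℕ) (ω : Ω) :
    M.scaled p (testCoef n) ω = (√(p : ℝ))⁻¹ • (M.X p 0 none ω - M.X p 1 none ω) := by
  simp only [scaled, testCoef, classSign, Fintype.sum_option, Fin.sum_univ_two,
    Option.elim_none, Option.elim_some, mul_zero, zero_smul, if_true,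
    one_ne_zero, if_false, Finset.sum_const_zero]
  module

/-- The limits of the coefficients of the scaled centered training observations in the direction of
the common leading eigenvector. -/
noncomputable def limW (c : Params) (z : (k : Fin 2) → Option (Fin (n k)) → ℝ) :
    (k : Fin 2) → Fin (n k) → ℝ :=
  fun k j => c.R k * √(c.σsq k) * (z k (some j) - (n k : ℝ)⁻¹ * ∑ j', z k (some j'))

lemma limW_centered (hn : ∀ k, (n k : ℝ) ≠ 0) (z : (k : Fin 2) → Option (Fin (n k)) → ℝ) :
    Centered (limW c z) := by
  intro k
  simp only [limW]
  rw [← Finset.mul_sum, Finset.sum_sub_distrib]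
  simp [hn k]

lemma limProj_trainCoef {a : (k : Fin 2) → Fin (n k) → ℝ} (ha : Centered a)
    (z : (k : Fin 2) → Option (Fin (n k)) → ℝ) :
    limProj c 0 (trainCoef a) z = dot a (limW c z) := by
  simp only [limProj, zero_mul, zero_add, trainCoef, Fintype.sum_option, Option.elim_none,
    Option.elim_some, dot, limW]
  refine Finset.sum_congr rfl fun k _ => ?_
  have : ∀ j, a k j * (c.R k * √(c.σsq k) * (z k (some j) - (n k : ℝ)⁻¹ * ∑ j', z k (some j'))) =
      c.R k * √(c.σsq k) * (a k j * z k (some j)) -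
        a k j * (c.R k * √(c.σsq k) * ((n k : ℝ)⁻¹ * ∑ j', z k (some j'))) := fun j => by ring
  simp only [this, Finset.sum_sub_distrib, ← Finset.mul_sum, ← Finset.sum_mul, ha k]
  ring

lemma limProj_deviation (hn : ∀ k, (n k : ℝ) ≠ 0) (z : (k : Fin 2) → Option (Fin (n k)) → ℝ)
    (k : Fin 2) (j : Fin (n k)) :
    limProj c 0 (trainCoef (deviation k j)) z = limW c z k j := by
  rw [limProj_trainCoef (deviation_centered k (hn k) j), dot_comm,
    dot_deviation (limW_centered hn z)]

lemma sum_trainCoef_mul_trainCoef (a b : (k : Fin 2) → Fin (n k) → ℝ) (k : Fin 2) :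
    ∑ o, trainCoef a k o * trainCoef b k o = blockDot k a b := by
  simp [trainCoef, Fintype.sum_option, blockDot]

lemma sum_trainCoef_mul_meanCoef {a : (k : Fin 2) → Fin (n k) → ℝ} (ha : Centered a) (k : Fin 2) :
    ∑ o, trainCoef a k o * meanCoef n k o = 0 := by
  simp [trainCoef, meanCoef, Fintype.sum_option, ← Finset.sum_mul, ha k]

lemma sum_trainCoef_mul_testCoef (a : (k : Fin 2) → Fin (n k) → ℝ) (k : Fin 2) :
    ∑ o, trainCoef a k o * testCoef n k o = 0 := by
  simp [trainCoef, testCoef, Fintype.sum_option]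

lemma sum_meanCoef_mul_testCoef (k : Fin 2) : ∑ o, meanCoef n k o * testCoef n k o = 0 := by
  simp [meanCoef, testCoef, Fintype.sum_option]

lemma sum_meanCoef_mul_meanCoef (hn : ∀ k, (n k : ℝ) ≠ 0) (k : Fin 2) :
    ∑ o, meanCoef n k o * meanCoef n k o = (n k : ℝ)⁻¹ := by
  have hs : classSign k * classSign k = 1 := by
    unfold classSign; split_ifs <;> norm_num
  have h0 := hn k
  simp only [meanCoef, Fintype.sum_option, Option.elim_none, Option.elim_some, Finset.sum_const,
    Finset.card_univ, Fintype.card_fin, nsmul_eq_mul]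
  calc _ = classSign k * classSign k * ((n k : ℝ) * (n k : ℝ)⁻¹ * (n k : ℝ)⁻¹) := by ring
    _ = _ := by rw [hs, mul_inv_cancel₀ h0]; ring

variable [MeasurableSpace Ω] {P : Measure Ω} [IsProbabilityMeasure P]

section Local

variable {u : (p : ℕ) → E p} {U : Ultrafilter (ℕ × Ω)}
  {z : (k : Fin 2) → Option (Fin (n k)) → ℝ}

/-- Convergence of the spectrum of the sample, localised at a value `z` of the leading scores. -/
lemma exists_limitSpectrum_config (hSample : M.IsSample P) (h1 : M.MeanDifference c)
    (h2 : M.OneStrongSpike c) (h3 : M.Scores P) (hτ : c.τsq 1 < c.τsq 0)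
    (hn2 : ∀ k, 2 ≤ n k) (hu : IsLeadingBasis M c u) (hU : (U : Filter (ℕ × Ω)) ≤ probFilter P)
    (hz : ∀ k o, Tendsto (fun x : ℕ × Ω => M.z k o 0 x.2) U (𝓝 (z k o)))
    (hpos : ∀ k, 0 < blockDot k (limW c z) (limW c z)) {N : ℕ} (hN : N + 2 = n 0 + n 1) :
    ∃ (y : Fin N → (k : Fin 2) → Fin (n k) → ℝ) (ℓ : Fin N → ℝ),
      LimitSpectrum n N c.τsq (limW c z) y ℓ ∧
      (∀ i : Fin N, Tendsto (fun x => (M.config hS hn x).val i) U (𝓝 (ℓ i))) ∧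
      (∀ i : Fin N, Tendsto (fun x => ⟪(M.config hS hn x).vec i, u x.1⟫) U
        (𝓝 (loading (limW c z) y ℓ i))) ∧
      (∀ i : Fin N, Tendsto (fun x => ⟪(M.config hS hn x).vec i,
        M.scaled x.1 (meanCoef n) x.2⟫) U
        (𝓝 (limProj c 1 (meanCoef n) z * loading (limW c z) y ℓ i))) ∧
      ∀ i : Fin N, Tendsto (fun x => ⟪(M.config hS hn x).vec i,
        M.scaled x.1 (testCoef n) x.2⟫) U
        (𝓝 (limProj c 1 (testCoef n) z * loading (limW c z) y ℓ i)) := by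
  have hdev := fun k j => hasTotal_trainCoef (deviation_centered k (hn k) j)
  obtain ⟨y, ℓ, hspec, hℓ, hq⟩ := exists_limitSpectrum (U := U) (C := M.config hS hn) hN hn2
    h2.τsq_pos hτ (limW_centered hn z) hpos
    (by
      intro k j
      have h := tendsto_inner_scaled hSample h1 h2 h3 hu hU hz (hdev k j) (hdev k j)
      have h' := (Real.continuous_sqrt.tendsto _).comp h
      obtain ⟨B, hB⟩ := h'.isBoundedUnder_le
      refine ⟨B, (eventually_map.1 hB).mono fun x hx => ?_⟩
      rw [config_V, norm_eq_sqrt_real_inner]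
      exact hx)
    (by
      intro a b ha hb
      have h := tendsto_inner_scaled hSample h1 h2 h3 hu hU hz (hasTotal_trainCoef ha)
        (hasTotal_trainCoef hb)
      simp only [limProj_trainCoef ha, limProj_trainCoef hb, sum_trainCoef_mul_trainCoef, zero_mul,
        zero_add] at h
      rw [dot_comm (a := limW c z), dot_comm (a := limW c z)]
      refine h.congr fun x => ?_
      rw [config_comb ha, config_comb hb])
  refine ⟨y, ℓ, hspec, hℓ, ?_, hq _ _ fun k j => ?_, hq _ _ fun k j => ?_⟩
  · have := hq (fun x => u x.1) 1 fun k j => by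
      have h := tendsto_scaled_inner_basis h2 h3 hu hU hz (hdev k j)
      rw [limProj_deviation hn] at h
      rw [one_mul]
      exact h.congr fun x => by rw [config_V]
    simpa only [one_mul] using this
  -- Centered coefficients have total `0` and are orthogonal to the constant coefficients of the
  -- class means. The sample mean difference therefore meets the centered data only through its
  -- component along `u`.
  · have h := tendsto_inner_scaled hSample h1 h2 h3 hu hU hz (hdev k j) (hasTotal_meanCoef hn)
    simp only [limProj_deviation hn,
      sum_trainCoef_mul_meanCoef (deviation_centered k (hn k) j), mul_zero,
      Finset.sum_const_zero, add_zero, zero_mul, zero_add] at h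
    rw [mul_comm]
    exact h.congr fun x => by rw [config_V]
  · have h := tendsto_inner_scaled hSample h1 h2 h3 hu hU hz (hdev k j) (hasTotal_testCoef (n := n))
    simp only [limProj_deviation hn,
      sum_trainCoef_mul_testCoef, mul_zero,
      Finset.sum_const_zero, add_zero, zero_mul, zero_add] at h
    rw [mul_comm]
    exact h.congr fun x => by rw [config_V]

/-- The squared norm of the limit of the component of the sample mean difference orthogonal to the
leading eigenspace. -/
noncomputable def limNoise (n : Fin 2 → ℕ) (c : Params) : ℝ :=
  (c.δ * Real.sin c.θ) ^ 2 + ∑ k, c.τsq k * (n k : ℝ)⁻¹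

/-- The asymptotic distance between the piles of test data, in terms of the leading scores. -/
noncomputable def limDist (c : Params) (k : Fin 2) (z : (k : Fin 2) → Option (Fin (n k)) → ℝ) : ℝ :=
  |(c.δ * Real.sin c.θ) ^ 2| / √(limNoise n c + limProj c 1 (meanCoef n) z ^ 2 *
    (c.τsq k / blockDot k (limW c z) (limW c z)))

omit [MeasurableSpace Ω] in
lemma limNoise_pos (h2 : M.OneStrongSpike c) (hn2 : ∀ k, 2 ≤ n k) : 0 < limNoise n c := by
  have h0 := h2.τsq_pos 0
  have h1 := h2.τsq_pos 1
  have := hn2 0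
  have := hn2 1
  rw [limNoise, Fin.sum_univ_two]
  positivity

lemma tendsto_ridge_config (hSample : M.IsSample P) (h1 : M.MeanDifference c)
    (h2 : M.OneStrongSpike c) (h3 : M.Scores P) (hτ : c.τsq 1 < c.τsq 0)
    (hn2 : ∀ k, 2 ≤ n k) (hu : IsLeadingBasis M c u) (hU : (U : Filter (ℕ × Ω)) ≤ probFilter P)
    (hz : ∀ k o, Tendsto (fun x : ℕ × Ω => M.z k o 0 x.2) U (𝓝 (z k o)))
    (hpos : ∀ k, 0 < blockDot k (limW c z) (limW c z)) {N : ℕ} (hN : N + 2 = n 0 + n 1)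
    (k : Fin 2) {α : ℕ × Ω → ℝ} (hα : Tendsto α U (𝓝 (-c.τsq k))) :
    Tendsto (fun x => |⟪(M.config hS hn x).ridge N (α x) (M.scaled x.1 (meanCoef n) x.2),
      M.scaled x.1 (testCoef n) x.2⟫| /
        ‖(M.config hS hn x).ridge N (α x) (M.scaled x.1 (meanCoef n) x.2)‖) U
      (𝓝 (limDist c k z)) := by
  obtain ⟨y, ℓ, hspec, hℓ, -, he, hq⟩ :=
    exists_limitSpectrum_config (hS := hS) (hn := hn) hSample h1 h2 h3 hτ hn2 hu hU hz hpos hN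
  refine tendsto_ridge hspec hℓ k hα (limNoise_pos h2 hn2) he hq ?_ ?_
  · have h := tendsto_inner_scaled hSample h1 h2 h3 hu hU hz (hasTotal_meanCoef hn)
      (hasTotal_testCoef (n := n))
    simpa only [sum_meanCoef_mul_testCoef, mul_zero, Finset.sum_const_zero, add_zero, one_mul]
      using h
  · have h := tendsto_inner_scaled hSample h1 h2 h3 hu hU hz (hasTotal_meanCoef hn)
      (hasTotal_meanCoef hn)
    simp only [sum_meanCoef_mul_meanCoef hn, one_mul] at h
    convert h using 2
    rw [limNoise]
    ring

end Local

end Model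

end SampleConfig

/-! ### Signal indices and the asymptotic distance -/

section AsymptoticDistance

variable {Ω : Type*} {n : Fin 2 → ℕ} {M : Model Ω n} {c : Params} {S : SampleEigen Ω}

lemma angleSubspace_span_singleton {p : ℕ} {w u : E p} (hu : ‖u‖ = 1) (hw : ‖w‖ = 1) :
    angleSubspace w (Submodule.span ℝ {u}) = Real.arccos |⟪w, u⟫| := by
  rw [angleSubspace, Submodule.starProjection_unit_singleton ℝ hu, InnerProductGeometry.angle,
    norm_smul, hu, hw, real_inner_smul_right, real_inner_comm w u, Real.norm_eq_abs, mul_one,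
    one_mul, ← abs_mul_abs_self, mul_self_div_self]

namespace Model

/-- The leading scores of all observations. -/
def leadingScores (M : Model Ω n) (ω : Ω) : (k : Fin 2) → Option (Fin (n k)) → ℝ :=
  fun k o => M.z k o 0 ω

/-- The values of the leading scores for which the leading scores of neither class have empirical
variance zero. -/
def goodScores (c : Params) (n : Fin 2 → ℕ) : Set ((k : Fin 2) → Option (Fin (n k)) → ℝ) :=
  {z | ∀ k, 0 < blockDot k (limW c z) (limW c z)}

variable {hS : S.IsEigenOf M} {hn : ∀ k, (n k : ℝ) ≠ 0}

lemma angle_eq {u : (p : ℕ) → E p} (hu : IsLeadingBasis M c u) {p : ℕ} (hp : 0 < p) (ω : Ω)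
    (i : ℕ) :
    (if h : i < p then angleSubspace (S.eigvec p ω ⟨i, h⟩) (M.leadingSpace p) else Real.pi / 2) =
      Real.arccos |⟪(M.config hS hn (p, ω)).vec i, u p⟫| := by
  split_ifs with h
  · rw [hu.span_eq p hp, angleSubspace_span_singleton (hu.norm_eq p hp) (by simp)]
    simp [SpectralConfig.vec, h, config]
  · rw [SpectralConfig.vec_of_le _ (not_lt.1 h)]
    simp

/-- Dividing the eigenvalues by `p` turns the ridge parameter `α p` into `α` and leaves the weights
unchanged. Both signal indices are below `N`, so the two ranges of weights do not overlap. -/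
lemma smul_ridgeVector {N : ℕ} (hN : N + 2 = n 0 + n 1) (hn2 : ∀ k, 2 ≤ n k) {p : ℕ} (hp : 0 < p)
    (α : ℝ) (ω : Ω) :
    (√(p : ℝ))⁻¹ • ridgeVector M S {i | i = 0 ∨ i + 1 = n 0} p α ω =
      (M.config hS hn (p, ω)).ridge N α (M.scaled p (meanCoef n) ω) := by
  have hp' : (p : ℝ) ≠ 0 := by positivity
  have h0 := hn2 0
  have h1 := hn2 1
  rw [ridgeVector, ← Finset.sum_add_distrib, Finset.smul_sum, SpectralConfig.ridge]
  refine Finset.sum_congr rfl fun i _ => ?_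
  rw [SpectralConfig.vec_fin, scaled_meanCoef, real_inner_smul_right, SpectralConfig.weight,
    SpectralConfig.val_fin]
  simp only [config, Set.mem_ofPred_eq]
  by_cases hiN : N ≤ i
  · have hi1 : ¬ ((i : ℕ) = 0 ∨ (i : ℕ) + 1 = n 0) := by omega
    have hi2 : n 0 + n 1 ≤ (i : ℕ) + 2 := by omega
    rw [if_neg hi1, if_pos hi2, if_pos hiN, zero_add, smul_smul, one_mul]
  · have hi2 : ¬ n 0 + n 1 ≤ (i : ℕ) + 2 := by omega
    rw [if_neg hi2, if_neg hiN, add_zero]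
    by_cases hi1 : (i : ℕ) = 0 ∨ (i : ℕ) + 1 = n 0
    · rw [if_pos hi1, if_pos hi1, smul_smul]
      congr 1
      have : S.eigval p ω i / p + α = (S.eigval p ω i + α * p) / p := by field_simp
      rw [this, div_div_eq_mul_div]
      ring
    · rw [if_neg hi1, if_neg hi1, smul_zero, zero_mul, zero_smul]

lemma continuous_blockDot_limW (c : Params) (k : Fin 2) :
    Continuous fun z : (k : Fin 2) → Option (Fin (n k)) → ℝ =>
      blockDot k (limW c z) (limW c z) := by
  unfold blockDot limW
  fun_prop

lemma continuous_limProj (c : Params) (t : ℝ) (a : (k : Fin 2) → Option (Fin (n k)) → ℝ) :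
    Continuous (limProj c t a) := by
  unfold limProj
  fun_prop

lemma measurable_limDist (c : Params) (k : Fin 2) : Measurable (limDist (n := n) c k) := by
  have h1 := (continuous_limProj c 1 (meanCoef n)).measurable
  have h2 := (continuous_blockDot_limW (n := n) c k).measurable
  unfold limDist
  fun_prop

lemma continuousAt_limDist (h2 : M.OneStrongSpike c) (hn2 : ∀ k, 2 ≤ n k) (k : Fin 2)
    {z : (k : Fin 2) → Option (Fin (n k)) → ℝ} (hz : z ∈ goodScores c n) :
    ContinuousAt (limDist c k) z := by
  have hpos := limNoise_pos h2 hn2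
  have hτ := h2.τsq_pos k
  have hk := hz k
  refine ContinuousAt.div continuousAt_const (Real.continuous_sqrt.continuousAt.comp ?_) ?_
  · refine continuousAt_const.add (((continuous_limProj c 1 _).continuousAt.pow 2).mul ?_)
    exact continuousAt_const.div (continuous_blockDot_limW c k).continuousAt hk.ne'
  · exact (Real.sqrt_pos.2 (by positivity)).ne'

variable [MeasurableSpace Ω] {P : Measure Ω}

lemma measurable_leadingScores (hSample : M.IsSample P) (h3 : M.Scores P) :
    Measurable M.leadingScores :=
  measurable_pi_lambda _ fun k => measurable_pi_lambda _ fun o => measurable_z hSample h3 k o 0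

lemma tendsto_leadingScores {U : Filter (ℕ × Ω)} {z : (k : Fin 2) → Option (Fin (n k)) → ℝ}
    (hU : U ≤ probFilter P ⊓ comap (fun x => M.leadingScores x.2) (𝓝 z)) (k : Fin 2)
    (o : Option (Fin (n k))) : Tendsto (fun x : ℕ × Ω => M.z k o 0 x.2) U (𝓝 (z k o)) := by
  have h : Tendsto (fun x : ℕ × Ω => M.leadingScores x.2) U (𝓝 z) :=
    tendsto_comap.mono_left (hU.trans inf_le_right)
  exact tendsto_pi_nhds.1 (tendsto_pi_nhds.1 h k) o

variable [IsProbabilityMeasure P]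

/-- The signal indices are the first one and the `n₁`-th one. -/
lemma signalIndices_eq (hSample : M.IsSample P) (h1 : M.MeanDifference c)
    (h2 : M.OneStrongSpike c) (h3 : M.Scores P) (h5 : M.CommonLeadingSpace c)
    (hτ : c.τsq 1 < c.τsq 0) (hn2 : ∀ k, 2 ≤ n k) (hS : S.IsEigenOf M)
    (hgood : ∀ᵐ ω ∂P, M.leadingScores ω ∈ goodScores c n) :
    signalIndices P M S = {i | i = 0 ∨ i + 1 = n 0} := by
  obtain ⟨u, hu⟩ := exists_isLeadingBasis h1 h5
  have hn : ∀ k, (n k : ℝ) ≠ 0 := fun k => by have := hn2 k; positivity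
  have g0 := hn2 0
  have g1 := hn2 1
  obtain ⟨N, hN⟩ : ∃ N, N + 2 = n 0 + n 1 := ⟨n 0 + n 1 - 2, by omega⟩
  have hZ := measurable_leadingScores hSample h3
  have hangle : ∀ i, (fun x : ℕ × Ω => if h : i < x.1 then
      angleSubspace (S.eigvec x.1 x.2 ⟨i, h⟩) (M.leadingSpace x.1) else Real.pi / 2)
        =ᶠ[probFilter P] fun x => Real.arccos |⟪(M.config hS hn x).vec i, u x.1⟫| := by
    intro i
    filter_upwards [(tendsto_fst_probFilter P).eventually (eventually_gt_atTop 0)] with x hx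
    exact angle_eq hu hx x.2 i
  ext i
  simp only [signalIndices, Set.mem_ofPred_eq]
  constructor
  · rintro ⟨hi, hnt⟩
    by_contra hc
    refine hnt (tendstoInMeasure_of_localised hZ hgood (D := fun _ => Real.pi / 2)
      (fun _ _ => continuousAt_const) fun z hz => ?_)
    rw [tendsto_congr' ((hangle i).filter_mono inf_le_left), tendsto_iff_ultrafilter]
    intro U hU
    obtain ⟨y, ℓ, hspec, -, hload, -⟩ := exists_limitSpectrum_config (hS := hS) (hn := hn) hSample
      h1 h2 h3 hτ hn2 hu (hU.trans inf_le_left) (tendsto_leadingScores hU) hz hN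
    have h0 : loading (limW c z) y ℓ ⟨i, by omega⟩ = 0 := by
      by_contra hne
      exact hc ((hspec.loading_ne_zero_iff _).1 hne)
    have h := hload ⟨i, by omega⟩
    rw [h0] at h
    have h' := (Real.continuous_arccos.tendsto _).comp h.abs
    rw [abs_zero, Real.arccos_zero] at h'
    exact h'
  · intro hi
    refine ⟨by omega, fun ht => ?_⟩
    -- One ultrafilter along which the loading has a nonzero limit refutes convergence of the angle
    -- to `π / 2`.
    obtain ⟨z, hz, hne⟩ := exists_neBot_localised hZ hgood
    have hU := Ultrafilter.of_le (probFilter P ⊓ comap (fun x => M.leadingScores x.2) (𝓝 z))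
    set U := Ultrafilter.of (probFilter P ⊓ comap (fun x => M.leadingScores x.2) (𝓝 z))
    obtain ⟨y, ℓ, hspec, -, hload, -⟩ := exists_limitSpectrum_config (hS := hS) (hn := hn) hSample
      h1 h2 h3 hτ hn2 hu (hU.trans inf_le_left) (tendsto_leadingScores hU) hz hN
    have hne0 := (hspec.loading_ne_zero_iff ⟨i, by omega⟩).2 hi
    rw [tendstoInMeasure_iff_tendsto_probFilter] at ht
    have h1 := (ht.mono_left (hU.trans inf_le_left)).add_const (Real.pi / 2)
    simp only [sub_add_cancel, zero_add] at h1
    have h2 := (Real.continuous_cos.tendsto _).comp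
      (h1.congr' ((hangle i).filter_mono (hU.trans inf_le_left)))
    rw [Real.cos_pi_div_two] at h2
    refine hne0 (abs_eq_zero.1 (tendsto_nhds_unique (hload ⟨i, by omega⟩).abs (h2.congr' ?_)))
    filter_upwards [((tendsto_fst_probFilter P).eventually (eventually_gt_atTop 0)).filter_mono
      (hU.trans inf_le_left)] with x hx
    refine Real.cos_arccos (by linarith [abs_nonneg ⟪(M.config hS hn x).vec i, u x.1⟫]) ?_
    refine (abs_real_inner_le_norm _ _).trans ?_
    rw [hu.norm_eq _ hx, mul_one]
    exact SpectralConfig.norm_vec_le _ i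

/-- The asymptotic distance between the piles of test data along the projected ridge direction. -/
lemma isAsymptoticDistance_limDist (hSample : M.IsSample P) (h1 : M.MeanDifference c)
    (h2 : M.OneStrongSpike c) (h3 : M.Scores P) (h5 : M.CommonLeadingSpace c)
    (hτ : c.τsq 1 < c.τsq 0) (hn2 : ∀ k, 2 ≤ n k) (hS : S.IsEigenOf M)
    (hgood : ∀ᵐ ω ∂P, M.leadingScores ω ∈ goodScores c n) (k : Fin 2) {α : ℕ → Ω → ℝ}
    (hα : TendstoInMeasure P α atTop (fun _ => -c.τsq k)) :
    IsAsymptoticDistance P M (fun p ω => projectedRidge P M S p (α p ω) ω)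
      fun ω => limDist c k (M.leadingScores ω) := by
  obtain ⟨u, hu⟩ := exists_isLeadingBasis h1 h5
  have hn : ∀ k, (n k : ℝ) ≠ 0 := fun k => by have := hn2 k; positivity
  have g0 := hn2 0
  have g1 := hn2 1
  obtain ⟨N, hN⟩ : ∃ N, N + 2 = n 0 + n 1 := ⟨n 0 + n 1 - 2, by omega⟩
  have hD := signalIndices_eq hSample h1 h2 h3 h5 hτ hn2 hS hgood
  rw [tendstoInMeasure_iff_tendsto_probFilter] at hα
  have hα' : Tendsto (fun x : ℕ × Ω => α x.1 x.2) (probFilter P) (𝓝 (-c.τsq k)) := by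
    have := hα.add_const (-c.τsq k)
    simpa only [sub_add_cancel, zero_add] using this
  refine tendstoInMeasure_of_localised (measurable_leadingScores hSample h3) hgood
    (fun z hz => continuousAt_limDist h2 hn2 k hz) fun z hz => ?_
  rw [tendsto_iff_ultrafilter]
  intro U hU
  refine (tendsto_ridge_config (hS := hS) (hn := hn) hSample h1 h2 h3 hτ hn2 hu
    (hU.trans inf_le_left) (tendsto_leadingScores hU) hz hN k
    (hα'.mono_left (hU.trans inf_le_left))).congr' ?_
  filter_upwards [((tendsto_fst_probFilter P).eventually (eventually_gt_atTop 0)).filter_mono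
      (hU.trans inf_le_left)] with x hx
  have hp : (0 : ℝ) < x.1 := by exact_mod_cast hx
  have hs : 0 < √(x.1 : ℝ) := Real.sqrt_pos.2 hp
  rw [← smul_ridgeVector hN hn2 hx, scaled_testCoef, projectedRidge, hD, real_inner_smul_left,
    real_inner_smul_right, real_inner_smul_left, norm_smul, abs_mul, abs_mul, abs_mul,
    abs_of_nonneg (inv_nonneg.2 (norm_nonneg _)), abs_of_pos (inv_pos.2 hs), norm_inv,
    Real.norm_of_nonneg hs.le]
  field_simp

end Model

end AsymptoticDistance

/-! ### Almost sure nondegeneracy of the leading scores -/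

section LeadingScores

variable {Ω : Type*} {n : Fin 2 → ℕ} {M : Model Ω n} {c : Params} [MeasurableSpace Ω]
  {P : Measure Ω} [IsProbabilityMeasure P]

/-- A linear form of independent random variables without atoms has no atoms. -/
lemma ae_sum_mul_ne {ι : Type*} [Fintype ι] {Z : ι → Ω → ℝ}
    (hZ : ∀ i, Measurable (Z i)) (hind : iIndepFun Z P) (hna : ∀ i x, P {ω | Z i ω = x} = 0)
    {a : ι → ℝ} {i : ι} (hi : a i ≠ 0) (t : ℝ) : ∀ᵐ ω ∂P, ∑ j, a j * Z j ω ≠ t := by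
  classical
  have hm : ∀ j, Measurable fun ω => a j * Z j ω := fun j => (hZ j).const_mul _
  have hmT : Measurable (∑ j ∈ Finset.univ.erase i, fun ω => a j * Z j ω) :=
    by fun_prop
  have hI := (hind.comp (fun j x => a j * x)
    fun j => measurable_const_mul _).indepFun_finsetSum_of_notMem hm
      (Finset.notMem_erase i Finset.univ)
  have hmap := (indepFun_iff_map_prod_eq_prod_map_map hmT.aemeasurable (hm i).aemeasurable).1 hI
  have hs : MeasurableSet {q : ℝ × ℝ | q.1 + q.2 = t} :=
    measurableSet_eq_fun (measurable_fst.add measurable_snd) measurable_const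
  have h0 : (P.map fun ω => ((∑ j ∈ Finset.univ.erase i, fun ω => a j * Z j ω) ω, a i * Z i ω))
      {q : ℝ × ℝ | q.1 + q.2 = t} = 0 := by
    rw [show (P.map fun ω => ((∑ j ∈ Finset.univ.erase i, fun ω => a j * Z j ω) ω, a i * Z i ω)) = _
      from hmap, Measure.measure_prod_null hs]
    -- Fubini: with the other summands fixed at `s`, the equation determines `Z i`, because `a i ≠
    -- 0`.
    refine Eventually.of_forall fun s => ?_
    dsimp only
    rw [Measure.map_apply (hm i) (measurable_prodMk_left hs), Pi.zero_apply,
      ← hna i ((t - s) / a i)]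
    congr 1
    ext ω
    simp only [Set.mem_preimage, Set.mem_ofPred_eq, eq_div_iff hi]
    constructor <;> intro h <;> linarith
  rw [Measure.map_apply (hmT.prodMk (hm i)) hs] at h0
  rw [ae_iff]
  refine measure_mono_null (fun ω hω => ?_) h0
  simp only [Set.mem_ofPred_eq, not_not, Set.mem_preimage, Finset.sum_apply] at hω ⊢
  rw [← hω, Finset.sum_erase_add _ _ (Finset.mem_univ i)]

namespace Model

-- The leading score is already present in dimension `1`, where it determines the observation. Its
-- level sets are thus preimages of single points, which are null by absolute continuity.
omit [IsProbabilityMeasure P] in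
lemma measure_leading_score_eq (hSample : M.IsSample P) (h2 : M.OneStrongSpike c)
    (h3 : M.Scores P) (k : Fin 2) (o : Option (Fin (n k))) (x : ℝ) :
    P {ω | M.z k o 0 ω = x} = 0 := by
  have hsub : {y : E 1 | ⟪M.eigvec 1 k 0, y - M.mean 1 k⟫ =
      √(M.eigval 1 k 0) * x}.Subsingleton := by
    intro y hy y' hy'
    rw [← sub_left_inj (a := M.mean 1 k)]
    refine (M.eigvec 1 k).repr.injective (PiLp.ext fun i => ?_)
    rw [OrthonormalBasis.repr_apply_apply, OrthonormalBasis.repr_apply_apply, Subsingleton.elim i 0]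
    exact hy.trans hy'.symm
  have h := hSample.absolutelyContinuous 1 k o (hsub.measure_zero volume)
  rw [Measure.map_apply (hSample.measurable 1 k o) hsub.measurableSet] at h
  refine measure_mono_null (fun ω hω => ?_) h
  have := inner_eigvec_sub_mean h2 h3 1 k o ω 0
  simp only [Set.mem_ofPred_eq, Set.mem_preimage] at hω ⊢
  rw [this, ← hω]
  rfl

omit [IsProbabilityMeasure P] in
lemma iIndepFun_leading_scores (hSample : M.IsSample P) (h3 : M.Scores P) :
    iIndepFun (fun o : (k : Fin 2) × Option (Fin (n k)) => M.z o.1 o.2 0) P := by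
  have h := (hSample.indep 1).comp
    (fun o x => ⟪M.eigvec 1 o.1 0, x - M.mean 1 o.1⟫ / √(M.eigval 1 o.1 0))
    (fun o => by fun_prop)
  refine cast (congrArg (fun f => iIndepFun f P) ?_) h
  funext o ω
  exact h3.score_eq 1 o.1 o.2 ω 0

/-- A linear form of the leading scores has no atoms. -/
lemma ae_sum_mul_leading_score_ne (hSample : M.IsSample P) (h2 : M.OneStrongSpike c)
    (h3 : M.Scores P) {a : (k : Fin 2) → Option (Fin (n k)) → ℝ} {k : Fin 2}
    {o : Option (Fin (n k))} (ha : a k o ≠ 0) (t : ℝ) :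
    ∀ᵐ ω ∂P, ∑ k, ∑ o, a k o * M.z k o 0 ω ≠ t := by
  have h := ae_sum_mul_ne (a := fun o : (k : Fin 2) × Option (Fin (n k)) => a o.1 o.2)
    (i := ⟨k, o⟩)
    (fun o => measurable_z hSample h3 o.1 o.2 0) (iIndepFun_leading_scores hSample h3)
    (fun o x => measure_leading_score_eq hSample h2 h3 o.1 o.2 x) ha t
  filter_upwards [h] with ω hω
  rwa [Fintype.sum_sigma] at hω

/-- Zero empirical variance in class `k` would force the first two leading scores to coincide, but
their difference is a nontrivial linear form without atoms. -/
lemma ae_mem_goodScores (hSample : M.IsSample P) (h1 : M.MeanDifference c)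
    (h2 : M.OneStrongSpike c) (h3 : M.Scores P) (h5 : M.CommonLeadingSpace c)
    (hn2 : ∀ k, 2 ≤ n k) : ∀ᵐ ω ∂P, M.leadingScores ω ∈ goodScores c n := by
  classical
  obtain ⟨u, hu⟩ := exists_isLeadingBasis h1 h5
  refine ae_all_iff.2 fun k => ?_
  have hk := hn2 k
  have hne : (⟨0, by omega⟩ : Fin (n k)) ≠ ⟨1, by omega⟩ := by simp
  filter_upwards [ae_sum_mul_leading_score_ne hSample h2 h3 (k := k) (o := some ⟨0, by omega⟩)
    (a := fun k' o => if k' = k then o.elim 0 fun j =>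
      if (j : ℕ) = 0 then 1 else if (j : ℕ) = 1 then -1 else 0 else 0) (by simp) 0] with ω hω
  refine (blockDot_self_nonneg k).lt_of_ne fun h => hω ?_
  have hw := eq_zero_of_blockDot_self h.symm
  have hR : c.R k * √(c.σsq k) ≠ 0 := by
    refine mul_ne_zero (fun h => ?_) (Real.sqrt_pos.2 (h2.σsq_pos k)).ne'
    simpa [h] using hu.sq_R k
  have hj : ∀ j, M.z k (some j) 0 ω = (n k : ℝ)⁻¹ * ∑ j', M.z k (some j') 0 ω := by
    intro j
    have := congrFun hw j
    simp only [limW, leadingScores, Pi.zero_apply, mul_eq_zero, hR, false_or] at this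
    linarith
  rw [Finset.sum_eq_single k]
  · simp only [if_true, Fintype.sum_option, Option.elim_none, Option.elim_some, zero_mul, zero_add]
    rw [← Finset.add_sum_erase _ _ (Finset.mem_univ ⟨0, by omega⟩),
      ← Finset.add_sum_erase _ _ (Finset.mem_erase.2 ⟨hne.symm, Finset.mem_univ _⟩),
      Finset.sum_eq_zero]
    · simp [hj ⟨0, by omega⟩, hj ⟨1, by omega⟩]
    · intro j hj
      simp only [Finset.mem_erase, ne_eq, Fin.ext_iff] at hj
      simp [hj.1, hj.2.1]
  · intro k' _ hk'
    simp [hk']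
  · simp

/-- Without this the two distances would agree whatever the `Φ_k` are. The quantity is a nonconstant
affine form in the leading scores, so it has no atom at `0`. -/
lemma ae_limProj_meanCoef_ne_zero (hSample : M.IsSample P) (h1 : M.MeanDifference c)
    (h2 : M.OneStrongSpike c) (h3 : M.Scores P) (h5 : M.CommonLeadingSpace c)
    (hn2 : ∀ k, 2 ≤ n k) :
    ∀ᵐ ω ∂P, limProj c 1 (meanCoef n) (M.leadingScores ω) ≠ 0 := by
  obtain ⟨u, hu⟩ := exists_isLeadingBasis h1 h5
  have hk := hn2 0
  have hR : c.R 0 ≠ 0 := fun h => by simpa [h] using hu.sq_R 0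
  have hσ := (Real.sqrt_pos.2 (h2.σsq_pos 0)).ne'
  filter_upwards [ae_sum_mul_leading_score_ne hSample h2 h3 (k := 0) (o := some ⟨0, by omega⟩)
    (a := fun k o => c.R k * √(c.σsq k) * meanCoef n k o)
    (mul_ne_zero (mul_ne_zero hR hσ) (by simp [meanCoef, classSign]; omega))
    (-(c.δ * Real.cos c.θ))] with ω hω h
  refine hω ?_
  simp only [limProj, one_mul, leadingScores, Finset.mul_sum, ← mul_assoc] at h
  linarith

omit [MeasurableSpace Ω] in
/-- `Φ` is `σ²` times the sum of the squared deviations of the leading scores from their mean. -/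
lemma Φ_eq (hn : ∀ k, (n k : ℝ) ≠ 0) (h2 : M.OneStrongSpike c) (k : Fin 2) (ω : Ω) :
    M.Φ c k ω = c.σsq k * ∑ j : Fin (n k),
      (M.z k (some j) 0 ω - (n k : ℝ)⁻¹ * ∑ j', M.z k (some j') 0 ω) ^ 2 := by
  have hk := hn k
  have hs := Real.mul_self_sqrt (h2.σsq_pos k).le
  simp only [Φ, Matrix.sub_mulVec, Matrix.one_mulVec, Matrix.smul_mulVec]
  simp only [dotProduct, Pi.sub_apply, Pi.smul_apply, smul_eq_mul, Matrix.mulVec, Matrix.of_apply,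
    one_mul]
  rw [← Finset.mul_sum]
  set s := √(c.σsq k)
  set T := ∑ j : Fin (n k), M.z k (some j) 0 ω
  rw [← hs, Finset.mul_sum _ _ (s * s)]
  have e1 : ∀ j, s * M.z k (some j) 0 ω * (s * M.z k (some j) 0 ω - (n k : ℝ)⁻¹ * (s * T)) =
      s * s * (M.z k (some j) 0 ω - (n k : ℝ)⁻¹ * T) ^ 2 +
        s * s * ((n k : ℝ)⁻¹ * T) * (M.z k (some j) 0 ω - (n k : ℝ)⁻¹ * T) := fun j => by ring
  simp only [e1]
  rw [Finset.sum_add_distrib, add_eq_left, ← Finset.mul_sum, Finset.sum_sub_distrib,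
    Finset.sum_const, Finset.card_univ, Fintype.card_fin, nsmul_eq_mul, mul_inv_cancel_left₀ hk,
    sub_self, mul_zero]

omit [MeasurableSpace Ω] in
lemma blockDot_limW_leadingScores (hn : ∀ k, (n k : ℝ) ≠ 0) (h1 : M.MeanDifference c)
    (h2 : M.OneStrongSpike c) (h5 : M.CommonLeadingSpace c) (k : Fin 2) (ω : Ω) :
    blockDot k (limW c (M.leadingScores ω)) (limW c (M.leadingScores ω)) = M.Φ c k ω := by
  obtain ⟨u, hu⟩ := exists_isLeadingBasis h1 h5
  rw [Φ_eq hn h2, blockDot, Finset.mul_sum]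
  refine Finset.sum_congr rfl fun j _ => ?_
  simp only [limW, leadingScores]
  -- The sign `R k` disappears on squaring.
  linear_combination (√(c.σsq k) ^ 2 * hu.sq_R k + Real.sq_sqrt (h2.σsq_pos k).le) *
    (M.z k (some j) 0 ω - (n k : ℝ)⁻¹ * ∑ j', M.z k (some j') 0 ω) ^ 2

end Model

end LeadingScores

/-! ### The chi-squared law of a sum of squared deviations -/

section Cochran

lemma sum_sq_deviation {m : ℕ} (x : Fin m → ℝ) :
    ∑ j, (x j - (m : ℝ)⁻¹ * ∑ j', x j') ^ 2 = ∑ j, x j ^ 2 - (m : ℝ)⁻¹ * (∑ j, x j) ^ 2 := by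
  rcases Nat.eq_zero_or_pos m with rfl | hm
  · simp
  have hm' : (m : ℝ) ≠ 0 := by positivity
  have e1 : ∀ j, (x j - (m : ℝ)⁻¹ * ∑ j', x j') ^ 2 = x j ^ 2 -
      2 * ((m : ℝ)⁻¹ * ∑ j', x j') * x j + ((m : ℝ)⁻¹ * ∑ j', x j') ^ 2 := fun j => by ring
  simp only [e1]
  rw [Finset.sum_add_distrib, Finset.sum_sub_distrib, ← Finset.mul_sum, Finset.sum_const,
    Finset.card_univ, Fintype.card_fin, nsmul_eq_mul]
  field_simp
  ring

/-- The sum of squared deviations from the mean of `d + 1` independent standard normal variables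
has a chi-squared distribution with `d` degrees of freedom. -/
lemma map_sum_sq_deviation_succ (d : ℕ) :
    (Measure.pi fun _ : Fin (d + 1) => gaussianReal 0 1).map
      (fun x => ∑ j, (x j - ((d + 1 : ℕ) : ℝ)⁻¹ * ∑ j', x j') ^ 2) = chiSquared d := by
  have hd : (0 : ℝ) < ((d + 1 : ℕ) : ℝ) := by positivity
  -- The sum of squared deviations is the squared length minus the squared component along this
  -- normalised constant vector. The standard Gaussian is rotation invariant, so in a basis starting
  -- with `v` one coordinate simply drops out.
  set v : E (d + 1) := WithLp.toLp 2 fun _ => (√((d + 1 : ℕ) : ℝ))⁻¹ with hv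
  have hvn : ‖v‖ = 1 := by
    rw [EuclideanSpace.norm_eq, Real.sqrt_eq_one]
    simp only [hv, Finset.sum_const, Finset.card_univ, Fintype.card_fin, nsmul_eq_mul]
    rw [Real.norm_eq_abs, sq_abs, inv_pow, Real.sq_sqrt hd.le, mul_inv_cancel₀ hd.ne']
  obtain ⟨b, hb⟩ := Orthonormal.exists_orthonormalBasis_extension_of_card_eq (𝕜 := ℝ)
    (E := E (d + 1)) (ι := Fin (d + 1)) (by simp) (v := fun _ => v) (s := {0}) (by
      refine ⟨fun i => hvn, fun i j hij => absurd (Subsingleton.elim i j) hij⟩)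
  have hb0 : b 0 = v := hb 0 rfl
  set F : E (d + 1) → ℝ := fun y => ‖y‖ ^ 2 - ⟪v, y⟫ ^ 2 with hF
  have hFm : Measurable F := by rw [hF]; fun_prop
  have h1 : (fun x : Fin (d + 1) → ℝ => ∑ j, (x j - ((d + 1 : ℕ) : ℝ)⁻¹ * ∑ j', x j') ^ 2) =
      F ∘ WithLp.toLp 2 := by
    funext x
    rw [sum_sq_deviation]
    simp only [hF, hv, Function.comp_apply, EuclideanSpace.norm_sq_eq, Real.norm_eq_abs, sq_abs,
      PiLp.inner_apply, RCLike.inner_apply, conj_trivial]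
    rw [← Finset.sum_mul, mul_pow, inv_pow, Real.sq_sqrt hd.le, mul_comm ((_ : ℝ) ^ 2)]
  have h2 : F ∘ (fun x : Fin (d + 1) → ℝ => ∑ i, x i • b i) =
      (fun y : Fin d → ℝ => ∑ i, y i ^ 2) ∘ Prod.snd ∘
        MeasurableEquiv.piFinSuccAbove (fun _ => ℝ) 0 := by
    funext x
    have hn : ‖∑ i, x i • b i‖ ^ 2 = ∑ i, x i ^ 2 := by
      rw [← real_inner_self_eq_norm_sq, b.orthonormal.inner_sum]
      simp [sq]
    have hi : ⟪v, ∑ i, x i • b i⟫ = x 0 := by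
      rw [← hb0, b.orthonormal.inner_right_fintype]
    simp only [Function.comp_apply, hF, hn, hi]
    rw [Fin.sum_univ_succ, add_sub_cancel_left]
    rfl
  have hmb : Measurable fun x : Fin (d + 1) → ℝ => ∑ i, x i • b i := by fun_prop
  have hm2 : Measurable fun y : Fin d → ℝ => ∑ i, y i ^ 2 := by fun_prop
  rw [h1, ← Measure.map_map hFm (WithLp.measurable_toLp 2 _), map_pi_eq_stdGaussian,
    stdGaussian_eq_map_pi_orthonormalBasis b, Measure.map_map hFm hmb, h2,
    ← Measure.map_map hm2 (measurable_snd.comp (MeasurableEquiv.measurable _)),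
    ← Measure.map_map measurable_snd (MeasurableEquiv.measurable _),
    (measurePreserving_piFinSuccAbove (fun _ => gaussianReal 0 1) 0).map_eq, Measure.map_snd_prod]
  simp [chiSquared]

lemma map_sum_sq_deviation {m : ℕ} (hm : m ≠ 0) :
    (Measure.pi fun _ : Fin m => gaussianReal 0 1).map
      (fun x => ∑ j, (x j - (m : ℝ)⁻¹ * ∑ j', x j') ^ 2) = chiSquared (m - 1) := by
  obtain ⟨d, rfl⟩ := Nat.exists_eq_succ_of_ne_zero hm
  exact map_sum_sq_deviation_succ d

end Cochran

/-! ### The Gaussian case -/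

section Gaussian

variable {Ω : Type*} {n : Fin 2 → ℕ} {M : Model Ω n} {c : Params}

namespace Model

/-- The sum of the squared deviations of the leading scores of class `k` from their mean. -/
noncomputable def scoreScatter (M : Model Ω n) (k : Fin 2) (ω : Ω) : ℝ :=
  ∑ j : Fin (n k), (M.z k (some j) 0 ω - (n k : ℝ)⁻¹ * ∑ j', M.z k (some j') 0 ω) ^ 2

variable [MeasurableSpace Ω] {P : Measure Ω}

lemma measurable_scoreScatter (hSample : M.IsSample P) (h3 : M.Scores P) (k : Fin 2) :
    Measurable (M.scoreScatter k) := by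
  have := fun j => measurable_z hSample h3 k (some j) 0
  unfold scoreScatter
  fun_prop

lemma indepFun_scoreScatter (hSample : M.IsSample P) (h3 : M.Scores P) :
    IndepFun (M.scoreScatter 0) (M.scoreScatter 1) P := by
  classical
  have hdisj : Disjoint (Finset.univ.filter fun o : (k : Fin 2) × Option (Fin (n k)) => o.1 = 0)
      (Finset.univ.filter fun o : (k : Fin 2) × Option (Fin (n k)) => o.1 = 1) :=
    Finset.disjoint_filter.2 fun o _ h0 h1 => by simp [h0] at h1
  have h := (iIndepFun_leading_scores hSample h3).indepFun_finset _ _ hdisj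
    fun o => measurable_z hSample h3 o.1 o.2 0
  have hm : ∀ (k : Fin 2), Measurable fun y : (Finset.univ.filter
      fun o : (k : Fin 2) × Option (Fin (n k)) => o.1 = k) → ℝ =>
      ∑ j : Fin (n k), (y ⟨⟨k, some j⟩, by simp⟩ -
        (n k : ℝ)⁻¹ * ∑ j', y ⟨⟨k, some j'⟩, by simp⟩) ^ 2 := by
    intro k
    fun_prop
  exact h.comp (hm 0) (hm 1)

variable [IsProbabilityMeasure P]

/-- Gaussianity in dimension `1` suffices, since the leading score is an affine function of that
observation. -/
lemma map_leading_score (hSample : M.IsSample P) (h2 : M.OneStrongSpike c) (h3 : M.Scores P)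
    {k : Fin 2} {o : Option (Fin (n k))} (hG : HasGaussianLaw (M.X 1 k o) P) :
    P.map (M.z k o 0) = gaussianReal 0 1 := by
  have hz : M.z k o 0 = ((√(M.eigval 1 k 0))⁻¹ • innerSL ℝ (M.eigvec 1 k 0)) ∘
      (fun x => x - M.mean 1 k) ∘ M.X 1 k o := by
    funext ω
    have := h3.score_eq 1 k o ω 0
    simp only [Fin.val_zero] at this
    rw [← this]
    simp [div_eq_inv_mul]
  have hgauss : HasGaussianLaw (M.z k o 0) P := by
    refine ⟨?_⟩
    have := hG.isGaussian_map
    have hsub : Measurable fun x : E 1 => x - M.mean 1 k := measurable_id.sub_const _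
    rw [hz, ← Measure.map_map (ContinuousLinearMap.measurable _)
      (hsub.comp (hSample.measurable 1 k o)),
      ← Measure.map_map hsub (hSample.measurable 1 k o)]
    infer_instance
  have hvar : Var[M.z k o 0; P] = 1 := by
    rw [variance_of_integral_eq_zero (measurable_z hSample h3 k o 0).aemeasurable
      (integral_z hSample h3 k o 0)]
    simpa [sq] using integral_z_mul_z hSample h2 h3 k o 0 0
  rw [hgauss.map_eq_gaussianReal, integral_z hSample h3, hvar, Real.toNNReal_one]

lemma map_scoreScatter (hSample : M.IsSample P) (h2 : M.OneStrongSpike c) (h3 : M.Scores P)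
    (hn2 : ∀ k, 2 ≤ n k) (hG : ∀ k o, HasGaussianLaw (M.X 1 k o) P) (k : Fin 2) :
    P.map (M.scoreScatter k) = chiSquared (n k - 1) := by
  have hm := fun j : Fin (n k) => measurable_z hSample h3 k (some j) 0
  have hind : iIndepFun (fun j : Fin (n k) => M.z k (some j) 0) P :=
    (iIndepFun_leading_scores hSample h3).precomp
      (g := fun j : Fin (n k) => (⟨k, some j⟩ : (k : Fin 2) × Option (Fin (n k))))
      fun i j hij => by simpa using hij
  have h := (iIndepFun_iff_map_fun_eq_pi_map fun j => (hm j).aemeasurable).1 hind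
  simp only [map_leading_score hSample h2 h3 (hG k _)] at h
  have hk := hn2 k
  rw [← map_sum_sq_deviation (by omega), ← h, Measure.map_map (by fun_prop) (by fun_prop)]
  rfl

/-- In the Gaussian case the comparison of the scaled variances is governed by an `F`
distribution. -/
lemma measure_Φ_le_eq_fDistribution (hSample : M.IsSample P) (h1 : M.MeanDifference c)
    (h2 : M.OneStrongSpike c) (h3 : M.Scores P) (h5 : M.CommonLeadingSpace c)
    (hn2 : ∀ k, 2 ≤ n k) (hG : ∀ k o, HasGaussianLaw (M.X 1 k o) P) :
    P {ω | (c.τsq 0)⁻¹ * M.Φ c 0 ω ≤ (c.τsq 1)⁻¹ * M.Φ c 1 ω} =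
      fDistribution (n 0 - 1) (n 1 - 1) (Set.Iic ((((n 1 : ℝ) - 1) * (c.τsq 1)⁻¹ * c.σsq 1) /
        (((n 0 : ℝ) - 1) * (c.τsq 0)⁻¹ * c.σsq 0))) := by
  have hn : ∀ k, (n k : ℝ) ≠ 0 := fun k => by have := hn2 k; positivity
  have hm := measurable_scoreScatter hSample h3
  have hmF : Measurable fun v : ℝ × ℝ => (v.1 / (n 0 - 1 : ℕ)) / (v.2 / (n 1 - 1 : ℕ)) := by
    fun_prop
  rw [fDistribution, ← map_scoreScatter hSample h2 h3 hn2 hG 0,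
    ← map_scoreScatter hSample h2 h3 hn2 hG 1, ← (indepFun_iff_map_prod_eq_prod_map_map
      (hm 0).aemeasurable (hm 1).aemeasurable).1 (indepFun_scoreScatter hSample h3),
    Measure.map_map hmF ((hm 0).prodMk (hm 1)),
    Measure.map_apply (hmF.comp ((hm 0).prodMk (hm 1))) measurableSet_Iic]
  refine measure_congr ?_
  -- Clearing denominators in the `F` statistic needs a positive scatter in the second class, which
  -- holds only almost surely.
  filter_upwards [ae_mem_goodScores hSample h1 h2 h3 h5 hn2] with ω hω
  have hpos := hω 1
  have hσ := h2.σsq_pos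
  have hτ := h2.τsq_pos
  have hsc : ∀ k, M.Φ c k ω = c.σsq k * M.scoreScatter k ω := fun k => Φ_eq hn h2 k ω
  rw [blockDot_limW_leadingScores hn h1 h2 h5, hsc] at hpos
  have hV := (mul_pos_iff_of_pos_left (hσ 1)).1 hpos
  have hd : ∀ k, (0 : ℝ) < (n k : ℝ) - 1 := fun k => by
    have : (2 : ℝ) ≤ n k := by exact_mod_cast hn2 k
    linarith
  have hc : ∀ k, ((n k - 1 : ℕ) : ℝ) = (n k : ℝ) - 1 := fun k => by
    rw [Nat.cast_sub (by have := hn2 k; omega), Nat.cast_one]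
  refine propext ?_
  change (c.τsq 0)⁻¹ * M.Φ c 0 ω ≤ (c.τsq 1)⁻¹ * M.Φ c 1 ω ↔
    (M.scoreScatter 0 ω / (n 0 - 1 : ℕ)) / (M.scoreScatter 1 ω / (n 1 - 1 : ℕ)) ≤ _
  rw [hc, hc, hsc, hsc]
  have h0 := hd 0
  have h1 := hd 1
  have hσ0 := hσ 0
  have hτ0 := hτ 0
  have hσ1 := hσ 1
  have hτ1 := hτ 1
  generalize M.scoreScatter 0 ω = V₀ at *
  generalize M.scoreScatter 1 ω = V₁ at *
  generalize (n 0 : ℝ) - 1 = d₀ at *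
  generalize (n 1 : ℝ) - 1 = d₁ at *
  rw [div_div_div_eq, div_le_div_iff₀ (by positivity) (by positivity),
    show V₀ * d₁ * (d₀ * (c.τsq 0)⁻¹ * c.σsq 0) =
      (d₀ * d₁) * ((c.τsq 0)⁻¹ * (c.σsq 0 * V₀)) by ring,
    show d₁ * (c.τsq 1)⁻¹ * c.σsq 1 * (d₀ * V₁) =
      (d₀ * d₁) * ((c.τsq 1)⁻¹ * (c.σsq 1 * V₁)) by ring,
    mul_le_mul_iff_right₀ (by positivity)]

end Model

end Gaussian

/-! ### Comparison of the two distances -/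

section Comparison

variable {Ω : Type*} {n : Fin 2 → ℕ} {M : Model Ω n} {c : Params}

namespace Model

/-- The asymptotic distances of the two ridge directions compare as the scaled variances. -/
lemma limDist_le_limDist_iff (h1 : M.MeanDifference c) (h2 : M.OneStrongSpike c)
    (h5 : M.CommonLeadingSpace c) (hn2 : ∀ k, 2 ≤ n k) (hθ : 0 < c.θ)
    {z : (k : Fin 2) → Option (Fin (n k)) → ℝ} (hz : z ∈ goodScores c n)
    (hκ : limProj c 1 (meanCoef n) z ≠ 0) :
    limDist c 0 z ≤ limDist c 1 z ↔
      (c.τsq 0)⁻¹ * blockDot 0 (limW c z) (limW c z) ≤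
        (c.τsq 1)⁻¹ * blockDot 1 (limW c z) (limW c z) := by
  have hs : 0 < Real.sin c.θ := Real.sin_pos_of_pos_of_lt_pi hθ
    (h5.mem.2.trans_lt (by linarith [Real.pi_pos]))
  have hδ := h1.δ_pos
  have hpos := limNoise_pos h2 hn2
  have hκ2 : 0 < limProj c 1 (meanCoef n) z ^ 2 := by positivity
  have hτ0 := h2.τsq_pos 0
  have hτ1 := h2.τsq_pos 1
  have hb0 := hz 0
  have hb1 := hz 1
  -- The common numerator is positive because `θ > 0`, so the order of the distances is the reverse
  -- of the order of `τ_k / Φ_k`.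
  rw [limDist, limDist, div_le_div_iff_of_pos_left (by positivity) (by positivity) (by positivity),
    Real.sqrt_le_sqrt_iff (by positivity), add_le_add_iff_left, mul_le_mul_iff_right₀ hκ2,
    div_le_div_iff₀ hb1 hb0, inv_mul_eq_div, inv_mul_eq_div, div_le_div_iff₀ hτ0 hτ1]
  constructor <;> intro h <;> linarith

end Model

end Comparison

end HDLSS

theorem mainTheorem10 {Ω : Type*} [MeasurableSpace Ω] (P : Measure Ω) [IsProbabilityMeasure P]
    (n : Fin 2 → ℕ) (hn : ∀ k, 2 ≤ n k)
    (M : HDLSS.Model Ω n) (c : HDLSS.Params)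
    (hSample : M.IsSample P) (h1 : M.MeanDifference c) (h2 : M.OneStrongSpike c)
    (h3 : M.Scores P) (h4 : M.LeadingAngles c) (h5 : M.CommonLeadingSpace c)
    (hτ : c.τsq 1 < c.τsq 0)
    (S : HDLSS.SampleEigen Ω) (hS : S.IsEigenOf M)
    (αhat : Fin 2 → ℕ → Ω → ℝ)
    (hα : ∀ k, TendstoInMeasure P (αhat k) atTop (fun _ => -c.τsq k)) :
    (∃ D : Fin 2 → Ω → ℝ, ∀ k, Measurable (D k) ∧
      HDLSS.IsAsymptoticDistance P M
        (fun p ω => HDLSS.projectedRidge P M S p (αhat k p ω) ω) (D k)) ∧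
    (0 < c.θ → ∀ D : Fin 2 → Ω → ℝ,
      (∀ k, HDLSS.IsAsymptoticDistance P M
        (fun p ω => HDLSS.projectedRidge P M S p (αhat k p ω) ω) (D k)) →
      ∀ᵐ ω ∂P,
        (D 0 ω ≤ D 1 ω ↔ (c.τsq 0)⁻¹ * M.Φ c 0 ω ≤ (c.τsq 1)⁻¹ * M.Φ c 1 ω) ∧
        (D 1 ω < D 0 ω ↔ (c.τsq 1)⁻¹ * M.Φ c 1 ω < (c.τsq 0)⁻¹ * M.Φ c 0 ω)) ∧
    ((∀ p k o, HasGaussianLaw (M.X p k o) P) →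
      P {ω | (c.τsq 0)⁻¹ * M.Φ c 0 ω ≤ (c.τsq 1)⁻¹ * M.Φ c 1 ω} =
        HDLSS.fDistribution (n 0 - 1) (n 1 - 1)
          (Set.Iic ((((n 1 : ℝ) - 1) * (c.τsq 1)⁻¹ * c.σsq 1) /
            (((n 0 : ℝ) - 1) * (c.τsq 0)⁻¹ * c.σsq 0)))) := by
  have hn0 : ∀ k, (n k : ℝ) ≠ 0 := fun k => by have := hn k; positivity
  have hgood := HDLSS.Model.ae_mem_goodScores hSample h1 h2 h3 h5 hn
  have hdist := fun k => HDLSS.Model.isAsymptoticDistance_limDist hSample h1 h2 h3 h5 hτ hn hS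
    hgood k (hα k)
  refine ⟨⟨_, fun k => ⟨(HDLSS.Model.measurable_limDist c k).comp
    (HDLSS.Model.measurable_leadingScores hSample h3), hdist k⟩⟩, fun hθ D hD => ?_, fun hG =>
    HDLSS.Model.measure_Φ_le_eq_fDistribution hSample h1 h2 h3 h5 hn (hG 1)⟩
  -- Limits in probability are almost surely unique, so any `D` may be replaced by the explicit
  -- formula.
  have heq := fun k => tendstoInMeasure_ae_unique (hD k) (hdist k)
  filter_upwards [hgood, HDLSS.Model.ae_limProj_meanCoef_ne_zero hSample h1 h2 h3 h5 hn,
    heq 0, heq 1] with ω hω hκ h0 h1'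
  have key := HDLSS.Model.limDist_le_limDist_iff h1 h2 h5 hn hθ hω hκ
  rw [HDLSS.Model.blockDot_limW_leadingScores hn0 h1 h2 h5,
    HDLSS.Model.blockDot_limW_leadingScores hn0 h1 h2 h5] at key
  rw [h0, h1', ← not_le, ← not_le (a := (c.τsq 0)⁻¹ * M.Φ c 0 ω)]
  exact ⟨key, not_congr key⟩
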